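/- **Setting.** Let $d\in\{1,2\}$, let $\Omega\subset\mathbb R^d$ be a bounded domain, and let $(\cdot,\cdot)$, $\|\cdot\|$ be the inner product and norm of $L^2(\Omega)$. Let $A v=-\sum_{i,j}\partial_i(a_{ij}\partial_j v)+b\,v$ with homogeneous Dirichlet condition be a self-adjoint, positive definite, uniformly elliptic operator with bounded measurable real coefficients, and let $A(\cdot,\cdot)$ be its form on $H^1_0(\Omega)$. Let $X_h\subset H_0^1(\Omega)$ be the space of continuous piecewise linear finite elements on a triangulation by $d$-simplices contained in $\overline\Omega$ (extended by zero outside it), $P_h:L^2(\Omega)\to X_h$ the $L^2$ projection, and $A_h:X_h\to X_h$ given by $(A_h\varphi,\psi)=A(\varphi,\psi)$ for $\varphi,\psi\in X_h$. Let $0<\alpha<1$, $T>0$, and let ${}^{C}D_t^\alpha U(t)=\frac1{\Gamma(1-\alpha)}\int_0^t(t-\zeta)^{-\alpha}U'(\zeta)\,d\zeta$ be the Caputo derivative. **Assumption on the source.** $f\in L^1(0,T;L^2(\Omega))$ is (the restriction of) a function on $(0,\infty)$ whose Laplace transform $\hat f(s)=\int_0^\infty e^{-st}f(t)\,dt$ converges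 absolutely in some right half plane and extends analytically to $\Sigma_\theta^\varepsilon=\{z\in\mathbb C:|z|\ge\varepsilon,\ |\arg z|<\theta\}$ for some $\theta\in(\pi/2,\pi)$ and $\varepsilon>0$, with $\|\hat f(s)\|\le C|s|^{-\mu-1}$ there, for some $\mu>-1$. **Semidiscrete solution.** With $f_h=P_hf$ and zero initial data, $u_h\in C((0,T];X_h)\cap L^1(0,T;X_h)$ solves ${}^{C}D_t^\alpha u_h+A_hu_h=f_h$, $u_h(0)=0$, in the integrated sense: $U_h(t)=\int_0^tu_h$ and $F_h(t)=\int_0^tf_h$ satisfy ${}^{C}D_t^\alpha U_h+A_hU_h=F_h$ on $(0,T]$. **Scheme CN-II.** Let $N\ge1$, $\tau=T/N$, $t_n=n\tau$, $\tilde F_h(t)=\int_0^tF_h$ for $t>0$ and $\tilde F_h(t)=0$ for $t\le0$, $D_\tau v(t)=\tau^{-1}\big(\tfrac32v(t)-2v(t-\tau)+\tfrac12v(t-2\tau)\big)$, and $\sigma_0=1$, $\sigma_j=(1-\frac{\alpha+1}{j})\sigma_{j-1}$. With $\tilde U_h^k=0$ for $k\le0$, the values $\tilde U_h^n,\tilde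 u_h^n\in X_h$, $1\le n\le N$, are given by $$\tau^{-\alpha}\sum_{j=0}^n\sigma_j\tilde U_h^{n-j}+\big(1-\tfrac\alpha2\big)A_h\tilde U_h^n+\tfrac\alpha2A_h\tilde U_h^{n-1}=\big(1-\tfrac\alpha2\big)D_\tau\tilde F_h(t_n)+\tfrac\alpha2D_\tau\tilde F_h(t_{n-1}),$$ $$\tilde u_h^n=\tau^{-1}\big(\tfrac32\tilde U_h^n-2\tilde U_h^{n-1}+\tfrac12\tilde U_h^{n-2}\big).$$ **Theorem.** For all $\alpha,\mu,\theta,\varepsilon,C,T$ as above there is a constant $c$, depending only on these numbers (and so not on the mesh, $N$, $n$, $\Omega$, $A$ or the particular $f$), such that $$\|u_h(t_n)-\tilde u_h^n\|\le c\,t_n^{\alpha+\mu-2}\,\tau^2,\qquad n=1,\dots,N.$$ Moreover, for $-1<\mu<0$ and $g\in L^2(\Omega)$ the singular source $f(x,t)=t^\mu g(x)$ satisfies the assumption, for every $\theta\in(\pi/2,\pi)$ and $\varepsilon>0$, with $C=\Gamma(\mu+1)\|g\|$. -/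

import Mathlib

open MeasureTheory Set
open scoped ContDiff

noncomputable section

namespace SubdiffusionCN

/-- The points of `ℝ^d`, with the Euclidean norm. -/
abbrev Pt (d : ℕ) : Type := EuclideanSpace ℝ (Fin d)

/-- `L²(Ω)`. Complex-valued functions are used because the Laplace transform of a source takes
complex values; real-valued data are a special case. -/
abbrev L2 {d : ℕ} (Ω : Set (Pt d)) : Type := Lp ℂ 2 (volume.restrict Ω)

/-- The space `L²(Ω) × L²(Ω)^d` of pairs (function, gradient). -/
abbrev FunGrad {d : ℕ} (Ω : Set (Pt d)) : Type := L2 Ω × (Fin d → L2 Ω)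

/-- `H¹₀(Ω)`, the closure of the smooth functions with compact support in `Ω` in the `H¹` norm.
An element is the pair `(v, ∇v)` of a function and its weak gradient. -/
def H10 {d : ℕ} (Ω : Set (Pt d)) : Submodule ℂ (FunGrad Ω) :=
  (Submodule.span ℂ {p : FunGrad Ω | ∃ φ : Pt d → ℂ,
    ContDiff ℝ ∞ φ ∧ HasCompactSupport φ ∧ tsupport φ ⊆ Ω ∧
    (p.1 =ᵐ[volume.restrict Ω] φ) ∧
    ∀ i, p.2 i =ᵐ[volume.restrict Ω]
      fun x => fderiv ℝ φ x (EuclideanSpace.single i (1 : ℝ))}).topologicalClosure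

/-- The form `A(p, q) = ∫_Ω ∑ᵢⱼ aᵢⱼ ∂ⱼp ∂ᵢq̄ + b p q̄` of the second-order operator
`A v = -∑ᵢⱼ ∂ᵢ(aᵢⱼ ∂ⱼv) + b v`. -/
def energyForm {d : ℕ} (Ω : Set (Pt d)) (a : Pt d → Matrix (Fin d) (Fin d) ℝ) (b : Pt d → ℝ)
    (p q : FunGrad Ω) : ℂ :=
  ∫ x in Ω, ((∑ i, ∑ j, (a x i j : ℂ) * p.2 j x * starRingEnd ℂ (q.2 i x))
    + (b x : ℂ) * p.1 x * starRingEnd ℂ (q.1 x))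

/-- The operator `A v = -∑ᵢⱼ ∂ᵢ(aᵢⱼ ∂ⱼv) + b v` with homogeneous Dirichlet condition has bounded
measurable real coefficients, and is self-adjoint, uniformly elliptic and positive definite. -/
structure IsEllipticPosDef {d : ℕ} (Ω : Set (Pt d)) (a : Pt d → Matrix (Fin d) (Fin d) ℝ)
    (b : Pt d → ℝ) : Prop where
  aemeasurable_a : ∀ i j, AEMeasurable (fun x => a x i j) (volume.restrict Ω)
  aemeasurable_b : AEMeasurable b (volume.restrict Ω)
  bounded : ∃ M : ℝ, ∀ᵐ x ∂(volume.restrict Ω), (∀ i j, |a x i j| ≤ M) ∧ |b x| ≤ M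
  symmetric : ∀ᵐ x ∂(volume.restrict Ω), ∀ i j, a x i j = a x j i
  elliptic : ∃ κ : ℝ, 0 < κ ∧ ∀ᵐ x ∂(volume.restrict Ω), ∀ ξ : Fin d → ℝ,
    κ * ∑ i, ξ i ^ 2 ≤ ∑ i, ∑ j, a x i j * ξ i * ξ j
  pos_def : ∀ p ∈ H10 Ω, p.1 ≠ 0 → 0 < (energyForm Ω a b p p).re

/-- `K` is a (conforming, finite) triangulation by `d`-simplices contained in `closure Ω`.
For a polygonal `Ω` the simplices may cover all of `closure Ω`; for a curved domain they cover
an inscribed polygon. -/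
structure IsTriangulation {d : ℕ} (Ω : Set (Pt d)) (K : Geometry.SimplicialComplex ℝ (Pt d)) :
    Prop where
  finite : K.faces.Finite
  pure : ∀ s ∈ K.faces, ∃ t ∈ K.faces, s ⊆ t ∧ t.card = d + 1
  subset : K.space ⊆ closure Ω

/-- The finite element space `X_h ⊂ H¹₀(Ω)` of the continuous functions that are affine on each
simplex of `K` (and vanish outside of the triangulated region). -/
def feSpace {d : ℕ} (Ω : Set (Pt d)) (K : Geometry.SimplicialComplex ℝ (Pt d)) :
    Submodule ℂ (FunGrad Ω) where
  carrier := {p | p ∈ H10 Ω ∧ ∃ v : Pt d → ℂ, Continuous v ∧ (p.1 =ᵐ[volume.restrict Ω] v) ∧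
    (∀ x, x ∉ K.space → v x = 0) ∧
    ∀ s ∈ K.faces, ∃ L : Pt d →ᵃ[ℝ] ℂ, EqOn v L (convexHull ℝ (s : Set (Pt d)))}
  zero_mem' := by
    refine ⟨Submodule.zero_mem _, fun _ => 0, continuous_const, ?_, fun _ _ => rfl,
      fun s _ => ⟨0, fun _ _ => rfl⟩⟩
    exact Lp.coeFn_zero ℂ 2 (volume.restrict Ω)
  add_mem' := by
    rintro p q ⟨hp, v, hv, hpv, hv0, hvK⟩ ⟨hq, w, hw, hqw, hw0, hwK⟩
    refine ⟨Submodule.add_mem _ hp hq, v + w, hv.add hw, ?_, ?_, ?_⟩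
    · exact (Lp.coeFn_add p.1 q.1).trans (hpv.add hqw)
    · intro x hx
      simp [hv0 x hx, hw0 x hx]
    · intro s hs
      obtain ⟨L, hL⟩ := hvK s hs
      obtain ⟨M, hM⟩ := hwK s hs
      exact ⟨L + M, fun x hx => by simp [hL hx, hM hx]⟩
  smul_mem' := by
    rintro z p ⟨hp, v, hv, hpv, hv0, hvK⟩
    refine ⟨Submodule.smul_mem _ z hp, z • v, hv.const_smul z, ?_, ?_, ?_⟩
    · exact (Lp.coeFn_smul z p.1).trans (hpv.const_smul z)
    · intro x hx
      simp [hv0 x hx]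
    · intro s hs
      obtain ⟨L, hL⟩ := hvK s hs
      exact ⟨z • L, fun x hx => by simp [hL hx]⟩

/-- The truncated sector `{z : |z| ≥ ε, |arg z| < θ}`. -/
def truncSector (θ ε : ℝ) : Set ℂ := {z | ε ≤ ‖z‖ ∧ |z.arg| < θ}

/-- The Laplace transform `∫₀^∞ e^{-st} f(t) dt`. -/
def laplace {H : Type*} [NormedAddCommGroup H] [NormedSpace ℂ H] (f : ℝ → H) (s : ℂ) : H :=
  ∫ t in Ioi (0 : ℝ), Complex.exp (-(s * t)) • f t

/-- The assumption on the source: `f ∈ L¹(0,T;H)`, its Laplace transform converges absolutely in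
some right half plane and has an analytic continuation `fhat` to `truncSector θ ε`, on which
`‖fhat s‖ ≤ C |s|^(-μ-1)`. -/
def IsSingularSource {H : Type*} [NormedAddCommGroup H] [NormedSpace ℂ H]
    (T θ ε μ C : ℝ) (f : ℝ → H) : Prop :=
  IntegrableOn f (Ioc 0 T) ∧
  ∃ (r : ℝ) (fhat : ℂ → H),
    (∀ s : ℂ, r < s.re → IntegrableOn (fun t : ℝ => Complex.exp (-(s * t)) • f t) (Ioi 0)) ∧
    (∀ s ∈ truncSector θ ε, r < s.re → fhat s = laplace f s) ∧
    DifferentiableOn ℂ fhat (truncSector θ ε) ∧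
    ∀ s ∈ truncSector θ ε, ‖fhat s‖ ≤ C * ‖s‖ ^ (-μ - 1)

/-- The primitive `∫₀ᵗ v` for `t > 0`, prescribed to be zero for `t ≤ 0`. -/
def primitive {H : Type*} [NormedAddCommGroup H] [NormedSpace ℝ H] (v : ℝ → H) (t : ℝ) : H :=
  ∫ ξ in (0 : ℝ)..(max t 0), v ξ

/-- The Caputo derivative `1/Γ(1-α) ∫₀ᵗ (t-ζ)^(-α) U'(ζ) dζ` of a function `U` whose (almost
everywhere) derivative is `U'`. -/
def caputo {H : Type*} [NormedAddCommGroup H] [NormedSpace ℝ H] (α : ℝ) (U' : ℝ → H) (t : ℝ) : H :=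
  (Real.Gamma (1 - α))⁻¹ • ∫ ζ in (0 : ℝ)..t, (t - ζ) ^ (-α) • U' ζ

/-- `u` solves the semidiscrete problem `ᶜDᵗ^α u + A_h u = P_h f`, `u(0) = P_h u⁰` on `(0, T]`, in
its integrated form: `u ∈ C((0,T];X_h) ∩ L¹(0,T;X_h)`, and `U(t) = ∫₀ᵗ u`, `F(t) = ∫₀ᵗ f` satisfy
`ᶜDᵗ^α U + A_h U = P_h F + t^(1-α)/Γ(2-α) P_h u⁰`. The equation in `X_h` is tested with all
`φ ∈ X_h`; recall `(A_h v, φ) = A(v, φ)` and `(P_h g, φ) = (g, φ)`. Here `(v, φ)` is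
`inner ℂ φ v`, which is linear in `v`. The integrated form is needed since `u` may be unbounded
at `t = 0`. -/
structure IsSemidiscreteSolution {d : ℕ} (Ω : Set (Pt d)) (a : Pt d → Matrix (Fin d) (Fin d) ℝ)
    (b : Pt d → ℝ) (K : Geometry.SimplicialComplex ℝ (Pt d)) (α T : ℝ) (u₀ : L2 Ω)
    (f : ℝ → L2 Ω) (u : ℝ → FunGrad Ω) : Prop where
  mem : ∀ t ∈ Ioc 0 T, u t ∈ feSpace Ω K
  continuousOn : ContinuousOn u (Ioc 0 T)
  integrableOn : IntegrableOn u (Ioc 0 T)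
  eq : ∀ t ∈ Ioc 0 T, ∀ φ ∈ feSpace Ω K,
    inner ℂ φ.1 (caputo α u t).1 + energyForm Ω a b (primitive u t) φ
      = inner ℂ φ.1 (primitive f t + (t ^ (1 - α) / Real.Gamma (2 - α)) • u₀)

/-- The second-order backward difference `τ⁻¹ (3/2 v(t) - 2 v(t-τ) + 1/2 v(t-2τ))`. -/
def bdf2 {H : Type*} [AddCommGroup H] [Module ℝ H] (τ : ℝ) (v : ℝ → H) (t : ℝ) : H :=
  τ⁻¹ • ((3 / 2 : ℝ) • v t - (2 : ℝ) • v (t - τ) + (1 / 2 : ℝ) • v (t - 2 * τ))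

/-- The Grünwald–Letnikov coefficients: `σ₀ = 1`, `σⱼ = (1 - (α+1)/j) σⱼ₋₁`. -/
def glCoeff (α : ℝ) : ℕ → ℝ
  | 0 => 1
  | j + 1 => (1 - (α + 1) / ((j : ℝ) + 1)) * glCoeff α j

/-- The function `t^(2-α)/Γ(3-α)` for `t > 0`, prescribed to be zero for `t ≤ 0`. -/
def initKernel (α t : ℝ) : ℝ := (max t 0) ^ (2 - α) / Real.Gamma (3 - α)

/-- The right-hand side `D_τ F̃(t) + D_τ(t^(2-α)/Γ(3-α)) u⁰` of the scheme at one time level, where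
`F̃(t) = ∫₀ᵗ ∫₀^ξ f` (zero for `t ≤ 0`). -/
def schemeData {H : Type*} [NormedAddCommGroup H] [NormedSpace ℝ H] (α τ : ℝ) (u₀ : H)
    (f : ℝ → H) (t : ℝ) : H :=
  bdf2 τ (primitive (primitive f)) t + bdf2 τ (initKernel α) t • u₀

/-- `(U, w)` solves the Crank–Nicolson scheme CN-II with `N` steps of size `τ`: `U n`, `n ≤ N`,
are the values `Ũ_hⁿ ∈ X_h` (zero for `n ≤ 0`) and `w n`, `1 ≤ n ≤ N`, the approximations `ũ_hⁿ`.
The equation in `X_h` is tested with all `φ ∈ X_h`. -/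
structure IsCNIISolution {d : ℕ} (Ω : Set (Pt d)) (a : Pt d → Matrix (Fin d) (Fin d) ℝ)
    (b : Pt d → ℝ) (K : Geometry.SimplicialComplex ℝ (Pt d)) (α τ : ℝ) (N : ℕ) (u₀ : L2 Ω)
    (f : ℝ → L2 Ω) (U : ℤ → FunGrad Ω) (w : ℕ → FunGrad Ω) : Prop where
  mem : ∀ n : ℕ, n ≤ N → U n ∈ feSpace Ω K
  init : ∀ k : ℤ, k ≤ 0 → U k = 0
  eq : ∀ n : ℕ, 1 ≤ n → n ≤ N → ∀ φ ∈ feSpace Ω K,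
    inner ℂ φ.1 (τ ^ (-α) • ∑ j ∈ Finset.range (n + 1), glCoeff α j • U ((n : ℤ) - j)).1
        + energyForm Ω a b ((1 - α / 2) • U n + (α / 2) • U ((n : ℤ) - 1)) φ
      = inner ℂ φ.1 ((1 - α / 2) • schemeData α τ u₀ f (n * τ)
          + (α / 2) • schemeData α τ u₀ f (((n : ℝ) - 1) * τ))
  output : ∀ n : ℕ, 1 ≤ n → n ≤ N →
    w n = τ⁻¹ • ((3 / 2 : ℝ) • U n - (2 : ℝ) • U ((n : ℤ) - 1) + (1 / 2 : ℝ) • U ((n : ℤ) - 2))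

end SubdiffusionCN

end

/-!
The constant may depend neither on the mesh nor on the operator, so everything is reduced to scalar
problems in which the eigenvalue `λ > 0` is a parameter and all bounds are uniform in it. The finite
element space is finite-dimensional (`finiteDimensional_valueSpace`) and weak gradients are
determined by the function (`H10_snd_eq_zero`), so the energy form is a positive definite Hermitian
form on a finite-dimensional subspace of `L²` and is diagonalized by an orthonormal basis
(`exists_feSpace_eigenbasis`). Pairing the error at time `t = nτ` with itself gives a weighted sum of
scalar errors, and orthonormality turns the bound on `‖f̂(s)‖` into a bound for the weighted sum of
the transforms of the components of `f` (`SourceFamily`). It remains to prove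
`exists_weighted_error_le`, whose constant is independent of the eigenvalues.

Both scalar solutions are inverse Laplace integrals of `f̂` times a kernel: `1 / (s^α + λ)` for the
exact problem (`primitive_primitive_exact`), and for the scheme a kernel built from the symbols of
the Grünwald–Letnikov difference, of the Crank–Nicolson average and of the second-order backward
difference (`scheme_eq_invLap`). The integrals are taken over the vertical line `Re s = κ / t`, on
which `e^{st}` is bounded. Since `f̂` decays only like `|s|^{-μ-1}`, the integral of the exact
solution need not converge absolutely. This is repaired by three integrations by parts, `t³ L[Q](t) =
-L[Q'''](t)` (`cube_mul_invLap`, `exact_eq_invLap`): each derivative gains a factor `1/|s|`, by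
Cauchy's estimate on discs of radius proportional to `|s|`. These discs leave the right half plane
when `s` is far up the line, but they stay in the sector where `f̂` is analytic. This is the only use
of analyticity beyond a half plane; no contour is deformed into the sector.

The frequencies split at `|Im s| = π/τ`.
* Below it, the kernels agree to relative order `(sτ)²`, uniformly in `λ` (`exists_kernel_bounds`).
  The consistency comes from Taylor expansion: the weight `α/2` is the one for which
  `(1 - e^{-z})^α` and `z^α` times the symbol of the average agree to second order. The uniformity in
  `λ` comes from stability: the real parts of `z^α`, of `(1 - e^{-z})^α` and of the average are
  positive, so adding a nonnegative multiple of the average cannot make the denominators small.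
* Above it, the exact part is of the order of the error by itself. The discrete kernel is, up to the
  factor `s^{-2}`, periodic with period `2πi/τ`, so its size is that at the translate of `s` into the
  resolved strip (`norm_iteratedDeriv_step_le`), and `s^{-2} f̂(s)` makes the sum over the periods
  converge (`exists_integral_norm_iteratedDeriv_le`).

The two ranges contribute `τ² t^{μ+α+1}` and `τ^{μ+3} t^α ≤ τ² t^{μ+α+1}` to the bound of `t³` times
the error, whence the rate `t^{α+μ-2} τ²`.

For the source `t^μ g`, the Laplace transform is `Γ(μ+1) s^{-μ-1} g` (`bilatLap_powKer`), which is
analytic off the negative real axis.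
-/


namespace SubdiffusionCN

open Filter Topology

/-! ### Symbols of the difference operators -/

/-- The symbol `1 - α/2 + (α/2) e^{-z}` of the Crank–Nicolson average, where `z = sτ`. -/
noncomputable def avgSymbol (α : ℝ) (z : ℂ) : ℂ := 1 - (α : ℂ) / 2 + (α : ℂ) / 2 * Complex.exp (-z)

/-- The symbol `(1 - e^{-z})^α` of the Grünwald–Letnikov difference, where `z = sτ`. -/
noncomputable def glSymbol (α : ℝ) (z : ℂ) : ℂ := (1 - Complex.exp (-z)) ^ (α : ℂ)

/-- The symbol `3/2 - 2 e^{-z} + e^{-2z}/2` of the second-order backward difference, where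
`z = sτ`. -/
noncomputable def bdfSymbol (z : ℂ) : ℂ :=
  3 / 2 - 2 * Complex.exp (-z) + 1 / 2 * Complex.exp (-(2 * z))

lemma cos_mul_norm_rpow_le_re_cpow {α ϑ : ℝ} (hα : 0 < α) (hϑ : α * ϑ ≤ Real.pi) {v : ℂ}
    (hv : |v.arg| ≤ ϑ) : Real.cos (α * ϑ) * ‖v‖ ^ α ≤ (v ^ (α : ℂ)).re := by
  rw [Complex.cpow_ofReal_re]
  have h1 : Real.cos (α * ϑ) ≤ Real.cos (v.arg * α) := by
    rw [← Real.cos_abs (v.arg * α), abs_mul, abs_of_pos hα, mul_comm]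
    apply Real.cos_le_cos_of_nonneg_of_le_pi (by positivity)
    · rw [mul_comm]; exact hϑ
    · gcongr
  rw [mul_comm]
  gcongr

lemma abs_arg_le_of_cos_mul_norm_le_re {ϑ : ℝ} (h0 : 0 ≤ ϑ) {v : ℂ}
    (hv0 : v ≠ 0) (hv : Real.cos ϑ * ‖v‖ ≤ v.re) : |v.arg| ≤ ϑ := by
  by_contra! h
  have h1 : Real.cos |v.arg| < Real.cos ϑ :=
    Real.cos_lt_cos_of_nonneg_of_le_pi h0 (Complex.abs_arg_le_pi v) h
  rw [Real.cos_abs, Complex.cos_arg hv0, div_lt_iff₀ (norm_pos_iff.2 hv0)] at h1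
  linarith

/-- A disc around a point of the right half plane, of radius proportional to the distance to the
origin, lies in a sector. -/
lemma cone_of_mem_disc {q c : ℝ} (hc : c ≤ 1 / 2) (hcq : 2 * c ≤ q) {z w : ℂ}
    (hz : 0 ≤ z.re) (hz0 : z ≠ 0) (hw : ‖w - z‖ ≤ c * ‖z‖) :
    ‖z‖ / 2 ≤ ‖w‖ ∧ ‖w‖ ≤ 2 * ‖z‖ ∧ w ≠ 0 ∧ -(2 * c * ‖w‖) ≤ w.re ∧ -(q * ‖w‖) ≤ w.re := by
  have hzp : 0 < ‖z‖ := norm_pos_iff.2 hz0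
  have h1 : ‖z‖ ≤ ‖w‖ + ‖w - z‖ := by
    have := norm_sub_le w (w - z); simpa using this
  have h2 : ‖w‖ ≤ ‖z‖ + ‖w - z‖ := by
    have := norm_add_le z (w - z); simpa using this
  have hc0 : 0 ≤ c := by
    by_contra! h
    have := norm_nonneg (w - z)
    nlinarith
  have h3 : ‖z‖ / 2 ≤ ‖w‖ := by nlinarith
  have h4 : |(w - z).re| ≤ ‖w - z‖ := Complex.abs_re_le_norm _
  have h5 : -(c * ‖z‖) ≤ w.re := by
    have := (abs_le.1 h4).1
    simp only [Complex.sub_re] at this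
    linarith
  have h6 : -(2 * c * ‖w‖) ≤ w.re := by nlinarith
  refine ⟨h3, by nlinarith, ?_, h6, by nlinarith⟩
  rintro rfl
  rw [norm_zero] at h3
  linarith

/-- `1 - e^{-w}` vanishes to first order at the origin and has no other zero in the strip
`|Im w| < 2π`. -/
lemma exists_mul_norm_le_norm_one_sub_exp (R : ℝ) :
    ∃ m : ℝ, 0 < m ∧ ∀ w : ℂ, ‖w‖ ≤ R → |w.im| ≤ 3 * Real.pi / 2 →
      m * ‖w‖ ≤ ‖1 - Complex.exp (-w)‖ := by
  let S : Set ℂ := Metric.closedBall 0 R ∩ {w | 1 / 2 ≤ ‖w‖ ∧ |w.im| ≤ 3 * Real.pi / 2}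
  have hS : IsCompact S := by
    apply (isCompact_closedBall _ _).inter_right
    apply IsClosed.inter
    · exact isClosed_le continuous_const continuous_norm
    · exact isClosed_le (continuous_abs.comp Complex.continuous_im) continuous_const
  have hne : ∀ w ∈ S, 0 < ‖1 - Complex.exp (-w)‖ := by
    rintro w ⟨-, hw1, hw2⟩
    rw [norm_pos_iff, sub_ne_zero]
    intro h
    obtain ⟨n, hn⟩ := Complex.exp_eq_one_iff.1 h.symm
    have him : w.im = -(n * (2 * Real.pi)) := by
      have := congrArg Complex.im hn
      simp at this
      linarith
    have hre : w.re = 0 := by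
      have := congrArg Complex.re hn
      simp at this
      linarith
    rcases eq_or_ne n 0 with rfl | hn0
    · have : w = 0 := Complex.ext (by simpa using hre) (by simpa using him)
      subst this
      norm_num at hw1
    · have h1 : (1 : ℝ) ≤ |(n : ℝ)| := by exact_mod_cast Int.one_le_abs hn0
      rw [him, abs_neg, abs_mul, abs_of_pos Real.two_pi_pos] at hw2
      have := Real.pi_pos
      nlinarith
  have hcont : ContinuousOn (fun w : ℂ => ‖1 - Complex.exp (-w)‖) S := by fun_prop
  obtain ⟨b, hb0, hb⟩ : ∃ b : ℝ, 0 < b ∧ ∀ w ∈ S, b ≤ ‖1 - Complex.exp (-w)‖ := by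
    rcases S.eq_empty_or_nonempty with h | h
    · exact ⟨1, one_pos, by simp [h]⟩
    · obtain ⟨w₀, hw₀, hmin⟩ := hS.exists_isMinOn h hcont
      exact ⟨_, hne w₀ hw₀, fun w hw => hmin hw⟩
  refine ⟨min (1 / 2) (b / (|R| + 1)), by positivity, fun w hwR hwim => ?_⟩
  rcases le_total ‖w‖ (1 / 2) with h | h
  · have h1 : ‖Complex.exp (-w) - 1 - (-w)‖ ≤ ‖-w‖ ^ 2 :=
      Complex.norm_exp_sub_one_sub_id_le (by rw [norm_neg]; linarith)
    rw [norm_neg] at h1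
    have h2 : ‖w‖ ≤ ‖1 - Complex.exp (-w)‖ + ‖Complex.exp (-w) - 1 - (-w)‖ := by
      have := norm_add_le (1 - Complex.exp (-w)) (Complex.exp (-w) - 1 - (-w))
      rwa [show 1 - Complex.exp (-w) + (Complex.exp (-w) - 1 - (-w)) = w by ring] at this
    calc min (1 / 2) (b / (|R| + 1)) * ‖w‖ ≤ 1 / 2 * ‖w‖ := by gcongr; exact min_le_left _ _
      _ ≤ _ := by nlinarith [norm_nonneg w]
  · have h1 := hb w ⟨by simpa using hwR, h, hwim⟩
    have h2 : ‖w‖ ≤ |R| + 1 := hwR.trans ((le_abs_self R).trans (by linarith))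
    calc min (1 / 2) (b / (|R| + 1)) * ‖w‖ ≤ b / (|R| + 1) * (|R| + 1) := by
          gcongr
          exact min_le_right _ _
      _ = b := by field_simp
      _ ≤ _ := h1

lemma norm_exp_sub_quadratic_le (x : ℂ) :
    ‖Complex.exp x - (1 + x + x ^ 2 / 2)‖ ≤ ‖x‖ ^ 3 * Real.exp ‖x‖ := by
  have := Complex.norm_exp_sub_sum_le_norm_mul_exp x 3
  simpa [Finset.sum_range_succ, Nat.factorial] using this

/-- The second-order backward difference is consistent of order two. -/
lemma norm_bdfSymbol_sub_self_le {R : ℝ} {w : ℂ} (hw : ‖w‖ ≤ R) :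
    ‖bdfSymbol w - w‖ ≤ 6 * Real.exp (2 * R) * ‖w‖ ^ 3 := by
  have h1 := norm_exp_sub_quadratic_le (-w)
  have h2 := norm_exp_sub_quadratic_le (-(2 * w))
  rw [norm_neg] at h1 h2
  have h3 : ‖2 * w‖ = 2 * ‖w‖ := by simp
  rw [h3] at h2
  have e : bdfSymbol w - w = -2 * (Complex.exp (-w) - (1 + -w + (-w) ^ 2 / 2))
      + 1 / 2 * (Complex.exp (-(2 * w)) - (1 + -(2 * w) + (-(2 * w)) ^ 2 / 2)) := by
    unfold bdfSymbol; ring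
  rw [e]
  have e1 : Real.exp ‖w‖ ≤ Real.exp (2 * R) := by
    gcongr; linarith [norm_nonneg w]
  have e2 : Real.exp (2 * ‖w‖) ≤ Real.exp (2 * R) := by gcongr
  refine (norm_add_le _ _).trans ?_
  rw [norm_mul, norm_mul, norm_neg, show ‖(2 : ℂ)‖ = 2 by norm_num,
    show ‖(1 / 2 : ℂ)‖ = 1 / 2 by norm_num]
  have h5 : ‖w‖ ^ 3 * Real.exp ‖w‖ ≤ ‖w‖ ^ 3 * Real.exp (2 * R) := by gcongr
  have h6 : (2 * ‖w‖) ^ 3 * Real.exp (2 * ‖w‖) ≤ (2 * ‖w‖) ^ 3 * Real.exp (2 * R) := by gcongr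
  nlinarith

lemma norm_bdfSymbol_le {R : ℝ} {w : ℂ} (hw : ‖w‖ ≤ R) :
    ‖bdfSymbol w‖ ≤ (1 + 6 * Real.exp (2 * R) * R ^ 2) * ‖w‖ := by
  have h := norm_bdfSymbol_sub_self_le hw
  have h1 : ‖bdfSymbol w‖ ≤ ‖bdfSymbol w - w‖ + ‖w‖ := by
    simpa using norm_add_le (bdfSymbol w - w) w
  have h2 : ‖w‖ ^ 2 ≤ R ^ 2 := by gcongr
  have h3 : 6 * Real.exp (2 * R) * ‖w‖ ^ 3 ≤ 6 * Real.exp (2 * R) * R ^ 2 * ‖w‖ := by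
    rw [show ‖w‖ ^ 3 = ‖w‖ ^ 2 * ‖w‖ by ring, ← mul_assoc]
    gcongr
  linarith

lemma norm_avgSymbol_le {α R : ℝ} (hα : 0 < α) (hα1 : α < 1) {w : ℂ} (hw : ‖w‖ ≤ R) :
    ‖avgSymbol α w‖ ≤ 1 + Real.exp R := by
  unfold avgSymbol
  have h1 : ‖Complex.exp (-w)‖ ≤ Real.exp R := by
    rw [Complex.norm_exp]
    gcongr
    simpa using (neg_le_abs w.re).trans ((Complex.abs_re_le_norm w).trans hw)
  have h2 : ‖(1 - (α : ℂ) / 2)‖ ≤ 1 := by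
    have : (1 - (α : ℂ) / 2) = ((1 - α / 2 : ℝ) : ℂ) := by push_cast; ring
    rw [this, Complex.norm_real, Real.norm_of_nonneg (by linarith)]
    linarith
  have h3 : ‖(α : ℂ) / 2‖ ≤ 1 := by
    have : (α : ℂ) / 2 = ((α / 2 : ℝ) : ℂ) := by push_cast; ring
    rw [this, Complex.norm_real, Real.norm_of_nonneg (by linarith)]
    linarith
  refine (norm_add_le _ _).trans ?_
  rw [norm_mul]
  have := mul_le_mul h3 h1 (norm_nonneg _) zero_le_one
  linarith

/-- Near the origin the fractional difference and the weighted average match to second order: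
`(1 - e^{-w})^α = (1 - α/2 + (α/2) e^{-w}) w^α (1 + O(w²))`. -/
lemma norm_glSymbol_sub_le_of_small {α ϑ : ℝ} (hα : 0 < α) (hα1 : α < 1) {w : ℂ}
    (hw0 : w ≠ 0) (harg : |w.arg| ≤ ϑ) (hw : ‖w‖ ≤ 1 / 4) (hw' : 2 * ‖w‖ ≤ Real.pi - ϑ) :
    ‖glSymbol α w - avgSymbol α w * w ^ (α : ℂ)‖ ≤ 20 * ‖w‖ ^ (2 + α) := by
  have hwp : 0 < ‖w‖ := norm_pos_iff.2 hw0
  have hαn : ‖(α : ℂ)‖ ≤ 1 := by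
    rw [Complex.norm_real, Real.norm_of_nonneg hα.le]; exact hα1.le
  set x : ℂ := (1 - Complex.exp (-w)) / w - 1 with hx
  have hwx : w * (1 + x) = 1 - Complex.exp (-w) := by rw [hx]; field_simp; ring
  have hx1 : ‖x‖ ≤ ‖w‖ := by
    have h1 : ‖Complex.exp (-w) - 1 - (-w)‖ ≤ ‖-w‖ ^ 2 :=
      Complex.norm_exp_sub_one_sub_id_le (by rw [norm_neg]; linarith)
    have h2 : x = -(Complex.exp (-w) - 1 - (-w)) / w := by rw [hx]; field_simp; ring
    rw [h2, norm_div, norm_neg, div_le_iff₀ hwp]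
    rw [norm_neg] at h1
    linarith [h1, sq ‖w‖]
  have hx2 : ‖x + w / 2‖ ≤ 2 * ‖w‖ ^ 2 := by
    have h1 := norm_exp_sub_quadratic_le (-w)
    have h2 : x + w / 2 = -(Complex.exp (-w) - (1 + -w + (-w) ^ 2 / 2)) / w := by
      rw [hx]; field_simp; ring
    rw [h2, norm_div, norm_neg, div_le_iff₀ hwp]
    rw [norm_neg] at h1
    have h3 : Real.exp ‖w‖ ≤ 2 := by
      have h4 : Real.exp ‖w‖ ≤ Real.exp (1 / 4) := by gcongr
      have := Real.exp_bound_div_one_sub_of_interval (x := 1 / 4) (by norm_num) (by norm_num)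
      linarith
    calc _ ≤ _ := h1
      _ ≤ ‖w‖ ^ 3 * 2 := by gcongr
      _ = _ := by ring
  have hxh : ‖x‖ ≤ 1 / 2 := by linarith
  have hl1 : ‖Complex.log (1 + x)‖ ≤ 3 / 2 * ‖x‖ := Complex.norm_log_one_add_half_le_self hxh
  have hl2 : ‖Complex.log (1 + x) - x‖ ≤ ‖x‖ ^ 2 := by
    refine (Complex.norm_log_one_add_sub_self_le (by linarith)).trans ?_
    have : (1 - ‖x‖)⁻¹ ≤ 2 := by
      rw [inv_le_comm₀ (by linarith) two_pos]; linarith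
    nlinarith [sq_nonneg ‖x‖]
  have h1x : 1 + x ≠ 0 := by
    intro h
    have : x = -1 := by linear_combination h
    rw [this] at hxh
    norm_num at hxh
  have hlog : Complex.log (1 - Complex.exp (-w)) = Complex.log w + Complex.log (1 + x) := by
    rw [← hwx]
    have him : |(Complex.log (1 + x)).im| < Real.pi - ϑ := by
      have := Complex.abs_im_le_norm (Complex.log (1 + x))
      nlinarith
    have h3 := abs_le.1 harg
    have h4 := abs_lt.1 him
    rw [Complex.log_im] at h4
    exact Complex.log_mul hw0 h1x ⟨by linarith, by linarith⟩
  have hN : glSymbol α w = w ^ (α : ℂ) * Complex.exp (α * Complex.log (1 + x)) := by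
    unfold glSymbol
    have hv : 1 - Complex.exp (-w) ≠ 0 := by rw [← hwx]; exact mul_ne_zero hw0 h1x
    rw [Complex.cpow_def_of_ne_zero hv, Complex.cpow_def_of_ne_zero hw0, hlog, ← Complex.exp_add]
    congr 1; ring
  set y : ℂ := α * Complex.log (1 + x) with hy
  have hy1 : ‖y‖ ≤ 3 / 2 * ‖w‖ := by
    rw [hy, norm_mul]
    calc _ ≤ 1 * (3 / 2 * ‖x‖) := by gcongr
      _ ≤ _ := by linarith
  have hy2 : ‖Complex.exp y - 1 - y‖ ≤ (3 / 2 * ‖w‖) ^ 2 := by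
    refine (Complex.norm_exp_sub_one_sub_id_le (by linarith)).trans ?_
    gcongr
  have hw2 : ‖Complex.exp (-w) - 1 - (-w)‖ ≤ ‖w‖ ^ 2 := by
    have := Complex.norm_exp_sub_one_sub_id_le (x := -w) (by rw [norm_neg]; linarith)
    rwa [norm_neg] at this
  have hdiff : ‖Complex.exp y - avgSymbol α w‖ ≤ 20 * ‖w‖ ^ 2 := by
    have e : Complex.exp y - avgSymbol α w = (Complex.exp y - 1 - y)
        + α * (Complex.log (1 + x) - x) + α * (x + w / 2)
        - α / 2 * (Complex.exp (-w) - 1 - (-w)) := by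
      rw [hy]; unfold avgSymbol; ring
    rw [e]
    refine (norm_sub_le _ _).trans ?_
    have a1 : ‖(α : ℂ) * (Complex.log (1 + x) - x)‖ ≤ ‖w‖ ^ 2 := by
      rw [norm_mul]
      calc _ ≤ 1 * ‖x‖ ^ 2 := by gcongr
        _ ≤ _ := by rw [one_mul]; gcongr
    have a2 : ‖(α : ℂ) * (x + w / 2)‖ ≤ 2 * ‖w‖ ^ 2 := by
      rw [norm_mul]
      calc _ ≤ 1 * (2 * ‖w‖ ^ 2) := by gcongr
        _ = _ := by ring
    have a3 : ‖(α : ℂ) / 2 * (Complex.exp (-w) - 1 - (-w))‖ ≤ ‖w‖ ^ 2 := by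
      rw [norm_mul, norm_div]
      norm_num only [Complex.norm_ofNat]
      calc _ ≤ 1 * ‖w‖ ^ 2 := by gcongr; linarith
        _ = _ := by ring
    have a4 := norm_add₃_le (a := Complex.exp y - 1 - y)
      (b := (α : ℂ) * (Complex.log (1 + x) - x)) (c := (α : ℂ) * (x + w / 2))
    nlinarith [sq_nonneg ‖w‖]
  rw [hN, show w ^ (α : ℂ) * Complex.exp y - avgSymbol α w * w ^ (α : ℂ)
    = w ^ (α : ℂ) * (Complex.exp y - avgSymbol α w) by ring, norm_mul, Complex.norm_cpow_real,
    Real.rpow_add hwp]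
  calc _ ≤ ‖w‖ ^ α * (20 * ‖w‖ ^ 2) := by gcongr
    _ = _ := by rw [Real.rpow_two]; ring

lemma norm_one_sub_exp_le {R : ℝ} {w : ℂ} (hw : ‖w‖ ≤ R) :
    ‖1 - Complex.exp (-w)‖ ≤ Real.exp R * ‖w‖ := by
  have := Complex.norm_exp_sub_sum_le_norm_mul_exp (-w) 1
  rw [norm_sub_rev]
  simp only [Finset.range_one, Finset.sum_singleton, pow_zero, Nat.factorial_zero, Nat.cast_one,
    div_one, norm_neg, pow_one] at this
  refine this.trans ?_
  rw [mul_comm]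
  gcongr

lemma norm_glSymbol_le {α R : ℝ} (hα : 0 < α) {w : ℂ} (hw : ‖w‖ ≤ R) :
    ‖glSymbol α w‖ ≤ Real.exp R ^ α * ‖w‖ ^ α := by
  unfold glSymbol
  rw [← Real.mul_rpow (Real.exp_pos _).le (norm_nonneg _)]
  rcases eq_or_ne (1 - Complex.exp (-w)) 0 with h | h
  · rw [h, Complex.zero_cpow (by exact_mod_cast hα.ne')]
    simp; positivity
  · rw [Complex.norm_cpow_real]
    have := norm_one_sub_exp_le hw
    gcongr

/-- The discrete symbol of the fractional derivative is consistent of order two, on any bounded part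
of a sector. -/
lemma exists_norm_glSymbol_sub_le {α ϑ : ℝ} (hα : 0 < α) (hα1 : α < 1) (hϑ : ϑ < Real.pi) (R : ℝ) :
    ∃ M : ℝ, 0 < M ∧ ∀ w : ℂ, w ≠ 0 → |w.arg| ≤ ϑ → ‖w‖ ≤ R →
      ‖glSymbol α w - avgSymbol α w * w ^ (α : ℂ)‖ ≤ M * ‖w‖ ^ (2 + α) := by
  set r : ℝ := min (1 / 4) ((Real.pi - ϑ) / 2) with hr
  have hr0 : 0 < r := lt_min (by norm_num) (by linarith)
  refine ⟨20 + (Real.exp R ^ α + (1 + Real.exp R)) / r ^ 2, by positivity, fun w hw0 harg hwR => ?_⟩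
  have hwp : 0 < ‖w‖ := norm_pos_iff.2 hw0
  rcases le_total ‖w‖ r with h | h
  · have h1 := norm_glSymbol_sub_le_of_small hα hα1 hw0 harg (h.trans (min_le_left _ _))
      (by linarith [h.trans (min_le_right _ _)])
    refine h1.trans ?_
    gcongr
    have : 0 ≤ (Real.exp R ^ α + (1 + Real.exp R)) / r ^ 2 := by positivity
    linarith
  · have h1 := norm_glSymbol_le hα hwR
    have h2 := norm_avgSymbol_le hα hα1 hwR
    have h3 : 1 ≤ ‖w‖ ^ 2 / r ^ 2 := by
      rw [one_le_div (by positivity)]; gcongr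
    calc _ ≤ Real.exp R ^ α * ‖w‖ ^ α + (1 + Real.exp R) * ‖w‖ ^ α := by
          refine (norm_sub_le _ _).trans ?_
          rw [norm_mul, Complex.norm_cpow_real]
          gcongr
      _ = (Real.exp R ^ α + (1 + Real.exp R)) * ‖w‖ ^ α * 1 := by ring
      _ ≤ (Real.exp R ^ α + (1 + Real.exp R)) * ‖w‖ ^ α * (‖w‖ ^ 2 / r ^ 2) := by gcongr
      _ = ((Real.exp R ^ α + (1 + Real.exp R)) / r ^ 2) * ‖w‖ ^ (2 + α) := by
          rw [Real.rpow_add hwp, Real.rpow_two]; ring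
      _ ≤ _ := by gcongr; linarith

/-! ### Resolvent kernels of the exact and of the discrete problem -/

set_option maxHeartbeats 800000 in
/-- The real parts of `(1 - e^{-w})^α` and of the Crank–Nicolson average stay positive slightly
beyond the right half plane: this is the stability of the scheme. -/
lemma exists_disc_symbol_lower_bounds {α κ ϑ : ℝ} (hα : 0 < α) (hα1 : α < 1) (hκ : 0 < κ)
    (hϑ : Real.pi / 2 < ϑ) (hϑπ : ϑ < Real.pi) (hαϑ : α * ϑ < Real.pi / 2) :
    ∃ c m : ℝ, 0 < c ∧ c ≤ 1 / 2 ∧ 2 * c ≤ -Real.cos ϑ ∧ 0 < m ∧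
      ∀ z : ℂ, 0 ≤ z.re → z.re ≤ κ → |z.im| ≤ Real.pi → z ≠ 0 → ∀ w : ℂ, ‖w - z‖ ≤ c * ‖z‖ →
        w ≠ 0 ∧ |w.arg| ≤ ϑ ∧ ‖w‖ ≤ 2 * (κ + Real.pi) ∧
        1 - Complex.exp (-w) ∈ Complex.slitPlane ∧
        m * ‖w‖ ^ α ≤ (w ^ (α : ℂ)).re ∧ m * ‖w‖ ^ α ≤ (glSymbol α w).re ∧
        m ≤ (avgSymbol α w).re := by
  have hpi := Real.pi_pos
  set q : ℝ := -Real.cos ϑ with hq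
  have hq0 : 0 < q := by
    have := Real.cos_neg_of_pi_div_two_lt_of_lt hϑ (by linarith)
    linarith
  set R : ℝ := κ + Real.pi with hR
  have hR0 : 0 < R := by positivity
  obtain ⟨m₁, hm₁, hv⟩ := exists_mul_norm_le_norm_one_sub_exp (2 * R)
  set E : ℝ := Real.exp (2 * R) with hE
  have hE0 : 0 < E := Real.exp_pos _
  have hE1 : 1 ≤ E := Real.one_le_exp (by positivity)
  have hcos : 0 < Real.cos (α * ϑ) := Real.cos_pos_of_mem_Ioo ⟨by nlinarith, hαϑ⟩
  -- The radius is small enough that `w` and `1 - e^{-w}` stay in the sector `|arg| ≤ ϑ` (the bounds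
  -- with `q`), that `|Im w| < 3π/2`, away from the zeros `±2πi` of `1 - e^{-w}`, and that the
  -- average keeps half of its margin `1 - α`.
  set c : ℝ := min (min (1 / 2) (q / 2)) (min (Real.pi / (2 * R)) (min (q * m₁ / (2 * E))
    ((1 - α) / (4 * R * E)))) with hc
  have hc0 : 0 < c := by
    have : 0 < 1 - α := by linarith
    positivity
  have hc1 : c ≤ 1 / 2 := (min_le_left _ _).trans (min_le_left _ _)
  have hc2 : c ≤ q / 2 := (min_le_left _ _).trans (min_le_right _ _)
  have hc3 : c ≤ Real.pi / (2 * R) := (min_le_right _ _).trans (min_le_left _ _)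
  have hc4 : c ≤ q * m₁ / (2 * E) :=
    (min_le_right _ _).trans ((min_le_right _ _).trans (min_le_left _ _))
  have hc5 : c ≤ (1 - α) / (4 * R * E) :=
    (min_le_right _ _).trans ((min_le_right _ _).trans (min_le_right _ _))
  rw [le_div_iff₀ (by positivity)] at hc3 hc4 hc5
  set m : ℝ := min (Real.cos (α * ϑ) * min 1 (m₁ ^ α)) ((1 - α) / 2) with hm
  have hm0 : 0 < m := by
    have : 0 < 1 - α := by linarith
    positivity
  clear_value c m E q R
  refine ⟨c, m, hc0, hc1, by linarith, hm0, fun z hz0 hzκ hzim hzne w hw => ?_⟩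
  obtain ⟨h1, h2, hw0, h4, h5⟩ := cone_of_mem_disc hc1 (by linarith : 2 * c ≤ q) hz0 hzne hw
  have hzR : ‖z‖ ≤ R := by
    refine (Complex.norm_le_abs_re_add_abs_im z).trans ?_
    rw [abs_of_nonneg hz0]; linarith
  have hwR : ‖w‖ ≤ 2 * R := by linarith
  have harg : |w.arg| ≤ ϑ := by
    apply abs_arg_le_of_cos_mul_norm_le_re (by linarith) hw0
    rw [hq] at h5; linarith
  have him : |w.im| ≤ 3 * Real.pi / 2 := by
    have e1 : |(w - z).im| ≤ ‖w - z‖ := Complex.abs_im_le_norm _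
    have e2 : |w.im| ≤ |z.im| + |(w - z).im| := by
      have := abs_add_le z.im (w - z).im
      simpa using this
    have e3 : c * ‖z‖ ≤ c * R := by gcongr
    linarith
  have hvw := hv w hwR him
  have hwp : 0 < ‖w‖ := norm_pos_iff.2 hw0
  have hvp : 0 < ‖1 - Complex.exp (-w)‖ := lt_of_lt_of_le (by positivity) hvw
  have hv0 : 1 - Complex.exp (-w) ≠ 0 := norm_pos_iff.1 hvp
  -- `|e^{-w}|` exceeds one by at most a small multiple of `|w|`
  have hexp : |(Complex.exp (-w)).re| ≤ 1 + 2 * c * ‖w‖ * E := by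
    have e1 : |(Complex.exp (-w)).re| ≤ Real.exp (-w.re) := by
      have := Complex.abs_re_le_norm (Complex.exp (-w))
      rwa [Complex.norm_exp, Complex.neg_re] at this
    have e2 : Real.exp (-w.re) ≤ Real.exp (2 * c * ‖w‖) := by gcongr; linarith
    have e3 : Real.exp (2 * c * ‖w‖) ≤ 1 + 2 * c * ‖w‖ * Real.exp (2 * c * ‖w‖) := by
      have := Real.add_one_le_exp (-(2 * c * ‖w‖))
      have h := Real.exp_pos (2 * c * ‖w‖)
      have hh : Real.exp (2 * c * ‖w‖) * Real.exp (-(2 * c * ‖w‖)) = 1 := by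
        rw [← Real.exp_add]; simp
      nlinarith
    have e4 : Real.exp (2 * c * ‖w‖) ≤ E := by
      rw [hE]; exact Real.exp_le_exp.2 (by nlinarith)
    have e5 : 2 * c * ‖w‖ * Real.exp (2 * c * ‖w‖) ≤ 2 * c * ‖w‖ * E := by gcongr
    linarith
  have hvre : -(q * ‖1 - Complex.exp (-w)‖) ≤ (1 - Complex.exp (-w)).re := by
    have e1 : (1 - Complex.exp (-w)).re = 1 - (Complex.exp (-w)).re := by simp
    have e2 : 2 * c * ‖w‖ * E ≤ q * m₁ * ‖w‖ := by nlinarith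
    have e3 : q * (m₁ * ‖w‖) ≤ q * ‖1 - Complex.exp (-w)‖ := by gcongr
    have e4 := (abs_le.1 hexp).2
    rw [e1]; linarith
  have hvarg : |(1 - Complex.exp (-w)).arg| ≤ ϑ := by
    apply abs_arg_le_of_cos_mul_norm_le_re (by linarith) hv0
    rw [hq] at hvre; linarith
  refine ⟨hw0, harg, hwR, ?_, ?_, ?_, ?_⟩
  · rw [Complex.mem_slitPlane_iff_arg]
    refine ⟨fun h => ?_, hv0⟩
    rw [h, abs_of_pos hpi] at hvarg
    linarith
  · refine le_trans ?_ (cos_mul_norm_rpow_le_re_cpow hα (by linarith) harg)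
    gcongr
    exact (hm.trans_le (min_le_left _ _)).trans (mul_le_of_le_one_right hcos.le (min_le_left _ _))
  · refine le_trans ?_ (cos_mul_norm_rpow_le_re_cpow hα (by linarith) hvarg)
    have e1 : m₁ ^ α * ‖w‖ ^ α ≤ ‖1 - Complex.exp (-w)‖ ^ α := by
      rw [← Real.mul_rpow hm₁.le hwp.le]; gcongr
    calc m * ‖w‖ ^ α ≤ (Real.cos (α * ϑ) * m₁ ^ α) * ‖w‖ ^ α := by
          gcongr
          refine (hm.trans_le (min_le_left _ _)).trans ?_
          gcongr
          exact min_le_right _ _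
      _ ≤ _ := by rw [mul_assoc]; gcongr
  · refine (hm.trans_le (min_le_right _ _)).trans ?_
    have e1 : (avgSymbol α w).re = 1 - α / 2 + α / 2 * (Complex.exp (-w)).re := by
      have : avgSymbol α w
          = ((1 - α / 2 : ℝ) : ℂ) + ((α / 2 : ℝ) : ℂ) * Complex.exp (-w) := by
        unfold avgSymbol; push_cast; ring
      rw [this, Complex.add_re, Complex.re_ofReal_mul, Complex.ofReal_re]
    have e2 := (abs_le.1 hexp).1
    have e3 : 2 * c * ‖w‖ * E ≤ 1 - α := by
      calc 2 * c * ‖w‖ * E ≤ 2 * c * (2 * R) * E := by gcongr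
        _ = c * (4 * R * E) := by ring
        _ ≤ _ := hc5
    have e4 : α / 2 * (-(2 - α)) ≤ α / 2 * (Complex.exp (-w)).re := by
      gcongr
      linarith
    have e5 : 0 ≤ (1 - α) * (1 - α) := mul_self_nonneg _
    rw [e1]
    linarith

/-- The kernel of the scheme in the variable `z = sτ`. -/
noncomputable def discKernel (α Λ : ℝ) (z : ℂ) : ℂ :=
  bdfSymbol z ^ 2 * avgSymbol α z / (glSymbol α z + Λ * avgSymbol α z)

lemma mul_le_norm_add_ofReal_mul {a b : ℂ} {x Λ : ℝ} (hΛ : 0 ≤ Λ) (ha : x ≤ a.re)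
    (hb : 0 ≤ b.re) : x ≤ ‖a + Λ * b‖ := by
  refine le_trans ?_ (Complex.re_le_norm _)
  simp only [Complex.add_re, Complex.mul_re, Complex.ofReal_re, Complex.ofReal_im, zero_mul,
    sub_zero]
  have := mul_nonneg hΛ hb
  linarith

/-- On discs around the points of the strip `0 ≤ Re z ≤ κ`, `|Im z| ≤ π`, with radius proportional
to the distance to the origin, the kernels of the scheme and of the exact problem are close to
second order, uniformly in the eigenvalue `Λ`. -/
theorem exists_kernel_bounds {α κ ϑ : ℝ} (hα : 0 < α) (hα1 : α < 1) (hκ : 0 < κ)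
    (hϑ : Real.pi / 2 < ϑ) (hϑπ : ϑ < Real.pi) (hαϑ : α * ϑ < Real.pi / 2) :
    ∃ c M : ℝ, 0 < c ∧ c ≤ 1 / 2 ∧ 2 * c ≤ -Real.cos ϑ ∧ 0 < M ∧
      ∀ z : ℂ, 0 ≤ z.re → z.re ≤ κ → |z.im| ≤ Real.pi → z ≠ 0 → ∀ w : ℂ, ‖w - z‖ ≤ c * ‖z‖ →
        ∀ Λ : ℝ, 0 ≤ Λ →
        DifferentiableAt ℂ (discKernel α Λ) w ∧
        ‖discKernel α Λ w‖ ≤ M * ‖w‖ ^ (2 - α) ∧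
        ‖1 / (w ^ (α : ℂ) + Λ) - discKernel α Λ w / w ^ 2‖ ≤ M * ‖w‖ ^ (2 - α) := by
  obtain ⟨c, m, hc, hc2, hcϑ, hm, H⟩ := exists_disc_symbol_lower_bounds hα hα1 hκ hϑ hϑπ hαϑ
  set R : ℝ := 2 * (κ + Real.pi) with hR
  have hR0 : 0 < R := by have := Real.pi_pos; positivity
  obtain ⟨M₁, hM₁, hN⟩ := exists_norm_glSymbol_sub_le hα hα1 hϑπ R
  set D₁ : ℝ := 6 * Real.exp (2 * R) with hD₁
  set D₂ : ℝ := 1 + 6 * Real.exp (2 * R) * R ^ 2 with hD₂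
  set G : ℝ := 1 + Real.exp R with hG
  have hD₁0 : 0 < D₁ := by positivity
  have hD₂0 : 0 < D₂ := by positivity
  have hG0 : 0 < G := by positivity
  refine ⟨c, D₂ ^ 2 * G / m + (M₁ / m ^ 2 + D₁ * (1 + D₂) * G / m), hc, hc2, hcϑ, by positivity,
    fun z h1 h2 h3 h4 w hw Λ hΛ => ?_⟩
  obtain ⟨hw0, harg, hwR, hslit, hwα, hNre, hgre⟩ := H z h1 h2 h3 h4 w hw
  have hwp : 0 < ‖w‖ := norm_pos_iff.2 hw0
  have hwαp : 0 < m * ‖w‖ ^ α := by positivity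
  have hden : m * ‖w‖ ^ α ≤ ‖glSymbol α w + Λ * avgSymbol α w‖ :=
    mul_le_norm_add_ofReal_mul hΛ hNre (hm.le.trans hgre)
  have hden0 : glSymbol α w + Λ * avgSymbol α w ≠ 0 := norm_pos_iff.1 (hwαp.trans_le hden)
  have hden' : m * ‖w‖ ^ α ≤ ‖w ^ (α : ℂ) + Λ‖ := by
    have := mul_le_norm_add_ofReal_mul (b := 1) hΛ hwα (by simp)
    simpa using this
  have hden0' : w ^ (α : ℂ) + Λ ≠ 0 := norm_pos_iff.1 (hwαp.trans_le hden')
  have hb := norm_bdfSymbol_le hwR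
  have hb1 := norm_bdfSymbol_sub_self_le hwR
  have hg := norm_avgSymbol_le hα hα1 hwR
  have hpow : ‖w‖ ^ (2 - α) = ‖w‖ ^ 2 / ‖w‖ ^ α := by
    rw [Real.rpow_sub hwp, Real.rpow_two]
  have hpow' : ‖w‖ ^ (2 + α) = ‖w‖ ^ 2 * ‖w‖ ^ α := by
    rw [Real.rpow_add hwp, Real.rpow_two]
  refine ⟨?_, ?_, ?_⟩
  · unfold discKernel bdfSymbol avgSymbol glSymbol at *
    refine DifferentiableAt.div (by fun_prop) ?_ hden0
    refine DifferentiableAt.add ?_ (by fun_prop)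
    exact DifferentiableAt.cpow_const (by fun_prop) hslit
  · unfold discKernel
    rw [norm_div, norm_mul, norm_pow]
    calc _ ≤ (D₂ * ‖w‖) ^ 2 * G / (m * ‖w‖ ^ α) := by gcongr
      _ = D₂ ^ 2 * G / m * ‖w‖ ^ (2 - α) := by rw [hpow]; field_simp
      _ ≤ _ := by
          gcongr
          have : 0 ≤ M₁ / m ^ 2 + D₁ * (1 + D₂) * G / m := by positivity
          linarith
  -- the errors of the fractional difference, relative to the average, and of the backward difference
  · have e : 1 / (w ^ (α : ℂ) + Λ) - discKernel α Λ w / w ^ 2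
        = (glSymbol α w - avgSymbol α w * w ^ (α : ℂ))
            / ((w ^ (α : ℂ) + Λ) * (glSymbol α w + Λ * avgSymbol α w))
          - (bdfSymbol w - w) * (bdfSymbol w + w) / w ^ 2 * avgSymbol α w
            / (glSymbol α w + Λ * avgSymbol α w) := by
      unfold discKernel
      field_simp
      ring
    rw [e]
    have t1 : ‖(glSymbol α w - avgSymbol α w * w ^ (α : ℂ))
            / ((w ^ (α : ℂ) + Λ) * (glSymbol α w + Λ * avgSymbol α w))‖
          ≤ M₁ / m ^ 2 * ‖w‖ ^ (2 - α) := by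
      rw [norm_div, norm_mul]
      have := hN w hw0 harg hwR
      calc _ ≤ M₁ * ‖w‖ ^ (2 + α) / ((m * ‖w‖ ^ α) * (m * ‖w‖ ^ α)) := by gcongr
        _ = _ := by rw [hpow, hpow']; field_simp
    have t2 : ‖(bdfSymbol w - w) * (bdfSymbol w + w) / w ^ 2 * avgSymbol α w
            / (glSymbol α w + Λ * avgSymbol α w)‖ ≤ D₁ * (1 + D₂) * G / m * ‖w‖ ^ (2 - α) := by
      rw [norm_div, norm_mul, norm_div, norm_mul, norm_pow]
      have e2 : ‖bdfSymbol w + w‖ ≤ (1 + D₂) * ‖w‖ := by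
        refine (norm_add_le _ _).trans ?_
        linarith
      calc _ ≤ (D₁ * ‖w‖ ^ 3) * ((1 + D₂) * ‖w‖) / ‖w‖ ^ 2 * G / (m * ‖w‖ ^ α) := by gcongr
        _ = _ := by rw [hpow]; field_simp
    refine (norm_sub_le _ _).trans ((add_le_add t1 t2).trans ?_)
    rw [← add_mul]
    have : 0 ≤ D₂ ^ 2 * G / m := by positivity
    exact mul_le_mul_of_nonneg_right (by linarith) (by positivity)

/-! ### Inverse Laplace transforms along vertical lines -/

/-- The point `σ + iy` of the vertical line `Re s = σ`. -/
noncomputable def vline (σ y : ℝ) : ℂ := σ + y * Complex.I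

@[simp] lemma vline_re (σ y : ℝ) : (vline σ y).re = σ := by simp [vline]

@[simp] lemma vline_im (σ y : ℝ) : (vline σ y).im = y := by simp [vline]

lemma continuous_vline (σ : ℝ) : Continuous (vline σ) := by unfold vline; fun_prop

lemma hasDerivAt_vline (σ y : ℝ) : HasDerivAt (vline σ) Complex.I y := by
  unfold vline
  simpa using ((Complex.ofRealCLM.hasDerivAt (x := y)).mul_const Complex.I).const_add (σ : ℂ)

lemma norm_vline_pos {σ : ℝ} (hσ : 0 < σ) (y : ℝ) : 0 < ‖vline σ y‖ := by
  rw [norm_pos_iff]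
  intro h
  have := congrArg Complex.re h
  simp at this
  exact hσ.ne' this

lemma abs_le_norm_vline (σ y : ℝ) : |y| ≤ ‖vline σ y‖ := by
  simpa using Complex.abs_im_le_norm (vline σ y)

/-- The integral `∫ e^{st} h(s) dy` over the vertical line `s = σ + iy`; it is `2π` times the inverse
Laplace transform of `h`. -/
noncomputable def invLap (σ : ℝ) (h : ℂ → ℂ) (t : ℝ) : ℂ :=
  ∫ y : ℝ, Complex.exp (vline σ y * t) * h (vline σ y)

lemma norm_exp_vline_mul (σ y t : ℝ) : ‖Complex.exp (vline σ y * t)‖ = Real.exp (σ * t) := by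
  rw [Complex.norm_exp]; simp [vline]

lemma norm_vline_eq {σ : ℝ} (hσ : 0 < σ) (y : ℝ) : ‖vline σ y‖ = σ * ‖vline 1 (y / σ)‖ := by
  have : vline σ y = (σ : ℂ) * vline 1 (y / σ) := by
    unfold vline
    push_cast
    have : (σ : ℂ) ≠ 0 := by exact_mod_cast hσ.ne'
    field_simp
  rw [this, norm_mul, Complex.norm_real, Real.norm_of_nonneg hσ.le]

lemma integrable_norm_vline_one_rpow {p : ℝ} (hp : 1 < p) :
    Integrable (fun y : ℝ => ‖vline 1 y‖ ^ (-p)) := by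
  have h := integrable_rpow_neg_one_add_norm_sq (E := ℝ) (μ := volume) (r := p) (by simpa using hp)
  refine h.congr (Eventually.of_forall fun y => ?_)
  have e : ‖vline 1 y‖ = Real.sqrt (1 + ‖y‖ ^ 2) := by
    rw [Complex.norm_eq_sqrt_sq_add_sq]; simp
  simp only [e]
  rw [Real.sqrt_eq_rpow, ← Real.rpow_mul (by positivity)]
  congr 1; ring

/-- The scale-invariant constant `∫ |1 + iy|^{-p} dy`. -/
noncomputable def lineConst (p : ℝ) : ℝ := ∫ y : ℝ, ‖vline 1 y‖ ^ (-p)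

lemma lineConst_nonneg (p : ℝ) : 0 ≤ lineConst p :=
  integral_nonneg fun _ => by positivity

lemma integrable_norm_vline_rpow {σ p : ℝ} (hσ : 0 < σ) (hp : 1 < p) :
    Integrable (fun y : ℝ => ‖vline σ y‖ ^ (-p)) := by
  have h := ((integrable_norm_vline_one_rpow hp).comp_div hσ.ne').const_mul (σ ^ (-p))
  refine h.congr (Eventually.of_forall fun y => ?_)
  simp only
  rw [norm_vline_eq hσ, Real.mul_rpow hσ.le (norm_nonneg _)]

lemma integral_norm_vline_rpow {σ p : ℝ} (hσ : 0 < σ) :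
    ∫ y : ℝ, ‖vline σ y‖ ^ (-p) = σ ^ (1 - p) * lineConst p := by
  have e : ∀ y : ℝ, ‖vline σ y‖ ^ (-p) = σ ^ (-p) * ‖vline 1 (y / σ)‖ ^ (-p) := fun y => by
    rw [norm_vline_eq hσ, Real.mul_rpow hσ.le (norm_nonneg _)]
  simp_rw [e]
  rw [integral_const_mul, Measure.integral_comp_div (fun y => ‖vline 1 y‖ ^ (-p)) σ,
    abs_of_pos hσ, smul_eq_mul, lineConst, ← mul_assoc, sub_eq_neg_add, Real.rpow_add hσ,
    Real.rpow_one]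

/-- Functions that are analytic in the half plane `Re s > a` and of size `O(|s|^{-p})` there. -/
structure DecaysOn (a p : ℝ) (h : ℂ → ℂ) : Prop where
  differentiableOn : DifferentiableOn ℂ h {s | a < s.re}
  bound : ∃ C : ℝ, 0 ≤ C ∧ ∀ s : ℂ, a < s.re → ‖h s‖ ≤ C * ‖s‖ ^ (-p)

lemma isOpen_halfPlane (a : ℝ) : IsOpen {s : ℂ | a < s.re} :=
  isOpen_lt continuous_const Complex.continuous_re

lemma DecaysOn.continuous_line {a p σ : ℝ} {h : ℂ → ℂ} (hh : DecaysOn a p h) (hσ : a < σ) :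
    Continuous fun y => h (vline σ y) :=
  hh.differentiableOn.continuousOn.comp_continuous (continuous_vline σ) fun y => by simpa using hσ

lemma DecaysOn.integrable_line {a p σ : ℝ} {h : ℂ → ℂ} (hh : DecaysOn a p h) (ha : 0 ≤ a)
    (hσ : a < σ) (hp : 1 < p) : Integrable fun y => h (vline σ y) := by
  obtain ⟨C, -, hC⟩ := hh.bound
  refine ((integrable_norm_vline_rpow (ha.trans_lt hσ) hp).const_mul C).mono'
    (hh.continuous_line hσ).aestronglyMeasurable (Eventually.of_forall fun y => hC _ (by simpa))

lemma DecaysOn.mul {a p q : ℝ} {h k : ℂ → ℂ} (ha : 0 ≤ a) (hh : DecaysOn a p h)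
    (hk : DecaysOn a q k) : DecaysOn a (p + q) fun s => h s * k s := by
  obtain ⟨C, h0, hC⟩ := hh.bound
  obtain ⟨D, h0', hD⟩ := hk.bound
  refine ⟨hh.differentiableOn.mul hk.differentiableOn, C * D, by positivity, fun s hs => ?_⟩
  have hs0 : 0 < ‖s‖ := (ha.trans_lt hs).trans_le (Complex.re_le_norm s)
  rw [norm_mul]
  calc _ ≤ (C * ‖s‖ ^ (-p)) * (D * ‖s‖ ^ (-q)) := by
        gcongr
        · exact hC s hs
        · exact hD s hs
    _ = _ := by rw [neg_add, Real.rpow_add hs0]; ring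

lemma DecaysOn.const_mul {a p : ℝ} {h : ℂ → ℂ} (hh : DecaysOn a p h) (c : ℂ) :
    DecaysOn a p fun s => c * h s := by
  obtain ⟨C, h0, hC⟩ := hh.bound
  refine ⟨hh.differentiableOn.const_mul c, ‖c‖ * C, by positivity, fun s hs => ?_⟩
  rw [norm_mul, mul_assoc]
  gcongr
  exact hC s hs

lemma decaysOn_pow_inv {a : ℝ} (ha : 0 ≤ a) (k : ℕ) : DecaysOn a k fun s => (s ^ k)⁻¹ := by
  refine ⟨?_, 1, zero_le_one, fun s hs => ?_⟩
  · intro s hs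
    have : s ≠ 0 := by
      rintro rfl
      exact absurd hs (by simpa using ha)
    exact ((differentiableAt_id.pow k).inv (pow_ne_zero _ this)).differentiableWithinAt
  · rw [norm_inv, norm_pow, one_mul, Real.rpow_neg (norm_nonneg _), Real.rpow_natCast]

lemma decaysOn_of_bounded {a C : ℝ} {h : ℂ → ℂ} (hd : DifferentiableOn ℂ h {s | a < s.re})
    (hC : ∀ s : ℂ, a < s.re → ‖h s‖ ≤ C) : DecaysOn a 0 h := by
  refine ⟨hd, |C|, abs_nonneg _, fun s hs => ?_⟩
  simpa using (hC s hs).trans (le_abs_self C)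

lemma integrable_exp_mul_line {σ t : ℝ} {h : ℂ → ℂ} (hh : Integrable fun y => h (vline σ y)) :
    Integrable fun y => Complex.exp (vline σ y * t) * h (vline σ y) := by
  refine hh.bdd_mul (c := Real.exp (σ * t)) ?_ (Eventually.of_forall fun y => ?_)
  · have := continuous_vline σ
    exact Continuous.aestronglyMeasurable (by fun_prop)
  · rw [norm_exp_vline_mul]

lemma invLap_const_mul (σ : ℝ) (h : ℂ → ℂ) (t : ℝ) (c : ℂ) :
    invLap σ (fun s => c * h s) t = c * invLap σ h t := by
  unfold invLap
  rw [← integral_const_mul]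
  congr 1 with y
  ring

lemma invLap_add {σ t : ℝ} {h k : ℂ → ℂ} (hh : Integrable fun y => h (vline σ y))
    (hk : Integrable fun y => k (vline σ y)) :
    invLap σ (fun s => h s + k s) t = invLap σ h t + invLap σ k t := by
  unfold invLap
  rw [← integral_add (integrable_exp_mul_line hh) (integrable_exp_mul_line hk)]
  congr 1 with y
  ring

lemma invLap_sub {σ t : ℝ} {h k : ℂ → ℂ} (hh : Integrable fun y => h (vline σ y))
    (hk : Integrable fun y => k (vline σ y)) :
    invLap σ (fun s => h s - k s) t = invLap σ h t - invLap σ k t := by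
  unfold invLap
  rw [← integral_sub (integrable_exp_mul_line hh) (integrable_exp_mul_line hk)]
  congr 1 with y
  ring

lemma invLap_sum {ι : Type*} {σ t : ℝ} {h : ι → ℂ → ℂ} (S : Finset ι)
    (hh : ∀ i, Integrable fun y => h i (vline σ y)) :
    invLap σ (fun s => ∑ i ∈ S, h i s) t = ∑ i ∈ S, invLap σ (h i) t := by
  unfold invLap
  rw [← integral_finsetSum _ fun i _ => integrable_exp_mul_line (hh i)]
  congr 1 with y
  rw [Finset.mul_sum]

lemma norm_invLap_le (σ t : ℝ) (h : ℂ → ℂ) :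
    ‖invLap σ h t‖ ≤ Real.exp (σ * t) * ∫ y : ℝ, ‖h (vline σ y)‖ := by
  unfold invLap
  refine (norm_integral_le_integral_norm _).trans (le_of_eq ?_)
  rw [← integral_const_mul]
  congr 1 with y
  rw [norm_mul, norm_exp_vline_mul]

lemma invLap_exp_shift (σ t r : ℝ) (h : ℂ → ℂ) :
    invLap σ (fun s => Complex.exp (-(s * r)) * h s) t = invLap σ h (t - r) := by
  unfold invLap
  congr 1 with y
  rw [← mul_assoc, ← Complex.exp_add]
  congr 2
  push_cast; ring

/-- Multiplication by `t` corresponds to `-d/ds`. -/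
lemma mul_invLap {σ t : ℝ} {h h' : ℂ → ℂ} (hd : ∀ y, HasDerivAt h (h' (vline σ y)) (vline σ y))
    (hh : Integrable fun y => h (vline σ y)) (hh' : Integrable fun y => h' (vline σ y)) :
    t * invLap σ h t = -invLap σ h' t := by
  have e1 : ∀ y : ℝ, HasDerivAt (fun y => Complex.exp (vline σ y * t))
      (Complex.exp (vline σ y * t) * (Complex.I * t)) y := fun y =>
    ((hasDerivAt_vline σ y).mul_const (t : ℂ)).cexp
  have e2 : ∀ y : ℝ, HasDerivAt (fun y => h (vline σ y)) (h' (vline σ y) * Complex.I) y := fun y =>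
    (hd y).comp y (hasDerivAt_vline σ y)
  have i1 := integrable_exp_mul_line (t := t) hh
  have i2 := integrable_exp_mul_line (t := t) hh'
  have key := integral_mul_deriv_eq_deriv_mul_of_integrable
    (u := fun y => Complex.exp (vline σ y * t)) (v := fun y => h (vline σ y))
    (fun y _ => e1 y) (fun y _ => e2 y)
    ((i2.mul_const Complex.I).congr (Eventually.of_forall fun y => by simp only [Pi.mul_apply]; ring))
    ((i1.mul_const (Complex.I * t)).congr
      (Eventually.of_forall fun y => by simp only [Pi.mul_apply]; ring)) i1
  have k1 : ∫ y : ℝ, Complex.exp (vline σ y * t) * (h' (vline σ y) * Complex.I)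
      = Complex.I * invLap σ h' t := by
    unfold invLap
    rw [← integral_const_mul]
    congr 1 with y; ring
  have k2 : ∫ y : ℝ, Complex.exp (vline σ y * t) * (Complex.I * t) * h (vline σ y)
      = Complex.I * (t * invLap σ h t) := by
    unfold invLap
    rw [← mul_assoc, ← integral_const_mul]
    congr 1 with y; ring
  rw [k1, k2, ← mul_neg] at key
  have := mul_left_cancel₀ Complex.I_ne_zero key
  rw [this, neg_neg]

/-- Differentiation in `t` corresponds to multiplication by `s`. -/
lemma hasDerivAt_invLap {σ : ℝ} {h : ℂ → ℂ} (hh : Integrable fun y => h (vline σ y))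
    (hsh : Integrable fun y => vline σ y * h (vline σ y)) (t : ℝ) :
    HasDerivAt (invLap σ h) (invLap σ (fun s => s * h s) t) t := by
  unfold invLap
  refine (hasDerivAt_integral_of_dominated_loc_of_deriv_le (Metric.ball_mem_nhds t one_pos)
    (F := fun t y => Complex.exp (vline σ y * (t : ℝ)) * h (vline σ y))
    (F' := fun t y => Complex.exp (vline σ y * (t : ℝ)) * (vline σ y * h (vline σ y)))
    (bound := fun y => Real.exp (|σ| * (|t| + 1)) * ‖vline σ y * h (vline σ y)‖)
    (Eventually.of_forall fun t => (integrable_exp_mul_line hh).aestronglyMeasurable)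
    (integrable_exp_mul_line hh) (integrable_exp_mul_line (h := fun s => s * h s) hsh).1
    (Eventually.of_forall fun y x hx => ?_) (hsh.norm.const_mul _)
    (Eventually.of_forall fun y x _ => ?_)).2
  · rw [norm_mul, norm_exp_vline_mul]
    refine mul_le_mul_of_nonneg_right (Real.exp_le_exp.2 ?_) (norm_nonneg _)
    refine (le_abs_self _).trans ?_
    rw [abs_mul]
    gcongr
    rw [Metric.mem_ball, Real.dist_eq] at hx
    have := abs_sub_abs_le_abs_sub x t
    linarith
  · have e : HasDerivAt (fun x : ℝ => Complex.exp (vline σ y * x))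
        (Complex.exp (vline σ y * x) * (vline σ y * 1)) x :=
      ((Complex.ofRealCLM.hasDerivAt (x := x)).const_mul (vline σ y)).cexp
    have e2 := e.mul_const (h (vline σ y))
    rwa [mul_one, mul_assoc] at e2

lemma tendsto_intervalIntegral_of_le {a b : ℝ} {F : ℝ → ℝ → ℂ} {C : ℝ → ℝ}
    (hC : Tendsto C atTop (𝓝 0)) (hF : ∀ᶠ R in atTop, ∀ x ∈ uIoc a b, ‖F R x‖ ≤ C R) :
    Tendsto (fun R => ∫ x in a..b, F R x) atTop (𝓝 0) := by
  refine squeeze_zero_norm' (a := fun R => C R * |b - a|) ?_ (by simpa using hC.mul_const |b - a|)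
  filter_upwards [hF] with R hR
  exact intervalIntegral.norm_integral_le_of_norm_le_const hR

/-- The vertical line of integration may be moved within the half plane of analyticity. -/
lemma invLap_eq_of_decaysOn {a p σ₁ σ₂ : ℝ} {h : ℂ → ℂ} (hh : DecaysOn a p h) (ha : 0 ≤ a)
    (hp : 1 < p) (h₁ : a < σ₁) (h₁₂ : σ₁ ≤ σ₂) (t : ℝ) : invLap σ₁ h t = invLap σ₂ h t := by
  have hdiff : DifferentiableOn ℂ (fun s => Complex.exp (s * t) * h s) {s | a < s.re} := by
    have := hh.differentiableOn
    fun_prop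
  obtain ⟨C, hC0, hC⟩ := hh.bound
  have hrect : ∀ R : ℝ,
      (∫ x : ℝ in σ₁..σ₂, Complex.exp ((x + (-R : ℝ) * Complex.I) * t) * h (x + (-R : ℝ) * Complex.I))
      - (∫ x : ℝ in σ₁..σ₂, Complex.exp ((x + R * Complex.I) * t) * h (x + R * Complex.I))
      + Complex.I • (∫ y : ℝ in (-R)..R, Complex.exp (vline σ₂ y * t) * h (vline σ₂ y))
      - Complex.I • (∫ y : ℝ in (-R)..R, Complex.exp (vline σ₁ y * t) * h (vline σ₁ y)) = 0 := by
    intro R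
    have := Complex.integral_boundary_rect_eq_zero_of_differentiableOn
      (fun s => Complex.exp (s * t) * h s) (vline σ₁ (-R)) (vline σ₂ R) (hdiff.mono ?_)
    · simpa [vline] using this
    · intro s hs
      rw [Complex.mem_reProdIm] at hs
      have := hs.1
      rw [vline_re, vline_re, uIcc_of_le h₁₂] at this
      exact h₁.trans_le this.1
  have hhor : ∀ e : ℝ, |e| = 1 → Tendsto (fun R : ℝ => ∫ x : ℝ in σ₁..σ₂,
      Complex.exp ((x + (e * R : ℝ) * Complex.I) * t) * h (x + (e * R : ℝ) * Complex.I))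
      atTop (𝓝 0) := by
    intro e he
    refine tendsto_intervalIntegral_of_le
      (C := fun R => Real.exp (|σ₂| * |t|) * (C * R ^ (-p))) ?_ ?_
    · have := (tendsto_rpow_neg_atTop (by linarith : 0 < p)).const_mul C
      simpa using this.const_mul (Real.exp (|σ₂| * |t|))
    · filter_upwards [eventually_gt_atTop 0] with R hR x hx
      rw [uIoc_of_le h₁₂] at hx
      change ‖Complex.exp (vline x (e * R) * t) * h (vline x (e * R))‖ ≤ _
      rw [norm_mul, norm_exp_vline_mul]
      have hx0 : 0 < x := ha.trans_lt (h₁.trans hx.1)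
      refine mul_le_mul (Real.exp_le_exp.2 ?_) ?_ (norm_nonneg _) (Real.exp_pos _).le
      · refine (le_abs_self _).trans ?_
        rw [abs_mul]
        gcongr
        exact hx.2
      · refine (hC _ (by simpa using h₁.trans hx.1)).trans ?_
        refine mul_le_mul_of_nonneg_left ?_ hC0
        apply Real.rpow_le_rpow_of_nonpos hR _ (by linarith)
        have := abs_le_norm_vline x (e * R)
        rwa [abs_mul, he, one_mul, abs_of_pos hR] at this
  have hver : ∀ σ, a < σ → Tendsto (fun R : ℝ =>
      ∫ y : ℝ in (-R)..R, Complex.exp (vline σ y * t) * h (vline σ y)) atTop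
      (𝓝 (invLap σ h t)) := fun σ hσ =>
    intervalIntegral_tendsto_integral (integrable_exp_mul_line (hh.integrable_line ha hσ hp))
      tendsto_neg_atTop_atBot tendsto_id
  have hm := hhor (-1) (by simp)
  have hpl := hhor 1 (by simp)
  simp only [neg_mul, one_mul] at hm hpl
  have hlim := ((hm.sub hpl).add ((hver σ₂ (h₁.trans_le h₁₂)).const_smul Complex.I)).sub
    ((hver σ₁ h₁).const_smul Complex.I)
  have h0 := tendsto_nhds_unique hlim (tendsto_const_nhds.congr fun R => (hrect R).symm)
  simp only [sub_self, zero_add, smul_eq_mul] at h0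
  rw [← mul_sub] at h0
  rcases mul_eq_zero.1 h0 with h1 | h1
  · exact absurd h1 Complex.I_ne_zero
  · exact (sub_eq_zero.1 h1).symm

/-- A transform that decays like `e^{-T Re s}` has an inverse transform supported in `t ≥ T`. -/
lemma tendsto_invLap_atTop {p T C a : ℝ} {h : ℂ → ℂ} (hp : 1 < p)
    (hh : ∀ s : ℂ, a < s.re → ‖h s‖ ≤ C * Real.exp (-(T * s.re)) * ‖s‖ ^ (-p)) {t : ℝ}
    (ht : t ≤ T) : Tendsto (fun σ => invLap σ h t) atTop (𝓝 0) := by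
  refine squeeze_zero_norm' (a := fun σ => |C| * lineConst p * σ ^ (-(p - 1))) ?_ ?_
  · filter_upwards [eventually_gt_atTop a, eventually_gt_atTop 0] with σ hσ hσ0
    refine (norm_invLap_le σ t h).trans ?_
    have h1 : ∫ y : ℝ, ‖h (vline σ y)‖
        ≤ ∫ y : ℝ, |C| * Real.exp (-(T * σ)) * ‖vline σ y‖ ^ (-p) := by
      refine integral_mono_of_nonneg (Eventually.of_forall fun y => norm_nonneg _)
        ((integrable_norm_vline_rpow hσ0 hp).const_mul _) (Eventually.of_forall fun y => ?_)
      refine (hh _ (by simpa using hσ)).trans ?_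
      rw [vline_re]
      exact mul_le_mul_of_nonneg_right
        (mul_le_mul_of_nonneg_right (le_abs_self C) (Real.exp_pos _).le) (by positivity)
    rw [integral_const_mul, integral_norm_vline_rpow hσ0] at h1
    have h2 : Real.exp (σ * t) * Real.exp (-(T * σ)) ≤ 1 := by
      rw [← Real.exp_add, Real.exp_le_one_iff]
      nlinarith
    have h3 : 0 ≤ |C| * (σ ^ (1 - p) * lineConst p) := by
      have := lineConst_nonneg p
      positivity
    calc _ ≤ Real.exp (σ * t) * (|C| * Real.exp (-(T * σ)) * (σ ^ (1 - p) * lineConst p)) := by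
          gcongr
      _ = (Real.exp (σ * t) * Real.exp (-(T * σ))) * (|C| * (σ ^ (1 - p) * lineConst p)) := by ring
      _ ≤ 1 * (|C| * (σ ^ (1 - p) * lineConst p)) := by gcongr
      _ = _ := by rw [neg_sub]; ring
  · have := (tendsto_rpow_neg_atTop (by linarith : 0 < p - 1)).const_mul (|C| * lineConst p)
    simpa using this

/-- The inverse transform of an analytic function vanishes for non-positive times. -/
lemma invLap_eq_zero {a p σ : ℝ} {h : ℂ → ℂ} (hh : DecaysOn a p h) (ha : 0 ≤ a)
    (hp : 1 < p) (hσ : a < σ) {t : ℝ} (ht : t ≤ 0) : invLap σ h t = 0 := by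
  obtain ⟨C, -, hC⟩ := hh.bound
  have h1 := tendsto_invLap_atTop (T := 0) (C := C) (a := a) hp
    (fun s hs => by simpa using hC s hs) ht
  refine tendsto_nhds_unique (tendsto_const_nhds.congr' ?_) h1
  filter_upwards [eventually_ge_atTop σ] with σ' hσ'
  exact invLap_eq_of_decaysOn hh ha hp hσ hσ' t

/-- The two-sided Laplace transform. -/
noncomputable def bilatLap (g : ℝ → ℂ) (s : ℂ) : ℂ := ∫ t : ℝ, Complex.exp (-(s * t)) * g t

/-- Laplace inversion for continuous functions, from the Fourier inversion formula. -/
lemma invLap_bilatLap {g : ℝ → ℂ} (hg : Continuous g) {σ : ℝ}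
    (hi : Integrable fun t : ℝ => Real.exp (-(σ * t)) * g t)
    (hl : Integrable fun y => bilatLap g (vline σ y)) (t : ℝ) :
    invLap σ (bilatLap g) t = 2 * Real.pi * g t := by
  open scoped FourierTransform in
  set G : ℝ → ℂ := fun t => Real.exp (-(σ * t)) * g t with hG
  have hFG : ∀ x : ℝ, 𝓕 G x = bilatLap g (vline σ (2 * Real.pi * x)) := by
    intro x
    rw [Real.fourier_real_eq_integral_exp_smul]
    unfold bilatLap
    congr 1 with u
    rw [hG, smul_eq_mul, ← mul_assoc, Complex.ofReal_exp, ← Complex.exp_add]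
    congr 2
    unfold vline
    push_cast; ring
  have hFi : Integrable (𝓕 G) := by
    have := hl.comp_mul_left' (R := 2 * Real.pi) (by positivity)
    exact this.congr (Eventually.of_forall fun x => (hFG x).symm)
  have hGc : Continuous G := by rw [hG]; fun_prop
  have hinv := congrFun (hGc.fourierInv_fourier_eq hi hFi) t
  rw [Real.fourierInv_eq'] at hinv
  have e : invLap σ (bilatLap g) t
      = (2 * Real.pi : ℝ) • ∫ x : ℝ, Complex.exp (vline σ (2 * Real.pi * x) * t) *
        bilatLap g (vline σ (2 * Real.pi * x)) := by
    rw [Measure.integral_comp_mul_left (fun y => Complex.exp (vline σ y * t) *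
        bilatLap g (vline σ y)) (2 * Real.pi), abs_of_pos (by positivity), smul_smul,
      mul_inv_cancel₀ (by positivity), one_smul]
    rfl
  have e2 : ∫ x : ℝ, Complex.exp (vline σ (2 * Real.pi * x) * t) *
        bilatLap g (vline σ (2 * Real.pi * x)) = Real.exp (σ * t) * G t := by
    rw [← hinv, ← integral_const_mul]
    congr 1 with x
    rw [hFG, smul_eq_mul, ← mul_assoc, Complex.ofReal_exp, ← Complex.exp_add]
    congr 2
    unfold vline
    simp only [RCLike.inner_apply, conj_trivial]
    push_cast; ring
  rw [e, e2, hG]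
  simp only
  rw [← mul_assoc, ← Complex.ofReal_mul, ← Real.exp_add]
  simp

/-- Cauchy's estimate on a disc of radius proportional to the distance to the origin: every
derivative gains one power of decay. -/
lemma norm_iteratedDeriv_le_of_decay {h : ℂ → ℂ} {s : ℂ} {c C p : ℝ} (hc : 0 < c) (hc2 : c ≤ 1 / 2)
    (hs : s ≠ 0) (hd : DifferentiableOn ℂ h (Metric.closedBall s (c * ‖s‖))) (hC : 0 ≤ C)
    (hb : ∀ w ∈ Metric.closedBall s (c * ‖s‖), ‖h w‖ ≤ C * ‖w‖ ^ (-p)) (k : ℕ) :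
    ‖iteratedDeriv k h s‖ ≤ k.factorial * (C * 2 ^ |p|) / c ^ k * ‖s‖ ^ (-(p + k)) := by
  have hsp : 0 < ‖s‖ := norm_pos_iff.2 hs
  have hr : 0 < c * ‖s‖ := by positivity
  have h1 := Complex.norm_iteratedDeriv_le_of_forall_mem_sphere_norm_le (C := C * 2 ^ |p| * ‖s‖ ^ (-p))
    k hr (DifferentiableOn.diffContOnCl (by rwa [closure_ball s hr.ne'])) ?_
  · refine h1.trans (le_of_eq ?_)
    rw [mul_pow, neg_add, Real.rpow_add hsp, Real.rpow_neg hsp.le (k : ℝ), Real.rpow_natCast]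
    field_simp
  · intro w hw
    refine (hb w (Metric.sphere_subset_closedBall hw)).trans ?_
    rw [mul_assoc]
    gcongr
    rw [mem_sphere_iff_norm] at hw
    have a1 : ‖s‖ / 2 ≤ ‖w‖ := by
      have : ‖s‖ ≤ ‖w‖ + ‖w - s‖ := by simpa using norm_sub_le w (w - s)
      nlinarith
    have a2 : ‖w‖ ≤ 2 * ‖s‖ := by
      have : ‖w‖ ≤ ‖s‖ + ‖w - s‖ := by simpa using norm_add_le s (w - s)
      nlinarith
    have hwp : 0 < ‖w‖ := by linarith
    rcases le_total 0 p with hp | hp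
    · rw [abs_of_nonneg hp, Real.rpow_neg hwp.le, Real.rpow_neg hsp.le]
      have : (‖s‖ / 2) ^ p ≤ ‖w‖ ^ p := by gcongr
      rw [Real.div_rpow hsp.le zero_le_two] at this
      rw [← div_eq_mul_inv, inv_le_comm₀ (by positivity) (by positivity), inv_div]
      exact this
    · rw [abs_of_nonpos hp, ← Real.mul_rpow zero_le_two hsp.le]
      exact Real.rpow_le_rpow hwp.le a2 (by linarith)

lemma DecaysOn.iteratedDeriv {a b p : ℝ} {h : ℂ → ℂ} (hh : DecaysOn a p h) (ha : 0 ≤ a)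
    (hab : a < b) (k : ℕ) : DecaysOn b p (iteratedDeriv k h) := by
  obtain ⟨C, hC0, hC⟩ := hh.bound
  have han : AnalyticOnNhd ℂ h {s | a < s.re} :=
    hh.differentiableOn.analyticOnNhd (isOpen_halfPlane a)
  have hb : 0 < b := ha.trans_lt hab
  set ρ : ℝ := (b - a) / 2 with hρ
  have hρ0 : 0 < ρ := by rw [hρ]; linarith
  have hsub : ∀ s : ℂ, b < s.re → Metric.closedBall s ρ ⊆ {s | a < s.re} := by
    intro s hs w hw
    rw [mem_closedBall_iff_norm] at hw
    have h1 := (abs_le.1 ((Complex.abs_re_le_norm (w - s)).trans hw)).1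
    rw [Complex.sub_re] at h1
    simp only [mem_ofPred_eq]
    linarith
  refine ⟨fun s hs => ?_, k.factorial * (C * 2 ^ |p|) / ρ ^ k, by positivity, fun s hs => ?_⟩
  · have h1 := han.iterated_deriv k s (hab.trans hs)
    rw [← iteratedDeriv_eq_iterate] at h1
    exact h1.differentiableAt.differentiableWithinAt
  · have hsb : b < ‖s‖ := hs.trans_le (Complex.re_le_norm s)
    have hsp : 0 < ‖s‖ := hb.trans hsb
    have e : ρ / ‖s‖ * ‖s‖ = ρ := by field_simp
    have h1 := norm_iteratedDeriv_le_of_decay (h := h) (s := s) (c := ρ / ‖s‖) (C := C) (p := p)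
      (by positivity) (by rw [div_le_iff₀ hsp]; linarith) (norm_pos_iff.1 hsp)
      (by rw [e]; exact hh.differentiableOn.mono (hsub s hs)) hC0
      (fun w hw => hC w (hsub s hs (by rwa [e] at hw))) k
    refine h1.trans (le_of_eq ?_)
    rw [div_pow, neg_add, Real.rpow_add hsp, Real.rpow_neg hsp.le (k : ℝ), Real.rpow_natCast]
    field_simp

lemma hasDerivAt_iteratedDeriv {h : ℂ → ℂ} {s : ℂ} (hh : AnalyticAt ℂ h s) (k : ℕ) :
    HasDerivAt (iteratedDeriv k h) (iteratedDeriv (k + 1) h s) s := by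
  rw [iteratedDeriv_succ]
  refine DifferentiableAt.hasDerivAt ?_
  rw [iteratedDeriv_eq_iterate]
  exact (hh.iterated_deriv k).differentiableAt

/-- Three integrations by parts: `t³ L[h](t) = -L[h'''](t)`, when `h` decays along the line. -/
lemma cube_mul_invLap {σ t : ℝ} {h : ℂ → ℂ} (han : ∀ y, AnalyticAt ℂ h (vline σ y))
    (hi : ∀ k ≤ 3, Integrable fun y => iteratedDeriv k h (vline σ y)) :
    (t : ℂ) ^ 3 * invLap σ h t = -invLap σ (iteratedDeriv 3 h) t := by
  have step : ∀ k, k + 1 ≤ 3 →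
      t * invLap σ (iteratedDeriv k h) t = -invLap σ (iteratedDeriv (k + 1) h) t := fun k hk =>
    mul_invLap (fun y => hasDerivAt_iteratedDeriv (han y) k) (hi k (by omega)) (hi (k + 1) hk)
  have h0 := step 0 (by norm_num)
  have h1 := step 1 (by norm_num)
  have h2 := step 2 (by norm_num)
  rw [iteratedDeriv_zero] at h0
  norm_num at h0 h1 h2
  linear_combination (t : ℂ) ^ 2 * h0 - t * h1 + h2

/-! ### Laplace transforms of causal functions -/

/-- Functions that vanish for `t ≤ 0` and whose Laplace transform converges absolutely on the line
`Re s = σ`. -/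
structure LapAt (σ : ℝ) (g : ℝ → ℂ) : Prop where
  zero : ∀ t ≤ 0, g t = 0
  integrable : Integrable fun t : ℝ => (Real.exp (-(σ * t)) : ℂ) * g t

lemma LapAt.aestronglyMeasurable {σ : ℝ} {g : ℝ → ℂ} (hg : LapAt σ g) :
    AEStronglyMeasurable g volume := by
  have h1 : AEStronglyMeasurable (fun t : ℝ => (Real.exp (σ * t) : ℂ)
      * ((Real.exp (-(σ * t)) : ℂ) * g t)) volume :=
    (Continuous.aestronglyMeasurable (by fun_prop)).mul hg.integrable.1
  refine h1.congr (Eventually.of_forall fun t => ?_)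
  simp only
  rw [← mul_assoc, ← Complex.ofReal_mul, ← Real.exp_add]
  simp

lemma norm_exp_neg_mul_ofReal (s : ℂ) (t : ℝ) :
    ‖Complex.exp (-(s * t))‖ = Real.exp (-(s.re * t)) := by
  rw [Complex.norm_exp]; simp

lemma LapAt.integrable_exp {σ : ℝ} {g : ℝ → ℂ} (hg : LapAt σ g) {s : ℂ} (hs : σ ≤ s.re) :
    Integrable fun t : ℝ => Complex.exp (-(s * t)) * g t := by
  refine hg.integrable.mono ((Continuous.aestronglyMeasurable (by fun_prop)).mul
    hg.aestronglyMeasurable) (Eventually.of_forall fun t => ?_)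
  rw [norm_mul, norm_mul, norm_exp_neg_mul_ofReal, Complex.norm_real,
    Real.norm_of_nonneg (Real.exp_pos _).le]
  rcases le_or_gt t 0 with h | h
  · simp [hg.zero t h]
  · gcongr

lemma LapAt.mono {σ σ' : ℝ} {g : ℝ → ℂ} (hg : LapAt σ g) (h : σ ≤ σ') : LapAt σ' g :=
  ⟨hg.zero, by simpa using hg.integrable_exp (s := (σ' : ℂ)) (by simpa using h)⟩

lemma LapAt.add {σ : ℝ} {g k : ℝ → ℂ} (hg : LapAt σ g) (hk : LapAt σ k) :
    LapAt σ fun t => g t + k t :=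
  ⟨fun t ht => by simp [hg.zero t ht, hk.zero t ht], by
    refine (hg.integrable.add hk.integrable).congr (Eventually.of_forall fun t => ?_)
    simp only [Pi.add_apply]; ring⟩

lemma LapAt.const_mul {σ : ℝ} {g : ℝ → ℂ} (hg : LapAt σ g) (c : ℂ) :
    LapAt σ fun t => c * g t :=
  ⟨fun t ht => by simp [hg.zero t ht], by
    refine (hg.integrable.const_mul c).congr (Eventually.of_forall fun t => ?_)
    simp only; ring⟩

lemma bilatLap_add {σ : ℝ} {g k : ℝ → ℂ} (hg : LapAt σ g) (hk : LapAt σ k) {s : ℂ}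
    (hs : σ ≤ s.re) : bilatLap (fun t => g t + k t) s = bilatLap g s + bilatLap k s := by
  unfold bilatLap
  rw [← integral_add (hg.integrable_exp hs) (hk.integrable_exp hs)]
  simp only [mul_add]

lemma bilatLap_const_mul (c : ℂ) (g : ℝ → ℂ) (s : ℂ) :
    bilatLap (fun t => c * g t) s = c * bilatLap g s := by
  unfold bilatLap
  rw [← integral_const_mul]
  congr 1 with t; ring

/-- The Laplace transform of a function that vanishes up to time `T` decays like `e^{-T Re s}`. -/
lemma LapAt.norm_bilatLap_le_exp {σ T : ℝ} {g : ℝ → ℂ} (hg : LapAt σ g)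
    (hT : ∀ t ≤ T, g t = 0) {s : ℂ} (hs : σ ≤ s.re) :
    ‖bilatLap g s‖ ≤ Real.exp (-(T * (s.re - σ))) * ∫ t : ℝ, ‖(Real.exp (-(σ * t)) : ℂ) * g t‖ := by
  unfold bilatLap
  refine (norm_integral_le_integral_norm _).trans ?_
  rw [← integral_const_mul]
  refine integral_mono (hg.integrable_exp hs).norm (hg.integrable.norm.const_mul _) fun t => ?_
  simp only [norm_mul, norm_exp_neg_mul_ofReal, Complex.norm_real,
    Real.norm_of_nonneg (Real.exp_pos _).le]
  rcases le_or_gt t T with h | h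
  · simp [hT t h]
  · rw [← mul_assoc, ← Real.exp_add]
    gcongr
    nlinarith

lemma LapAt.norm_bilatLap_le {σ : ℝ} {g : ℝ → ℂ} (hg : LapAt σ g) {s : ℂ} (hs : σ ≤ s.re) :
    ‖bilatLap g s‖ ≤ ∫ t : ℝ, ‖(Real.exp (-(σ * t)) : ℂ) * g t‖ := by
  simpa using hg.norm_bilatLap_le_exp hg.zero hs

lemma LapAt.continuous_bilatLap {σ : ℝ} {g : ℝ → ℂ} (hg : LapAt σ g) :
    Continuous fun y => bilatLap g (vline σ y) := by
  unfold bilatLap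
  refine continuous_of_dominated (bound := fun t => ‖(Real.exp (-(σ * t)) : ℂ) * g t‖)
    (fun y => (hg.integrable_exp (by simp)).1) (fun y => Eventually.of_forall fun t => ?_)
    hg.integrable.norm (Eventually.of_forall fun t => ?_)
  · rw [norm_mul, norm_mul, norm_exp_neg_mul_ofReal, Complex.norm_real,
      Real.norm_of_nonneg (Real.exp_pos _).le, vline_re]
  · have := continuous_vline σ
    fun_prop

lemma LapAt.differentiableAt_bilatLap {σ : ℝ} {g : ℝ → ℂ} (hg : LapAt σ g) {s : ℂ} (hs : σ < s.re) :
    DifferentiableAt ℂ (bilatLap g) s := by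
  set δ : ℝ := (s.re - σ) / 2 with hδ
  have hδ0 : 0 < δ := by rw [hδ]; linarith
  refine (hasDerivAt_integral_of_dominated_loc_of_deriv_le (Metric.ball_mem_nhds s hδ0)
    (F := fun (w : ℂ) (t : ℝ) => Complex.exp (-(w * t)) * g t)
    (F' := fun (w : ℂ) (t : ℝ) => Complex.exp (-(w * t)) * (-(1 * t)) * g t)
    (bound := fun t => 1 / δ * ‖(Real.exp (-(σ * t)) : ℂ) * g t‖)
    (Eventually.of_forall fun w => (Continuous.aestronglyMeasurable (by fun_prop)).mul
        hg.aestronglyMeasurable)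
    (hg.integrable_exp hs.le) ((Continuous.aestronglyMeasurable (by fun_prop)).mul
        hg.aestronglyMeasurable)
    (Eventually.of_forall fun t w hw => ?_) (hg.integrable.norm.const_mul _)
    (Eventually.of_forall fun t w _ => ?_)).2.differentiableAt
  · rw [norm_mul, norm_mul, norm_mul, norm_exp_neg_mul_ofReal, Complex.norm_real,
      Real.norm_of_nonneg (Real.exp_pos _).le, norm_neg, one_mul, Complex.norm_real]
    rcases le_or_gt t 0 with h | h
    · simp [hg.zero t h]
    · rw [← mul_assoc]
      refine mul_le_mul_of_nonneg_right ?_ (norm_nonneg _)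
      rw [Real.norm_of_nonneg h.le]
      rw [mem_ball_iff_norm] at hw
      have h1 := (abs_lt.1 ((Complex.abs_re_le_norm (w - s)).trans_lt hw)).1
      rw [Complex.sub_re] at h1
      have h2 : Real.exp (-(w.re * t)) ≤ Real.exp (-(σ * t)) * Real.exp (-(δ * t)) := by
        rw [← Real.exp_add]
        apply Real.exp_le_exp.2
        nlinarith
      have h3 : δ * t * Real.exp (-(δ * t)) ≤ 1 := by
        have := Real.add_one_le_exp (δ * t)
        have h4 : Real.exp (δ * t) * Real.exp (-(δ * t)) = 1 := by rw [← Real.exp_add]; simp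
        nlinarith [Real.exp_pos (-(δ * t))]
      rw [one_div, ← div_eq_inv_mul, le_div_iff₀ hδ0]
      calc Real.exp (-(w.re * t)) * t * δ
          ≤ Real.exp (-(σ * t)) * Real.exp (-(δ * t)) * t * δ := by gcongr
        _ = Real.exp (-(σ * t)) * (δ * t * Real.exp (-(δ * t))) := by ring
        _ ≤ Real.exp (-(σ * t)) * 1 := by gcongr
        _ = _ := mul_one _
  · exact (((hasDerivAt_id w).mul_const (t : ℂ)).neg.cexp).mul_const (g t)

/-- The convolution of functions on the line. -/
noncomputable def conv (a b : ℝ → ℂ) (t : ℝ) : ℂ := ∫ r : ℝ, a r * b (t - r)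

lemma exp_mul_conv (s : ℂ) (a b : ℝ → ℂ) (t : ℝ) :
    Complex.exp (-(s * t)) * conv a b t = convolution (fun r : ℝ => Complex.exp (-(s * r)) * a r)
      (fun r : ℝ => Complex.exp (-(s * r)) * b r) (ContinuousLinearMap.mul ℂ ℂ) volume t := by
  unfold conv convolution
  rw [← integral_const_mul]
  congr 1 with r
  simp only [ContinuousLinearMap.mul_apply']
  have : Complex.exp (-(s * t)) = Complex.exp (-(s * r)) * Complex.exp (-(s * (t - r : ℝ))) := by
    rw [← Complex.exp_add]; congr 1; push_cast; ring
  rw [this]; ring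

lemma LapAt.conv {σ : ℝ} {a b : ℝ → ℂ} (ha : LapAt σ a) (hb : LapAt σ b) :
    LapAt σ (conv a b) := by
  refine ⟨fun t ht => ?_, ?_⟩
  · unfold SubdiffusionCN.conv
    rw [integral_eq_zero_of_ae]
    refine Eventually.of_forall fun r => ?_
    rcases le_or_gt r 0 with h | h
    · simp [ha.zero r h]
    · simp [hb.zero (t - r) (by linarith)]
  · have h1 := (ha.integrable_exp (s := σ) (by simp)).integrable_convolution
      (ContinuousLinearMap.mul ℂ ℂ) (hb.integrable_exp (s := σ) (by simp))
    refine h1.congr (Eventually.of_forall fun t => ?_)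
    rw [← exp_mul_conv]
    simp

lemma bilatLap_conv {σ : ℝ} {a b : ℝ → ℂ} (ha : LapAt σ a) (hb : LapAt σ b) {s : ℂ}
    (hs : σ ≤ s.re) : bilatLap (conv a b) s = bilatLap a s * bilatLap b s := by
  have h1 := integral_convolution (ContinuousLinearMap.mul ℂ ℂ) (ha.integrable_exp hs)
    (hb.integrable_exp hs)
  simp_rw [← exp_mul_conv] at h1
  exact h1

/-- The kernel `t^(a-1)` for `t > 0`, zero for `t ≤ 0`. -/
noncomputable def powKer (a t : ℝ) : ℂ := if 0 < t then ((t ^ (a - 1) : ℝ) : ℂ) else 0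

lemma exp_mul_powKer_eq_indicator (a : ℝ) (s : ℂ) :
    (fun t : ℝ => Complex.exp (-(s * t)) * powKer a t)
      = (Ioi (0 : ℝ)).indicator fun t : ℝ => (t : ℂ) ^ ((a : ℂ) - 1) * Complex.exp (-(s * t)) := by
  funext t
  by_cases ht : 0 < t
  · rw [indicator_of_mem (mem_Ioi.2 ht), powKer, if_pos ht, Complex.ofReal_cpow ht.le, mul_comm]
    push_cast; rfl
  · rw [indicator_of_notMem (by simpa using ht), powKer, if_neg ht, mul_zero]

lemma lapAt_powKer {a σ : ℝ} (ha : 0 < a) (hσ : 0 < σ) : LapAt σ (powKer a) := by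
  refine ⟨fun t ht => by rw [powKer, if_neg ht.not_gt], ?_⟩
  have h1 := integrableOn_rpow_mul_exp_neg_mul_rpow (s := a - 1) (p := 1) (b := σ)
    (by linarith) zero_lt_one hσ
  have h2 := (h1.integrable_indicator measurableSet_Ioi).ofReal (𝕜 := ℂ)
  refine h2.congr (Eventually.of_forall fun t => ?_)
  simp only
  by_cases ht : 0 < t
  · rw [indicator_of_mem (mem_Ioi.2 ht), powKer, if_pos ht, Real.rpow_one]
    simp [mul_comm]
  · rw [indicator_of_notMem (by simpa using ht), powKer, if_neg ht]
    simp

/-- The Laplace transform of a power: Euler's integral on the positive real axis, and the identity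
theorem in the half plane. -/
lemma bilatLap_powKer {a : ℝ} (ha : 0 < a) {s : ℂ} (hs : 0 < s.re) :
    bilatLap (powKer a) s = Real.Gamma a * s ^ (-(a : ℂ)) := by
  have hopen := isOpen_halfPlane 0
  have h1 : AnalyticOnNhd ℂ (bilatLap (powKer a)) {s : ℂ | 0 < s.re} := by
    apply DifferentiableOn.analyticOnNhd _ hopen
    intro s hs
    have hs : 0 < s.re := hs
    exact ((lapAt_powKer ha (half_pos hs)).differentiableAt_bilatLap
      (half_lt_self hs)).differentiableWithinAt
  have h2 : AnalyticOnNhd ℂ (fun s : ℂ => (Real.Gamma a : ℂ) * s ^ (-(a : ℂ)))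
      {s : ℂ | 0 < s.re} := by
    apply DifferentiableOn.analyticOnNhd _ hopen
    intro s hs
    refine ((differentiableAt_id.cpow_const ?_).const_mul _).differentiableWithinAt
    exact Or.inl hs
  have hconn : IsPreconnected {s : ℂ | 0 < s.re} :=
    (convex_halfSpace_re_gt 0).isPreconnected
  have hreal : ∀ x : ℝ, 0 < x → bilatLap (powKer a) x = Real.Gamma a * (x : ℂ) ^ (-(a : ℂ)) := by
    intro x hx
    unfold bilatLap
    rw [exp_mul_powKer_eq_indicator, integral_indicator measurableSet_Ioi,
      Complex.integral_cpow_mul_exp_neg_mul_Ioi (by simpa using ha) hx, Complex.Gamma_ofReal,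
      one_div, Complex.inv_cpow _ _ (by rw [Complex.arg_ofReal_of_nonneg hx.le]; exact
        Real.pi_pos.ne), Complex.cpow_neg, mul_comm]
  refine h1.eqOn_of_preconnected_of_frequently_eq h2 hconn (z₀ := 1) (by simp) ?_ hs
  have hseq : Tendsto (fun n : ℕ => ((1 + 1 / ((n : ℝ) + 1) : ℝ) : ℂ)) atTop (𝓝[≠] 1) := by
    rw [tendsto_nhdsWithin_iff]
    constructor
    · have : Tendsto (fun n : ℕ => (1 + 1 / ((n : ℝ) + 1) : ℝ)) atTop (𝓝 (1 + 0)) :=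
        tendsto_one_div_add_atTop_nhds_zero_nat.const_add 1
      rw [add_zero] at this
      exact (Complex.continuous_ofReal.tendsto 1).comp this
    · refine Eventually.of_forall fun n => ?_
      simp only [mem_compl_iff, mem_singleton_iff]
      intro h
      have h' : (1 + 1 / ((n : ℝ) + 1) : ℝ) = 1 := by exact_mod_cast h
      have : (0 : ℝ) < 1 / ((n : ℝ) + 1) := by positivity
      linarith
  refine hseq.frequently (Frequently.of_forall fun n => hreal _ (by positivity))

lemma conv_powKer_eq {a t : ℝ} (ht : 0 ≤ t) {g : ℝ → ℂ} (hg : ∀ r ≤ 0, g r = 0) :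
    conv (powKer a) g t = ∫ r in (0 : ℝ)..t, (((t - r) ^ (a - 1) : ℝ) : ℂ) * g r := by
  unfold conv
  have h1 : ∫ r : ℝ, powKer a r * g (t - r) = ∫ r : ℝ, powKer a (t - r) * g r := by
    rw [← integral_sub_left_eq_self _ volume t]
    simp
  rw [h1, intervalIntegral.integral_of_le ht, ← integral_Ioc_eq_integral_Ioo.symm,
    ← integral_indicator measurableSet_Ioo]
  congr 1 with r
  by_cases hr : r ∈ Ioo 0 t
  · rw [indicator_of_mem hr, powKer, if_pos (by linarith [hr.2])]
  · rw [indicator_of_notMem hr]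
    rcases le_or_gt r 0 with h | h
    · simp [hg r h]
    · have : ¬ 0 < t - r := fun h' => hr ⟨h, by linarith⟩
      rw [powKer, if_neg this, zero_mul]

/-- The part of a function on positive times. -/
noncomputable def causal (g : ℝ → ℂ) : ℝ → ℂ := (Ioi (0 : ℝ)).indicator g

lemma causal_of_pos {g : ℝ → ℂ} {t : ℝ} (ht : 0 < t) : causal g t = g t :=
  indicator_of_mem (mem_Ioi.2 ht) g

lemma causal_of_nonpos {g : ℝ → ℂ} {t : ℝ} (ht : t ≤ 0) : causal g t = 0 :=
  indicator_of_notMem (by simpa using ht) g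

lemma primitive_of_nonpos {H : Type*} [NormedAddCommGroup H] [NormedSpace ℝ H] (g : ℝ → H) {t : ℝ}
    (ht : t ≤ 0) : primitive g t = 0 := by
  simp [primitive, max_eq_right ht]

lemma conv_powKer_one (g : ℝ → ℂ) : conv (powKer 1) (causal g) = primitive g := by
  funext t
  rcases le_or_gt t 0 with h | h
  · rw [primitive_of_nonpos g h]
    unfold conv
    rw [integral_eq_zero_of_ae]
    refine Eventually.of_forall fun r => ?_
    rcases le_or_gt r 0 with h' | h'
    · simp [powKer, h'.not_gt]
    · simp [causal_of_nonpos (show t - r ≤ 0 by linarith)]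
  · rw [conv_powKer_eq h.le fun r hr => causal_of_nonpos hr, primitive, max_eq_left h.le]
    refine intervalIntegral.integral_congr_ae (Eventually.of_forall fun r hr => ?_)
    rw [uIoc_of_le h.le] at hr
    rw [causal_of_pos hr.1]
    simp

lemma conv_powKer_caputo {α t : ℝ} (ht : 0 < t) (u : ℝ → ℂ) :
    ((Real.Gamma (1 - α))⁻¹ : ℂ) * conv (powKer (1 - α)) (causal u) t = caputo α u t := by
  rw [conv_powKer_eq ht.le fun r hr => causal_of_nonpos hr]
  unfold caputo
  rw [Complex.real_smul]
  push_cast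
  congr 1
  refine intervalIntegral.integral_congr_ae (Eventually.of_forall fun r hr => ?_)
  rw [uIoc_of_le ht.le] at hr
  rw [causal_of_pos hr.1, Complex.real_smul, show 1 - α - 1 = -α by ring]

lemma causal_primitive (g : ℝ → ℂ) : causal (primitive g) = primitive g := by
  funext t
  rcases le_or_gt t 0 with h | h
  · rw [causal_of_nonpos h, primitive_of_nonpos g h]
  · rw [causal_of_pos h]

lemma LapAt.primitive {σ : ℝ} {g : ℝ → ℂ} (hσ : 0 < σ) (hg : LapAt σ (causal g)) :
    LapAt σ (primitive g) := by
  rw [← conv_powKer_one]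
  exact (lapAt_powKer one_pos hσ).conv hg

lemma bilatLap_primitive {σ : ℝ} {g : ℝ → ℂ} (hσ : 0 < σ) (hg : LapAt σ (causal g)) {s : ℂ}
    (hs : σ ≤ s.re) : bilatLap (SubdiffusionCN.primitive g) s = s⁻¹ * bilatLap (causal g) s := by
  rw [← conv_powKer_one, bilatLap_conv (lapAt_powKer one_pos hσ) hg hs,
    bilatLap_powKer one_pos (hσ.trans_le hs)]
  simp [Complex.cpow_neg_one]

lemma LapAt.intervalIntegrable {σ : ℝ} {g : ℝ → ℂ} (hg : LapAt σ g) (a b : ℝ) :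
    IntervalIntegrable g volume a b := by
  have h := (hg.integrable.intervalIntegrable (a := a) (b := b)).continuousOn_mul
    (g := fun t : ℝ => (Real.exp (σ * t) : ℂ)) (by fun_prop)
  refine h.congr_ae (Eventually.of_forall fun t => ?_)
  simp only
  rw [← mul_assoc, ← Complex.ofReal_mul, ← Real.exp_add]
  simp

lemma continuous_primitive {σ : ℝ} {g : ℝ → ℂ} (hg : LapAt σ (causal g)) :
    Continuous (SubdiffusionCN.primitive g) := by
  have h2 := intervalIntegral.continuous_primitive hg.intervalIntegrable 0
  have h3 : SubdiffusionCN.primitive g = fun t => ∫ ξ in (0 : ℝ)..(max t 0), causal g ξ := by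
    funext t
    unfold SubdiffusionCN.primitive
    refine intervalIntegral.integral_congr_ae (Eventually.of_forall fun r hr => ?_)
    rw [uIoc_of_le (le_max_right _ _)] at hr
    rw [causal_of_pos hr.1]
  rw [h3]
  exact h2.comp (continuous_id.max continuous_const)

/-- Laplace inversion for the iterated primitive, which is continuous and whose transform is
integrable. -/
lemma invLap_primitive_primitive {σ : ℝ} {g : ℝ → ℂ} (hσ : 0 < σ) (hg : LapAt σ (causal g)) (t : ℝ) :
    Integrable (fun y => (vline σ y ^ 2)⁻¹ * bilatLap (causal g) (vline σ y)) ∧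
    invLap σ (fun s => (s ^ 2)⁻¹ * bilatLap (causal g) s) t
      = 2 * Real.pi * SubdiffusionCN.primitive (SubdiffusionCN.primitive g) t := by
  have hp : LapAt σ (causal (SubdiffusionCN.primitive g)) := by
    rw [causal_primitive]; exact hg.primitive hσ
  have e : ∀ s : ℂ, σ ≤ s.re →
      bilatLap (SubdiffusionCN.primitive (SubdiffusionCN.primitive g)) s
        = (s ^ 2)⁻¹ * bilatLap (causal g) s := fun s hs => by
    rw [bilatLap_primitive hσ hp hs, causal_primitive, bilatLap_primitive hσ hg hs, sq, mul_inv,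
      mul_assoc]
  have hi : Integrable (fun y => (vline σ y ^ 2)⁻¹ * bilatLap (causal g) (vline σ y)) := by
    refine Integrable.mul_bdd (c := ∫ t : ℝ, ‖(Real.exp (-(σ * t)) : ℂ) * causal g t‖) ?_
      hg.continuous_bilatLap.aestronglyMeasurable
      (Eventually.of_forall fun y => hg.norm_bilatLap_le (by simp))
    exact (decaysOn_pow_inv le_rfl 2).integrable_line le_rfl hσ (by norm_num)
  refine ⟨hi, ?_⟩
  rw [← invLap_bilatLap (σ := σ) (continuous_primitive hp) (hp.primitive hσ).integrable]
  · unfold invLap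
    congr 1 with y
    rw [e _ (by simp)]
  · exact hi.congr (Eventually.of_forall fun y => (e _ (by simp)).symm)

/-! ### The exact solution in one eigenspace -/

/-- The resolvent kernel `1 / (s^α + λ)` of the exact problem. -/
noncomputable def exactKernel (α lam : ℝ) (s : ℂ) : ℂ := (s ^ (α : ℂ) + lam)⁻¹

lemma exactKernel_bounds {α ϑ lam : ℝ} (hα : 0 < α) (hϑ : ϑ < Real.pi)
    (hαϑ : α * ϑ < Real.pi / 2) (hϑ0 : 0 ≤ ϑ) (hl : 0 ≤ lam) {s : ℂ} (hs : s ≠ 0)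
    (harg : |s.arg| ≤ ϑ) :
    s ^ (α : ℂ) + lam ≠ 0 ∧ DifferentiableAt ℂ (exactKernel α lam) s ∧
      ‖exactKernel α lam s‖ ≤ (Real.cos (α * ϑ))⁻¹ * ‖s‖ ^ (-α) := by
  have hpi := Real.pi_pos
  have hsp : 0 < ‖s‖ := norm_pos_iff.2 hs
  have hcos : 0 < Real.cos (α * ϑ) := Real.cos_pos_of_mem_Ioo ⟨by nlinarith, hαϑ⟩
  have h1 := cos_mul_norm_rpow_le_re_cpow hα (by linarith : α * ϑ ≤ Real.pi) harg
  have h2 := mul_le_norm_add_ofReal_mul (b := 1) hl h1 (by simp)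
  rw [mul_one] at h2
  have h3 : 0 < Real.cos (α * ϑ) * ‖s‖ ^ α := by positivity
  have h4 : s ^ (α : ℂ) + lam ≠ 0 := norm_pos_iff.1 (h3.trans_le h2)
  refine ⟨h4, ?_, ?_⟩
  · have hslit : s ∈ Complex.slitPlane := by
      rw [Complex.mem_slitPlane_iff_arg]
      refine ⟨fun h => ?_, hs⟩
      rw [h, abs_of_pos hpi] at harg
      linarith
    exact ((differentiableAt_id.cpow_const hslit).add_const _).inv h4
  · unfold exactKernel
    rw [norm_inv, Real.rpow_neg hsp.le, ← mul_inv]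
    exact inv_anti₀ h3 h2

lemma abs_arg_le_pi_div_two {s : ℂ} (hs : 0 ≤ s.re) : |s.arg| ≤ Real.pi / 2 :=
  Complex.abs_arg_le_pi_div_two_iff.2 hs

lemma decaysOn_exactKernel {α lam a : ℝ} (hα : 0 < α) (hα1 : α < 1) (hl : 0 ≤ lam) (ha : 0 ≤ a) :
    DecaysOn a α (exactKernel α lam) := by
  have hpi := Real.pi_pos
  have hcos : 0 < Real.cos (α * (Real.pi / 2)) :=
    Real.cos_pos_of_mem_Ioo ⟨by nlinarith, by nlinarith⟩
  have key : ∀ s : ℂ, a < s.re → DifferentiableAt ℂ (exactKernel α lam) s ∧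
      ‖exactKernel α lam s‖ ≤ (Real.cos (α * (Real.pi / 2)))⁻¹ * ‖s‖ ^ (-α) := fun s hs => by
    have hs0 : s ≠ 0 := by
      rintro rfl
      exact absurd hs (by simpa using ha)
    exact (exactKernel_bounds hα (by linarith) (by nlinarith) (by linarith) hl hs0
      (abs_arg_le_pi_div_two (ha.trans hs.le))).2
  exact ⟨fun s hs => (key s hs).1.differentiableWithinAt, _, (by positivity),
    fun s hs => (key s hs).2⟩

lemma primitive_congr_of_le {T : ℝ} {g k : ℝ → ℂ} (h : ∀ x ≤ T, g x = k x) {x : ℝ} (hx : x ≤ T) :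
    primitive g x = primitive k x := by
  unfold primitive
  refine intervalIntegral.integral_congr_ae (Eventually.of_forall fun y hy => ?_)
  rw [uIoc_of_le (le_max_right _ _)] at hy
  rcases le_or_gt x 0 with h' | h'
  · rw [max_eq_right h'] at hy
    exact absurd hy.1 (not_lt.2 hy.2)
  · rw [max_eq_left h'.le] at hy
    exact h y (hy.2.trans hx)

lemma lapAt_causal_indicator {T : ℝ} {u : ℝ → ℂ} (hu : IntegrableOn u (Ioc 0 T)) :
    LapAt 0 (causal ((Iic T).indicator u)) := by
  refine ⟨fun t ht => causal_of_nonpos ht, ?_⟩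
  rw [causal, indicator_indicator, Ioi_inter_Iic]
  simpa using hu.integrable_indicator measurableSet_Ioc

/-- The transform of the exact solution. The truncation of `u` at time `T` solves the problem with a
residual that is supported in `t ≥ T`, and such a residual does not affect earlier times. -/
theorem primitive_primitive_exact {α lam T r ε μ : ℝ} (hα : 0 < α) (hα1 : α < 1) (hl : 0 ≤ lam)
    (hr : 0 < r) (hε : 0 ≤ ε) (hμ : -1 < μ) {u f : ℝ → ℂ} {fh : ℂ → ℂ}
    (hu : IntegrableOn u (Ioc 0 T))
    (heq : ∀ t ∈ Ioc 0 T, caputo α u t + lam * primitive u t = primitive f t)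
    (hf : LapAt r (causal f)) (hfh : ∀ s : ℂ, r < s.re → fh s = bilatLap (causal f) s)
    (hdec : DecaysOn ε (μ + 1) fh) {σ t : ℝ} (hσ : ε < σ) (ht : t ∈ Ioc 0 T) :
    2 * Real.pi * primitive (primitive u) t
      = invLap σ (fun s => (s ^ 2)⁻¹ * (fh s * exactKernel α lam s)) t := by
  set v : ℝ → ℂ := (Iic T).indicator u with hv
  have hvu : ∀ x ≤ T, v x = u x := fun x hx => indicator_of_mem (mem_Iic.2 hx) u
  have hprim : ∀ x ≤ T, primitive v x = primitive u x := fun x hx =>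
    primitive_congr_of_le (fun y hy => hvu y hy) hx
  have hprim2 : ∀ x ≤ T, primitive (primitive v) x = primitive (primitive u) x := fun x hx =>
    primitive_congr_of_le (fun y hy => hprim y hy) hx
  have hcap : ∀ x ∈ Ioc 0 T, caputo α v x = caputo α u x := fun x hx => by
    unfold caputo
    congr 1
    refine intervalIntegral.integral_congr_ae (Eventually.of_forall fun y hy => ?_)
    rw [uIoc_of_le hx.1.le] at hy
    rw [hvu y (hy.2.trans hx.2)]
  have hv0 : LapAt 0 (causal v) := lapAt_causal_indicator hu
  have hvr : LapAt r (causal v) := hv0.mono hr.le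
  -- the residual of the truncated solution
  set R : ℝ → ℂ := fun t => (((Real.Gamma (1 - α))⁻¹ : ℂ) * conv (powKer (1 - α)) (causal v) t
    + lam * primitive v t) + (-1) * primitive f t with hR
  have hK : LapAt r (conv (powKer (1 - α)) (causal v)) :=
    (lapAt_powKer (by linarith) hr).conv hvr
  have hRl : LapAt r R :=
    ((hK.const_mul _).add ((hvr.primitive hr).const_mul _)).add ((hf.primitive hr).const_mul _)
  have hR0 : ∀ t ≤ T, R t = 0 := by
    intro x hx
    rcases le_or_gt x 0 with h | h
    · exact hRl.zero x h
    · rw [hR]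
      simp only
      rw [conv_powKer_caputo h, hcap x ⟨h, hx⟩, hprim x hx, heq x ⟨h, hx⟩]
      ring
  have hΓ : (Real.Gamma (1 - α) : ℂ) ≠ 0 := by
    exact_mod_cast (Real.Gamma_pos_of_pos (by linarith)).ne'
  have hRhat : ∀ s : ℂ, r < s.re →
      s * bilatLap R s = (s ^ (α : ℂ) + lam) * bilatLap (causal v) s - fh s := by
    intro s hs
    have hs0 : s ≠ 0 := by
      rintro rfl
      exact absurd hs (by simpa using hr.le)
    rw [hR, bilatLap_add ((hK.const_mul _).add ((hvr.primitive hr).const_mul _))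
      ((hf.primitive hr).const_mul _) hs.le, bilatLap_add (hK.const_mul _)
      ((hvr.primitive hr).const_mul _) hs.le, bilatLap_const_mul, bilatLap_const_mul,
      bilatLap_const_mul, bilatLap_conv (lapAt_powKer (by linarith) hr) hvr hs.le,
      bilatLap_powKer (by linarith) (hr.trans hs), bilatLap_primitive hr hvr hs.le,
      bilatLap_primitive hr hf hs.le, ← hfh s hs]
    have e : s ^ (-((1 - α : ℝ) : ℂ)) = s ^ (α : ℂ) * s⁻¹ := by
      rw [← Complex.cpow_neg_one, ← Complex.cpow_add _ _ hs0]
      congr 1; push_cast; ring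
    rw [e]
    field_simp
    ring
  have hker : ∀ s : ℂ, r < s.re → s ^ (α : ℂ) + lam ≠ 0 := fun s hs => by
    have hpi := Real.pi_pos
    have hs0 : s ≠ 0 := by
      rintro rfl
      exact absurd hs (by simpa using hr.le)
    exact (exactKernel_bounds hα (by linarith) (by nlinarith : α * (Real.pi / 2) < Real.pi / 2)
      (by linarith) hl hs0 (abs_arg_le_pi_div_two (hr.trans hs).le)).1
  set Hf : ℂ → ℂ := fun s => (s ^ 2)⁻¹ * (fh s * exactKernel α lam s) with hHf
  set tail : ℂ → ℂ := fun s => s⁻¹ * bilatLap R s * exactKernel α lam s with htail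
  have hsplit : ∀ s : ℂ, r < s.re → (s ^ 2)⁻¹ * bilatLap (causal v) s = Hf s + tail s := by
    intro s hs
    have hs0 : s ≠ 0 := by
      rintro rfl
      exact absurd hs (by simpa using hr.le)
    have h1 := hRhat s hs
    have h2 := hker s hs
    rw [hHf, htail]
    simp only [exactKernel]
    have h3 : fh s = (s ^ (α : ℂ) + lam) * bilatLap (causal v) s - s * bilatLap R s := by
      rw [h1]; ring
    rw [h3]
    field_simp
    ring
  have hHdec : DecaysOn ε ((2 : ℕ) + ((μ + 1) + α)) Hf :=
    (decaysOn_pow_inv hε 2).mul hε (hdec.mul hε (decaysOn_exactKernel hα hα1 hl hε))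
  have hp : 1 < ((2 : ℕ) : ℝ) + ((μ + 1) + α) := by norm_num; linarith
  obtain ⟨D, hD0, hD⟩ := (decaysOn_exactKernel hα hα1 hl (le_refl 0)).bound
  set B : ℝ := ∫ t : ℝ, ‖(Real.exp (-(r * t)) : ℂ) * R t‖ with hB
  have htail_le : ∀ s : ℂ, r < s.re →
      ‖tail s‖ ≤ (Real.exp (T * r) * B * D) * Real.exp (-(T * s.re)) * ‖s‖ ^ (-(1 + α)) := by
    intro s hs
    have hsp : 0 < ‖s‖ := (hr.trans hs).trans_le (Complex.re_le_norm s)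
    rw [htail]
    simp only
    rw [norm_mul, norm_mul, norm_inv, neg_add, Real.rpow_add hsp, Real.rpow_neg_one]
    have h1 := hRl.norm_bilatLap_le_exp hR0 hs.le
    have h2 := hD s (hr.trans hs)
    have h3 : Real.exp (-(T * (s.re - r))) = Real.exp (T * r) * Real.exp (-(T * s.re)) := by
      rw [← Real.exp_add]; congr 1; ring
    rw [h3] at h1
    have hB0 : 0 ≤ B := integral_nonneg fun _ => norm_nonneg _
    calc _ ≤ ‖s‖⁻¹ * (Real.exp (T * r) * Real.exp (-(T * s.re)) * B) * (D * ‖s‖ ^ (-α)) := by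
          gcongr
      _ = _ := by ring
  have hlim : Tendsto (fun σ' => 2 * Real.pi * primitive (primitive v) t - invLap σ' tail t) atTop
      (𝓝 (2 * Real.pi * primitive (primitive v) t - 0)) :=
    tendsto_const_nhds.sub (tendsto_invLap_atTop (by linarith) htail_le ht.2)
  rw [sub_zero, hprim2 t ht.2] at hlim
  refine tendsto_nhds_unique hlim (tendsto_const_nhds.congr' ?_)
  filter_upwards [eventually_gt_atTop r, eventually_ge_atTop σ] with σ' h1 h2
  have hpos : 0 < σ' := hr.trans h1
  obtain ⟨i1, i2⟩ := invLap_primitive_primitive hpos (hvr.mono h1.le) t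
  have i3 := hHdec.integrable_line hε (hσ.trans_le h2) hp
  have i4 : Integrable fun y => tail (vline σ' y) := by
    refine (i1.sub i3).congr (Eventually.of_forall fun y => ?_)
    simp only [Pi.sub_apply]
    rw [hsplit _ (by simpa using h1)]
    ring
  rw [invLap_eq_of_decaysOn hHdec hε hp hσ h2 t, ← hprim2 t ht.2, ← i2]
  have e : invLap σ' (fun s => (s ^ 2)⁻¹ * bilatLap (causal v) s) t
      = invLap σ' (fun s => Hf s + tail s) t := by
    unfold invLap
    congr 1 with y
    exact congrArg _ (hsplit _ (by simpa using h1))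
  rw [e, invLap_add i3 i4]
  ring

/-- Functions analytic in discs around the points of the line `Re s = σ`, with radii proportional to
the distance to the origin, and of size `O(|s|^{-p})` in these discs. -/
def ConeDecay (σ c p : ℝ) (h : ℂ → ℂ) : Prop :=
  ∃ C : ℝ, 0 ≤ C ∧ ∀ y : ℝ,
    DifferentiableOn ℂ h (Metric.closedBall (vline σ y) (c * ‖vline σ y‖)) ∧
    ∀ w ∈ Metric.closedBall (vline σ y) (c * ‖vline σ y‖), ‖h w‖ ≤ C * ‖w‖ ^ (-p)

lemma ConeDecay.analyticAt {σ c p : ℝ} {h : ℂ → ℂ} (hh : ConeDecay σ c p h) (hσ : 0 < σ)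
    (hc : 0 < c) (y : ℝ) : AnalyticAt ℂ h (vline σ y) := by
  obtain ⟨C, -, hC⟩ := hh
  exact (hC y).1.analyticAt (Metric.closedBall_mem_nhds _ (mul_pos hc (norm_vline_pos hσ y)))

lemma ConeDecay.exists_norm_iteratedDeriv_le {σ c p : ℝ} {h : ℂ → ℂ} (hh : ConeDecay σ c p h)
    (hσ : 0 < σ) (hc : 0 < c) (hc2 : c ≤ 1 / 2) (k : ℕ) :
    ∃ B : ℝ, ∀ y, ‖iteratedDeriv k h (vline σ y)‖ ≤ B * ‖vline σ y‖ ^ (-(p + k)) := by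
  obtain ⟨C, hC0, hC⟩ := hh
  exact ⟨_, fun y => norm_iteratedDeriv_le_of_decay hc hc2 (norm_pos_iff.1 (norm_vline_pos hσ y))
    (hC y).1 hC0 (hC y).2 k⟩

lemma ConeDecay.continuous_iteratedDeriv {σ c p : ℝ} {h : ℂ → ℂ} (hh : ConeDecay σ c p h)
    (hσ : 0 < σ) (hc : 0 < c) (k : ℕ) : Continuous fun y => iteratedDeriv k h (vline σ y) := by
  refine continuous_iff_continuousAt.2 fun y => ?_
  exact ContinuousAt.comp (hasDerivAt_iteratedDeriv (hh.analyticAt hσ hc y) k).continuousAt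
    (continuous_vline σ).continuousAt

lemma ConeDecay.integrable_iteratedDeriv {σ c p : ℝ} {h : ℂ → ℂ} (hh : ConeDecay σ c p h)
    (hσ : 0 < σ) (hc : 0 < c) (hc2 : c ≤ 1 / 2) {k : ℕ} (hk : 1 < p + k) :
    Integrable fun y => iteratedDeriv k h (vline σ y) := by
  obtain ⟨B, hB⟩ := hh.exists_norm_iteratedDeriv_le hσ hc hc2 k
  exact ((integrable_norm_vline_rpow hσ hk).const_mul B).mono'
    (hh.continuous_iteratedDeriv hσ hc k).aestronglyMeasurable (Eventually.of_forall hB)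

lemma ConeDecay.integrable_mul_iteratedDeriv {σ c p : ℝ} {h : ℂ → ℂ} (hh : ConeDecay σ c p h)
    (hσ : 0 < σ) (hc : 0 < c) (hc2 : c ≤ 1 / 2) {k : ℕ} (hk : 1 < p + k - 1) :
    Integrable fun y => vline σ y * iteratedDeriv k h (vline σ y) := by
  obtain ⟨B, hB⟩ := hh.exists_norm_iteratedDeriv_le hσ hc hc2 k
  refine ((integrable_norm_vline_rpow hσ hk).const_mul B).mono'
    ((continuous_vline σ).mul (hh.continuous_iteratedDeriv hσ hc k)).aestronglyMeasurable
    (Eventually.of_forall fun y => ?_)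
  have hp := norm_vline_pos hσ y
  rw [norm_mul]
  calc _ ≤ ‖vline σ y‖ * (B * ‖vline σ y‖ ^ (-(p + k))) := by gcongr; exact hB y
    _ = B * ‖vline σ y‖ ^ (-(p + k - 1)) := by
      rw [show -(p + (k : ℝ) - 1) = 1 + -(p + k) by ring, Real.rpow_add hp, Real.rpow_one]; ring

lemma ConeDecay.inv_mul {σ c p : ℝ} {h : ℂ → ℂ} (hh : ConeDecay σ c p h) (hσ : 0 < σ)
    (hc2 : c ≤ 1 / 2) : ConeDecay σ c (p + 1) fun s => s⁻¹ * h s := by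
  obtain ⟨C, hC0, hC⟩ := hh
  refine ⟨C, hC0, fun y => ?_⟩
  have hne : ∀ w ∈ Metric.closedBall (vline σ y) (c * ‖vline σ y‖), w ≠ 0 := by
    rintro w hw rfl
    rw [mem_closedBall_iff_norm, zero_sub, norm_neg] at hw
    have := norm_vline_pos hσ y
    nlinarith
  refine ⟨DifferentiableOn.mul (fun w hw =>
    (differentiableAt_inv (hne w hw)).differentiableWithinAt) (hC y).1, fun w hw => ?_⟩
  have hp := norm_pos_iff.2 (hne w hw)
  rw [norm_mul, norm_inv, neg_add, Real.rpow_add hp, Real.rpow_neg_one]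
  calc _ ≤ ‖w‖⁻¹ * (C * ‖w‖ ^ (-p)) := by gcongr; exact (hC y).2 w hw
    _ = _ := by ring

lemma hasDerivAt_primitive {g : ℝ → ℂ} {σ x : ℝ} (hg : LapAt σ (causal g)) (hx : 0 < x)
    (hc : ContinuousAt g x) : HasDerivAt (primitive g) (g x) x := by
  have hcc : causal g =ᶠ[𝓝 x] g := by
    filter_upwards [lt_mem_nhds hx] with y hy using causal_of_pos hy
  have h1 := intervalIntegral.integral_hasDerivAt_right (hg.intervalIntegrable 0 x)
    (hg.aestronglyMeasurable.stronglyMeasurableAtFilter) (hc.congr hcc.symm)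
  rw [causal_of_pos hx] at h1
  refine h1.congr_of_eventuallyEq ?_
  filter_upwards [lt_mem_nhds hx] with y hy
  unfold primitive
  rw [max_eq_left hy.le]
  refine intervalIntegral.integral_congr_ae (Eventually.of_forall fun z hz => ?_)
  rw [uIoc_of_le hy.le] at hz
  rw [causal_of_pos hz.1]

/-- The exact solution as an absolutely convergent integral. The inversion integral of `Q` itself
need not converge; it is recovered from the one of `s^{-2} Q`, by differentiating twice and
integrating by parts in between. -/
theorem exact_eq_invLap {T σ c p : ℝ} {u : ℝ → ℂ} {Q : ℂ → ℂ} (hσ : 0 < σ) (hc : 0 < c)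
    (hc2 : c ≤ 1 / 2) (hp : 0 < p) (hu : IntegrableOn u (Ioc 0 T))
    (huc : ContinuousOn u (Ioc 0 T)) (hQ : ConeDecay σ c p Q)
    (hrep : ∀ t ∈ Ioc 0 T, 2 * Real.pi * primitive (primitive u) t
      = invLap σ (fun s => (s ^ 2)⁻¹ * Q s) t) {t : ℝ} (ht : t ∈ Ioc 0 T) :
    2 * Real.pi * ((t : ℂ) ^ 3 * u t) = -invLap σ (iteratedDeriv 3 Q) t := by
  set v : ℝ → ℂ := (Iic T).indicator u with hv
  have hvu : ∀ x ≤ T, v x = u x := fun x hx => indicator_of_mem (mem_Iic.2 hx) u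
  have hv0 : LapAt 0 (causal v) := lapAt_causal_indicator hu
  have hv1 : LapAt 1 (causal v) := hv0.mono zero_le_one
  have hvp : LapAt 1 (causal (primitive v)) := by
    rw [causal_primitive]; exact hv1.primitive one_pos
  set h₁ : ℂ → ℂ := fun s => s⁻¹ * Q s with hh₁
  set h₂ : ℂ → ℂ := fun s => s⁻¹ * h₁ s with hh₂
  have c1 : ConeDecay σ c (p + 1) h₁ := hQ.inv_mul hσ hc2
  have c2 : ConeDecay σ c (p + 1 + 1) h₂ := c1.inv_mul hσ hc2
  have hne : ∀ y, vline σ y ≠ 0 := fun y => norm_pos_iff.1 (norm_vline_pos hσ y)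
  have i1 : Integrable fun y => h₁ (vline σ y) := by
    simpa using c1.integrable_iteratedDeriv (k := 0) hσ hc hc2 (by norm_num; linarith)
  have i2 : Integrable fun y => h₂ (vline σ y) := by
    simpa using c2.integrable_iteratedDeriv (k := 0) hσ hc hc2 (by norm_num; linarith)
  have i1' : Integrable fun y => iteratedDeriv 1 h₁ (vline σ y) :=
    c1.integrable_iteratedDeriv hσ hc hc2 (by norm_num; linarith)
  have i1s : Integrable fun y => vline σ y * iteratedDeriv 1 h₁ (vline σ y) :=
    c1.integrable_mul_iteratedDeriv hσ hc hc2 (by norm_num; linarith)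
  have iQ : ∀ k : ℕ, 1 ≤ k → Integrable fun y => iteratedDeriv k Q (vline σ y) := fun k hk =>
    hQ.integrable_iteratedDeriv hσ hc hc2 (by
      have : (1 : ℝ) ≤ k := by exact_mod_cast hk
      linarith)
  -- first derivative
  have e1 : ∀ x ∈ Ioo 0 T, 2 * Real.pi * primitive v x = invLap σ h₁ x := by
    intro x hx
    have d1 : HasDerivAt (fun x => 2 * Real.pi * primitive (primitive v) x)
        (2 * Real.pi * primitive v x) x :=
      (hasDerivAt_primitive hvp hx.1 (continuous_primitive hv1).continuousAt).const_mul _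
    have d2 := hasDerivAt_invLap i2 (i1.congr (Eventually.of_forall fun y => by
      simp only [hh₂]; rw [mul_inv_cancel_left₀ (hne y)])) x
    have e : invLap σ (fun s => s * h₂ s) x = invLap σ h₁ x := by
      unfold invLap
      congr 1 with y
      simp only [hh₂]
      rw [mul_inv_cancel_left₀ (hne y)]
    rw [e] at d2
    refine d1.unique (d2.congr_of_eventuallyEq ?_)
    filter_upwards [Ioo_mem_nhds hx.1 hx.2] with z hz
    rw [primitive_congr_of_le (fun y hy => primitive_congr_of_le hvu hy) hz.2.le,
      hrep z ⟨hz.1, hz.2.le⟩]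
    congr 1
    funext s
    rw [hh₂, hh₁, sq, mul_inv, mul_assoc]
  have e2 : ∀ x ∈ Ioo 0 T, x * (2 * Real.pi * primitive v x)
      = -invLap σ (iteratedDeriv 1 h₁) x := by
    intro x hx
    rw [e1 x hx]
    refine mul_invLap (fun y => ?_) i1 i1'
    have := hasDerivAt_iteratedDeriv (c1.analyticAt hσ hc y) 0
    rwa [iteratedDeriv_zero] at this
  have hQ' : ∀ y, iteratedDeriv 1 Q (vline σ y)
      = h₁ (vline σ y) + vline σ y * iteratedDeriv 1 h₁ (vline σ y) := by
    intro y
    have a1 := hasDerivAt_iteratedDeriv (c1.analyticAt hσ hc y) 0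
    rw [iteratedDeriv_zero] at a1
    have a2 := (hasDerivAt_id (vline σ y)).mul a1
    have a3 := hasDerivAt_iteratedDeriv (hQ.analyticAt hσ hc y) 0
    rw [iteratedDeriv_zero] at a3
    have a4 : Q =ᶠ[𝓝 (vline σ y)] fun s => id s * h₁ s := by
      filter_upwards [isOpen_ne.mem_nhds (hne y)] with s hs
      simp only [hh₁, id]
      rw [mul_inv_cancel_left₀ hs]
    have := a3.unique (a2.congr_of_eventuallyEq a4)
    simpa using this
  have e3 : ∀ x ∈ Ioo 0 T, 2 * Real.pi * (x * u x) = -invLap σ (iteratedDeriv 1 Q) x := by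
    intro x hx
    have hcv : ContinuousAt v x := by
      refine (huc.continuousAt (Ioc_mem_nhds hx.1 hx.2)).congr ?_
      filter_upwards [gt_mem_nhds hx.2] with z hz using (hvu z hz.le).symm
    have d1 : HasDerivAt (fun x : ℝ => (x : ℂ) * (2 * Real.pi * primitive v x))
        (1 * (2 * Real.pi * primitive v x) + x * (2 * Real.pi * v x)) x :=
      (Complex.ofRealCLM.hasDerivAt (x := x)).mul
        ((hasDerivAt_primitive hv1 hx.1 hcv).const_mul _)
    have d2 := (hasDerivAt_invLap i1' i1s x).neg
    have d3 := d1.unique (d2.congr_of_eventuallyEq (by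
      filter_upwards [Ioo_mem_nhds hx.1 hx.2] with z hz using e2 z hz))
    rw [hvu x hx.2.le, one_mul, e1 x hx] at d3
    have e : invLap σ (iteratedDeriv 1 Q) x
        = invLap σ h₁ x + invLap σ (fun s => s * iteratedDeriv 1 h₁ s) x := by
      rw [← invLap_add i1 i1s]
      unfold invLap
      congr 1 with y
      rw [hQ' y]
    rw [e]
    linear_combination d3
  have e4 : ∀ x ∈ Ioo 0 T, 2 * Real.pi * ((x : ℂ) ^ 3 * u x)
      = -invLap σ (iteratedDeriv 3 Q) x := by
    intro x hx
    have a1 := mul_invLap (t := x) (fun y => hasDerivAt_iteratedDeriv (hQ.analyticAt hσ hc y) 1)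
      (iQ 1 (by norm_num)) (iQ 2 (by norm_num))
    have a2 := mul_invLap (t := x) (fun y => hasDerivAt_iteratedDeriv (hQ.analyticAt hσ hc y) 2)
      (iQ 2 (by norm_num)) (iQ 3 (by norm_num))
    have a3 := e3 x hx
    linear_combination (x : ℂ) ^ 2 * a3 - x * a1 + a2
  -- the end point `t = T` by continuity
  rcases lt_or_eq_of_le ht.2 with h | h
  · exact e4 t ⟨ht.1, h⟩
  · subst h
    have hu1 : Tendsto (fun x : ℝ => 2 * Real.pi * ((x : ℂ) ^ 3 * u x)) (𝓝[Ioo 0 t] t)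
        (𝓝 (2 * Real.pi * ((t : ℂ) ^ 3 * u t))) := by
      have h1 : Tendsto u (𝓝[Ioo 0 t] t) (𝓝 (u t)) :=
        (huc t ht).mono_left (nhdsWithin_mono _ Ioo_subset_Ioc_self)
      have h2 : Tendsto (fun x : ℝ => (x : ℂ) ^ 3) (𝓝[Ioo 0 t] t) (𝓝 ((t : ℂ) ^ 3)) :=
        (Continuous.tendsto (by fun_prop) t).mono_left nhdsWithin_le_nhds
      exact (h2.mul h1).const_mul _
    have hu2 : Tendsto (fun x : ℝ => -invLap σ (iteratedDeriv 3 Q) x) (𝓝[Ioo 0 t] t)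
        (𝓝 (-invLap σ (iteratedDeriv 3 Q) t)) := by
      have := (hasDerivAt_invLap (iQ 3 (by norm_num))
        (hQ.integrable_mul_iteratedDeriv hσ hc hc2 (k := 3) (by norm_num; linarith)) t).continuousAt
      exact (this.tendsto.mono_left nhdsWithin_le_nhds).neg
    have hne' : (𝓝[Ioo 0 t] t).NeBot := by
      rw [← mem_closure_iff_nhdsWithin_neBot, closure_Ioo ht.1.ne]
      exact ⟨ht.1.le, le_rfl⟩
    refine tendsto_nhds_unique hu1 (hu2.congr' ?_)
    filter_upwards [self_mem_nhdsWithin] with x hx using (e4 x hx).symm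

/-! ### The scheme in one eigenspace -/

lemma glCoeff_eq_choose (α : ℝ) (j : ℕ) : (glCoeff α j : ℂ) = (-1) ^ j * Ring.choose (α : ℂ) j := by
  induction j with
  | zero => simp [glCoeff]
  | succ j ih =>
    have h1 : Ring.choose (α : ℂ) (j + 1) = Ring.choose (α : ℂ) j * (α - j) / (j + 1) := by
      rw [Ring.choose_eq_smul, Ring.choose_eq_smul, descPochhammer_succ_right,
        Polynomial.smeval_mul, Nat.factorial_succ]
      have : ((j : ℂ) + 1) ≠ 0 := by exact_mod_cast Nat.succ_ne_zero j
      have h2 : ((j.factorial : ℕ) : ℂ) ≠ 0 := by exact_mod_cast j.factorial_ne_zero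
      simp only [smul_eq_mul, Polynomial.smeval_sub, Polynomial.smeval_X, Polynomial.smeval_natCast,
        pow_one, pow_zero, nsmul_eq_mul, mul_one]
      push_cast
      field_simp
    have : ((j : ℂ) + 1) ≠ 0 := by exact_mod_cast Nat.succ_ne_zero j
    rw [glCoeff, h1]
    push_cast
    rw [ih]
    field_simp
    ring

/-- The generating function of the Grünwald–Letnikov coefficients. -/
lemma hasSum_glCoeff (α : ℝ) {ζ : ℂ} (hζ : ‖ζ‖ < 1) :
    HasSum (fun j => (glCoeff α j : ℂ) * ζ ^ j) ((1 - ζ) ^ (α : ℂ)) := by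
  have h := (Complex.one_add_cpow_hasFPowerSeriesOnBall_zero (a := (α : ℂ))).hasSum (y := -ζ)
    (by
      rw [← ENNReal.ofReal_one, Metric.eball_ofReal]
      simpa using hζ)
  rw [zero_add, ← sub_eq_add_neg] at h
  refine h.congr_fun fun j => ?_
  rw [binomialSeries_apply, glCoeff_eq_choose, smul_eq_mul, List.ofFn_const, List.prod_replicate,
    neg_pow]
  ring

lemma norm_exp_neg_lt_one {z : ℂ} (hz : 0 < z.re) : ‖Complex.exp (-z)‖ < 1 := by
  rw [Complex.norm_exp, Real.exp_lt_one_iff]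
  simpa using hz

lemma re_one_sub_exp_pos {z : ℂ} (hz : 0 < z.re) : 0 < (1 - Complex.exp (-z)).re := by
  have h1 := (Complex.re_le_norm (Complex.exp (-z))).trans_lt (norm_exp_neg_lt_one hz)
  simp only [Complex.sub_re, Complex.one_re]
  linarith

lemma norm_bdfSymbol_le_four {z : ℂ} (hz : 0 < z.re) : ‖bdfSymbol z‖ ≤ 4 := by
  have h1 := norm_exp_neg_lt_one hz
  have h2 := norm_exp_neg_lt_one (z := 2 * z) (by simpa using hz)
  unfold bdfSymbol
  refine (norm_add_le _ _).trans ((add_le_add_left (norm_sub_le _ _) _).trans ?_)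
  rw [norm_mul, norm_mul, show ‖(3 / 2 : ℂ)‖ = 3 / 2 by norm_num, show ‖(2 : ℂ)‖ = 2 by norm_num,
    show ‖(1 / 2 : ℂ)‖ = 1 / 2 by norm_num]
  linarith

lemma avgSymbol_eq (α : ℝ) (z : ℂ) :
    avgSymbol α z = ((1 - α / 2 : ℝ) : ℂ) + ((α / 2 : ℝ) : ℂ) * Complex.exp (-z) := by
  unfold avgSymbol; push_cast; ring

lemma avgSymbol_bounds {α : ℝ} (hα : 0 < α) (hα1 : α < 1) {z : ℂ} (hz : 0 < z.re) :
    1 - α ≤ (avgSymbol α z).re ∧ ‖avgSymbol α z‖ ≤ 1 := by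
  have h1 := norm_exp_neg_lt_one hz
  have h2 := (abs_le.1 (Complex.abs_re_le_norm (Complex.exp (-z)))).1
  rw [avgSymbol_eq]
  constructor
  · rw [Complex.add_re, Complex.re_ofReal_mul, Complex.ofReal_re]
    nlinarith
  · refine (norm_add_le _ _).trans ?_
    rw [norm_mul, Complex.norm_real, Complex.norm_real, Real.norm_of_nonneg (by linarith),
      Real.norm_of_nonneg (by linarith)]
    nlinarith

lemma re_glSymbol_nonneg {α : ℝ} (hα : 0 < α) (hα1 : α < 1) {z : ℂ} (hz : 0 < z.re) :
    0 ≤ (glSymbol α z).re := by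
  have hpi := Real.pi_pos
  refine le_trans ?_ (cos_mul_norm_rpow_le_re_cpow hα (by nlinarith)
    (abs_arg_le_pi_div_two (re_one_sub_exp_pos hz).le))
  have : 0 ≤ Real.cos (α * (Real.pi / 2)) :=
    Real.cos_nonneg_of_mem_Icc ⟨by nlinarith, by nlinarith⟩
  positivity

/-- The symbol `avg / (gl + Λ avg)` of the solution operator of the scheme, before differencing. -/
noncomputable def schemeKernel (α Λ : ℝ) (z : ℂ) : ℂ :=
  avgSymbol α z / (glSymbol α z + Λ * avgSymbol α z)

lemma schemeKernel_bounds {α Λ : ℝ} (hα : 0 < α) (hα1 : α < 1) (hΛ : 0 < Λ) {z : ℂ}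
    (hz : 0 < z.re) : glSymbol α z + Λ * avgSymbol α z ≠ 0 ∧
      DifferentiableAt ℂ (glSymbol α) z ∧ DifferentiableAt ℂ (schemeKernel α Λ) z ∧
      ‖schemeKernel α Λ z‖ ≤ (Λ * (1 - α))⁻¹ := by
  have hα' : 0 < 1 - α := by linarith
  obtain ⟨h1, h2⟩ := avgSymbol_bounds hα hα1 hz
  have h3 := re_glSymbol_nonneg hα hα1 hz
  have h4 : Λ * (1 - α) ≤ ‖glSymbol α z + Λ * avgSymbol α z‖ := by
    refine le_trans ?_ (Complex.re_le_norm _)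
    simp only [Complex.add_re, Complex.re_ofReal_mul]
    nlinarith
  have h5 : 0 < Λ * (1 - α) := by positivity
  have h6 : glSymbol α z + Λ * avgSymbol α z ≠ 0 := norm_pos_iff.1 (h5.trans_le h4)
  have h7 : DifferentiableAt ℂ (glSymbol α) z := by
    unfold glSymbol
    exact DifferentiableAt.cpow_const (by fun_prop) (Or.inl (re_one_sub_exp_pos hz))
  have h8 : DifferentiableAt ℂ (avgSymbol α) z := by unfold avgSymbol; fun_prop
  refine ⟨h6, h7, h8.div (h7.add (h8.const_mul _)) h6, ?_⟩
  unfold schemeKernel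
  rw [norm_div, ← one_div]
  gcongr

lemma decaysOn_schemeKernel {α Λ τ a : ℝ} (hα : 0 < α) (hα1 : α < 1) (hΛ : 0 < Λ) (hτ : 0 < τ)
    (ha : 0 ≤ a) : DecaysOn a 0 fun s => schemeKernel α Λ (s * τ) := by
  have hre : ∀ s : ℂ, a < s.re → 0 < (s * τ).re := fun s hs => by
    rw [Complex.re_mul_ofReal]
    exact mul_pos (ha.trans_lt hs) hτ
  refine decaysOn_of_bounded (fun s hs => ?_)
    fun s hs => (schemeKernel_bounds hα hα1 hΛ (hre s hs)).2.2.2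
  exact DifferentiableAt.differentiableWithinAt (DifferentiableAt.comp s
    (f := fun s : ℂ => s * τ)
    (schemeKernel_bounds hα hα1 hΛ (hre s hs)).2.2.1 (by fun_prop))

lemma decaysOn_bdfSymbol {τ a : ℝ} (hτ : 0 < τ) (ha : 0 ≤ a) :
    DecaysOn a 0 fun s => bdfSymbol (s * τ) := by
  refine decaysOn_of_bounded (C := 4) (by unfold bdfSymbol; fun_prop) fun s hs =>
    norm_bdfSymbol_le_four ?_
  rw [Complex.re_mul_ofReal]
  exact mul_pos (ha.trans_lt hs) hτ

lemma decaysOn_avgSymbol {α τ a : ℝ} (hα : 0 < α) (hα1 : α < 1) (hτ : 0 < τ) (ha : 0 ≤ a) :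
    DecaysOn a 0 fun s => avgSymbol α (s * τ) := by
  refine decaysOn_of_bounded (C := 1) (by unfold avgSymbol; fun_prop) fun s hs =>
    (avgSymbol_bounds hα hα1 ?_).2
  rw [Complex.re_mul_ofReal]
  exact mul_pos (ha.trans_lt hs) hτ

lemma decaysOn_glSymbol {α τ a : ℝ} (hα : 0 < α) (hα1 : α < 1) (hτ : 0 < τ) (ha : 0 ≤ a) :
    DecaysOn a 0 fun s => glSymbol α (s * τ) := by
  have hre : ∀ s : ℂ, a < s.re → 0 < (s * τ).re := fun s hs => by
    rw [Complex.re_mul_ofReal]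
    exact mul_pos (ha.trans_lt hs) hτ
  refine decaysOn_of_bounded (C := 2 ^ α) (fun s hs => ?_) fun s hs => ?_
  · exact DifferentiableAt.differentiableWithinAt (DifferentiableAt.comp s
      (f := fun s : ℂ => s * τ) (schemeKernel_bounds hα hα1 one_pos (hre s hs)).2.1 (by fun_prop))
  · have h1 := re_one_sub_exp_pos (hre s hs)
    have h2 : 1 - Complex.exp (-(s * τ)) ≠ 0 := by
      intro h
      rw [h] at h1
      simp at h1
    unfold glSymbol
    rw [Complex.norm_cpow_real]
    have h3 : ‖1 - Complex.exp (-(s * τ))‖ ≤ 2 := by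
      refine (norm_sub_le _ _).trans ?_
      have := norm_exp_neg_lt_one (hre s hs)
      rw [norm_one]
      linarith
    gcongr

lemma invLap_bdf {σ τ t : ℝ} {h : ℂ → ℂ} (hh : Integrable fun y => h (vline σ y)) :
    invLap σ (fun s => (τ : ℂ)⁻¹ * (bdfSymbol (s * τ) * h s)) t = bdf2 τ (invLap σ h) t := by
  have e : invLap σ (fun s => bdfSymbol (s * τ) * h s) t
      = 3 / 2 * invLap σ h t - 2 * invLap σ h (t - τ) + 1 / 2 * invLap σ h (t - 2 * τ) := by
    rw [← invLap_exp_shift σ t τ, ← invLap_exp_shift σ t (2 * τ)]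
    unfold invLap
    have i0 := integrable_exp_mul_line (t := t) hh
    have i1 : Integrable fun y => Complex.exp (vline σ y * t) *
        (Complex.exp (-(vline σ y * τ)) * h (vline σ y)) := by
      refine (integrable_exp_mul_line (t := t - τ) hh).congr (Eventually.of_forall fun y => ?_)
      simp only
      rw [← mul_assoc, ← Complex.exp_add]
      congr 2; push_cast; ring
    have i2 : Integrable fun y => Complex.exp (vline σ y * t) *
        (Complex.exp (-(vline σ y * (2 * τ : ℝ))) * h (vline σ y)) := by
      refine (integrable_exp_mul_line (t := t - 2 * τ) hh).congr (Eventually.of_forall fun y => ?_)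
      simp only
      rw [← mul_assoc, ← Complex.exp_add]
      congr 2; push_cast; ring
    have i3 : Integrable fun y => 3 / 2 * (Complex.exp (vline σ y * t) * h (vline σ y))
        - 2 * (Complex.exp (vline σ y * t) * (Complex.exp (-(vline σ y * τ)) * h (vline σ y))) :=
      (i0.const_mul _).sub (i1.const_mul _)
    simp only
    rw [← integral_const_mul, ← integral_const_mul, ← integral_const_mul,
      ← integral_sub (i0.const_mul _) (i1.const_mul _), ← integral_add i3 (i2.const_mul _)]
    congr 1 with y
    unfold bdfSymbol
    rw [show 2 * (vline σ y * τ) = vline σ y * ((2 * τ : ℝ) : ℂ) by push_cast; ring]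
    ring
  rw [invLap_const_mul, e]
  unfold bdf2
  simp only [Complex.real_smul]
  push_cast
  ring

lemma invLap_avg {σ τ t α : ℝ} {h : ℂ → ℂ} (hh : Integrable fun y => h (vline σ y)) :
    invLap σ (fun s => avgSymbol α (s * τ) * h s) t
      = ((1 - α / 2 : ℝ) : ℂ) * invLap σ h t + ((α / 2 : ℝ) : ℂ) * invLap σ h (t - τ) := by
  rw [← invLap_exp_shift σ t τ]
  unfold invLap
  have i0 := integrable_exp_mul_line (t := t) hh
  have i1 : Integrable fun y => Complex.exp (vline σ y * t) *
      (Complex.exp (-(vline σ y * τ)) * h (vline σ y)) := by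
    refine (integrable_exp_mul_line (t := t - τ) hh).congr (Eventually.of_forall fun y => ?_)
    simp only
    rw [← mul_assoc, ← Complex.exp_add]
    congr 2; push_cast; ring
  rw [← integral_const_mul, ← integral_const_mul,
    ← integral_add (i0.const_mul _) (i1.const_mul _)]
  congr 1 with y
  simp only [avgSymbol_eq]
  ring

/-- The Grünwald–Letnikov sum, extended over all past times, acts on inverse Laplace transforms as
multiplication by its symbol. -/
lemma hasSum_glCoeff_mul_invLap {σ τ α t : ℝ} {h : ℂ → ℂ} (hσ : 0 < σ) (hτ : 0 < τ)
    (hh : Integrable fun y => h (vline σ y)) :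
    HasSum (fun j : ℕ => (glCoeff α j : ℂ) * invLap σ h (t - j * τ))
      (invLap σ (fun s => glSymbol α (s * τ) * h s) t) := by
  set F : ℕ → ℝ → ℂ := fun j y => (glCoeff α j : ℂ) *
    (Complex.exp (vline σ y * ((t - j * τ : ℝ) : ℂ)) * h (vline σ y)) with hF
  have hFi : ∀ j, Integrable (F j) := fun j => (integrable_exp_mul_line hh).const_mul _
  have hnorm : ∀ j y, ‖F j y‖ = (|glCoeff α j| * Real.exp (-(σ * τ)) ^ j) *
      (Real.exp (σ * t) * ‖h (vline σ y)‖) := by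
    intro j y
    simp only [hF, norm_mul, norm_exp_vline_mul, Complex.norm_real, Real.norm_eq_abs]
    rw [← Real.exp_nat_mul, mul_assoc, ← mul_assoc (Real.exp _) (Real.exp _), ← Real.exp_add]
    congr 3; ring
  have hlt : ‖((Real.exp (-(σ * τ)) : ℝ) : ℂ)‖ < 1 := by
    rw [Complex.norm_real, Real.norm_of_nonneg (Real.exp_pos _).le, Real.exp_lt_one_iff]
    have := mul_pos hσ hτ
    linarith
  have hsum : Summable fun j => |glCoeff α j| * Real.exp (-(σ * τ)) ^ j := by
    have := (hasSum_glCoeff α hlt).summable.norm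
    refine this.congr fun j => ?_
    rw [norm_mul, norm_pow, Complex.norm_real, Complex.norm_real, Real.norm_eq_abs,
      Real.norm_of_nonneg (Real.exp_pos _).le]
  have key := hasSum_integral_of_summable_integral_norm hFi (by
    simp_rw [hnorm, integral_const_mul]
    exact hsum.mul_right _)
  have e1 : ∀ j, ∫ y, F j y = (glCoeff α j : ℂ) * invLap σ h (t - j * τ) := fun j => by
    simp only [hF]
    rw [integral_const_mul]
    rfl
  simp_rw [e1] at key
  suffices h : invLap σ (fun s => glSymbol α (s * τ) * h s) t = ∫ y, ∑' j, F j y by rwa [h]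
  refine integral_congr_ae (Eventually.of_forall fun y => ?_)
  have hre : 0 < (vline σ y * τ).re := by
    rw [Complex.re_mul_ofReal, vline_re]; exact mul_pos hσ hτ
  have h1 := hasSum_glCoeff α (norm_exp_neg_lt_one hre)
  have h2 := h1.mul_left (Complex.exp (vline σ y * t) * h (vline σ y))
  have h3 : HasSum (fun j => F j y) (Complex.exp (vline σ y * t) * h (vline σ y) *
      (1 - Complex.exp (-(vline σ y * τ))) ^ (α : ℂ)) := by
    refine h2.congr_fun fun j => ?_
    simp only [hF]
    have : Complex.exp (vline σ y * ((t - j * τ : ℝ) : ℂ))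
        = Complex.exp (vline σ y * t) * Complex.exp (-(vline σ y * τ)) ^ j := by
      rw [← Complex.exp_nat_mul, ← Complex.exp_add]
      congr 1; push_cast; ring
    rw [this]; ring
  beta_reduce
  rw [h3.tsum_eq]
  unfold glSymbol
  ring

/-- The transform of the iterated primitive of the source, on every line to the right of `ε`. -/
lemma invLap_source {r ε μ : ℝ} (hr : 0 < r) (hε : 0 ≤ ε) (hμ : -1 < μ) {f : ℝ → ℂ} {fh : ℂ → ℂ}
    (hf : LapAt r (causal f)) (hfh : ∀ s : ℂ, r < s.re → fh s = bilatLap (causal f) s)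
    (hdec : DecaysOn ε (μ + 1) fh) {σ : ℝ} (hσ : ε < σ) (t : ℝ) :
    invLap σ (fun s => (s ^ 2)⁻¹ * fh s) t = 2 * Real.pi * primitive (primitive f) t := by
  have hd : DecaysOn ε ((2 : ℕ) + (μ + 1)) fun s => (s ^ 2)⁻¹ * fh s :=
    (decaysOn_pow_inv hε 2).mul hε hdec
  set σ' : ℝ := max σ (r + 1) with hσ'
  have h1 : r < σ' := by
    have := le_max_right σ (r + 1)
    linarith
  rw [invLap_eq_of_decaysOn hd hε (by norm_num; linarith) hσ (le_max_left σ (r + 1)) t,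
    ← (invLap_primitive_primitive (hr.trans h1) (hf.mono h1.le) t).2]
  unfold invLap
  congr 1 with y
  simp only
  rw [hfh _ (by simp)]

lemma bdf2_const_mul (τ : ℝ) (c : ℂ) (v : ℝ → ℂ) (t : ℝ) :
    bdf2 τ (fun x => c * v x) t = c * bdf2 τ v t := by
  unfold bdf2
  simp only [Complex.real_smul]
  ring

/-- The output of the scheme as an inverse Laplace transform. -/
theorem scheme_eq_invLap {α lam τ r ε μ : ℝ} (hα : 0 < α) (hα1 : α < 1) (hl : 0 < lam)
    (hτ : 0 < τ) (hr : 0 < r) (hε : 0 ≤ ε) (hμ : -1 < μ) {f : ℝ → ℂ} {fh : ℂ → ℂ}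
    (hf : LapAt r (causal f)) (hfh : ∀ s : ℂ, r < s.re → fh s = bilatLap (causal f) s)
    (hdec : DecaysOn ε (μ + 1) fh) {N : ℕ} {U : ℤ → ℂ} (hU0 : ∀ k ≤ 0, U k = 0)
    (hU : ∀ n : ℕ, 1 ≤ n → n ≤ N →
      ((τ ^ (-α) : ℝ) : ℂ) * ∑ j ∈ Finset.range (n + 1), (glCoeff α j : ℂ) * U ((n : ℤ) - j)
        + lam * (((1 - α / 2 : ℝ) : ℂ) * U n + ((α / 2 : ℝ) : ℂ) * U ((n : ℤ) - 1))
      = ((1 - α / 2 : ℝ) : ℂ) * bdf2 τ (primitive (primitive f)) (n * τ)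
        + ((α / 2 : ℝ) : ℂ) * bdf2 τ (primitive (primitive f)) (((n : ℝ) - 1) * τ))
    {σ : ℝ} (hσ : ε < σ) {n : ℕ} (hn : n ≤ N) :
    2 * Real.pi * ((τ : ℂ)⁻¹ * (3 / 2 * U n - 2 * U ((n : ℤ) - 1) + 1 / 2 * U ((n : ℤ) - 2)))
      = invLap σ (fun s => fh s * ((s ^ 2)⁻¹ *
          (((τ ^ (α - 2) : ℝ) : ℂ) * discKernel α (lam * τ ^ α) (s * τ)))) (n * τ) := by
  have hσ0 : 0 < σ := hε.trans_lt hσ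
  set Λ : ℝ := lam * τ ^ α with hΛ
  have hΛ0 : 0 < Λ := by positivity
  set h₀ : ℂ → ℂ := fun s => (s ^ 2)⁻¹ * fh s with hh₀
  have d0 : DecaysOn ε ((2 : ℕ) + (μ + 1)) h₀ := (decaysOn_pow_inv hε 2).mul hε hdec
  set h₁ : ℂ → ℂ := fun s => (τ : ℂ)⁻¹ * (bdfSymbol (s * τ) * h₀ s) with hh₁
  have d1 : DecaysOn ε (0 + ((2 : ℕ) + (μ + 1))) h₁ :=
    ((decaysOn_bdfSymbol hτ hε).mul hε d0).const_mul _
  set G : ℂ → ℂ := fun s => ((τ ^ α : ℝ) : ℂ) * (schemeKernel α Λ (s * τ) * h₁ s) with hG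
  have dG : DecaysOn ε (0 + (0 + ((2 : ℕ) + (μ + 1)))) G :=
    ((decaysOn_schemeKernel hα hα1 hΛ0 hτ hε).mul hε d1).const_mul _
  have hp0 : 1 < ((2 : ℕ) : ℝ) + (μ + 1) := by norm_num; linarith
  have hpG : 1 < 0 + (0 + (((2 : ℕ) : ℝ) + (μ + 1))) := by linarith
  have i0 := d0.integrable_line hε hσ hp0
  have i1 := d1.integrable_line hε hσ (by linarith)
  have iG := dG.integrable_line hε hσ hpG
  set V : ℤ → ℂ := fun k => invLap σ G (k * τ) with hV
  have hV0 : ∀ k ≤ 0, V k = 0 := fun k hk => by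
    refine invLap_eq_zero dG hε hpG hσ ?_
    have : (k : ℝ) ≤ 0 := by exact_mod_cast hk
    nlinarith
  have hsrc : ∀ t, bdf2 τ (invLap σ h₀) t = 2 * Real.pi * bdf2 τ (primitive (primitive f)) t := by
    intro t
    rw [← bdf2_const_mul]
    congr 1
    funext x
    exact invLap_source hr hε hμ hf hfh hdec hσ x
  -- the transform `V` satisfies the equation of the scheme
  have hVeq : ∀ n : ℕ,
      ((τ ^ (-α) : ℝ) : ℂ) * ∑ j ∈ Finset.range (n + 1), (glCoeff α j : ℂ) * V ((n : ℤ) - j)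
        + lam * (((1 - α / 2 : ℝ) : ℂ) * V n + ((α / 2 : ℝ) : ℂ) * V ((n : ℤ) - 1))
      = 2 * Real.pi * (((1 - α / 2 : ℝ) : ℂ) * bdf2 τ (primitive (primitive f)) (n * τ)
        + ((α / 2 : ℝ) : ℂ) * bdf2 τ (primitive (primitive f)) (((n : ℝ) - 1) * τ)) := by
    intro n
    have s1 : ∑ j ∈ Finset.range (n + 1), (glCoeff α j : ℂ) * V ((n : ℤ) - j)
        = invLap σ (fun s => glSymbol α (s * τ) * G s) (n * τ) := by
      have hs := hasSum_glCoeff_mul_invLap (α := α) (t := n * τ) hσ0 hτ iG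
      refine HasSum.unique ?_ hs
      have e : ∀ j : ℕ, invLap σ G (n * τ - j * τ) = V ((n : ℤ) - j) := fun j => by
        simp only [hV]
        congr 1; push_cast; ring
      simp_rw [e]
      refine hasSum_sum_of_ne_finset_zero fun j hj => ?_
      rw [Finset.mem_range, not_lt] at hj
      rw [hV0 _ (by omega), mul_zero]
    have s2 : ((1 - α / 2 : ℝ) : ℂ) * V n + ((α / 2 : ℝ) : ℂ) * V ((n : ℤ) - 1)
        = invLap σ (fun s => avgSymbol α (s * τ) * G s) (n * τ) := by
      rw [invLap_avg iG]
      simp only [hV]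
      congr 3
      push_cast; ring
    have s3 : 2 * Real.pi * (((1 - α / 2 : ℝ) : ℂ) * bdf2 τ (primitive (primitive f)) (n * τ)
        + ((α / 2 : ℝ) : ℂ) * bdf2 τ (primitive (primitive f)) (((n : ℝ) - 1) * τ))
        = invLap σ (fun s => avgSymbol α (s * τ) * h₁ s) (n * τ) := by
      rw [invLap_avg i1, invLap_bdf i0, invLap_bdf i0, hsrc, hsrc,
        show (n : ℝ) * τ - τ = ((n : ℝ) - 1) * τ by ring]
      ring
    rw [s1, s2, s3, ← invLap_const_mul, ← invLap_const_mul]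
    have j1 : Integrable fun y => glSymbol α (vline σ y * τ) * G (vline σ y) :=
      ((decaysOn_glSymbol hα hα1 hτ hε).mul hε dG).integrable_line hε hσ (by linarith)
    have j2 : Integrable fun y => avgSymbol α (vline σ y * τ) * G (vline σ y) :=
      ((decaysOn_avgSymbol hα hα1 hτ hε).mul hε dG).integrable_line hε hσ (by linarith)
    rw [← invLap_add (j1.const_mul _) (j2.const_mul _)]
    unfold invLap
    congr 1 with y
    have hre : 0 < (vline σ y * τ).re := by
      rw [Complex.re_mul_ofReal, vline_re]; exact mul_pos hσ0 hτ
    have hne := (schemeKernel_bounds hα hα1 hΛ0 hre).1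
    have hτα : ((τ ^ (-α) : ℝ) : ℂ) = ((τ ^ α : ℝ) : ℂ)⁻¹ := by
      rw [Real.rpow_neg hτ.le]; push_cast; rfl
    have hτ0 : ((τ ^ α : ℝ) : ℂ) ≠ 0 := by
      exact_mod_cast (Real.rpow_pos_of_pos hτ α).ne'
    simp only [hG, schemeKernel]
    rw [hτα]
    have hΛ' : (Λ : ℂ) = lam * ((τ ^ α : ℝ) : ℂ) := by rw [hΛ]; push_cast; rfl
    rw [hΛ'] at hne ⊢
    rw [div_eq_mul_inv]
    set E := Complex.exp (vline σ y * ((n * τ : ℝ) : ℂ))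
    linear_combination E * (glSymbol α (vline σ y * τ) * avgSymbol α (vline σ y * τ)
      * (glSymbol α (vline σ y * τ) + lam * ((τ ^ α : ℝ) : ℂ) * avgSymbol α (vline σ y * τ))⁻¹
      * h₁ (vline σ y)) * inv_mul_cancel₀ hτ0
      + E * avgSymbol α (vline σ y * τ) * h₁ (vline σ y) * mul_inv_cancel₀ hne
  -- uniqueness of the solution of the scheme
  have hUV : ∀ n : ℕ, n ≤ N → ∀ k : ℤ, k ≤ n → 2 * Real.pi * U k = V k := by
    intro n
    induction n with
    | zero =>
      intro _ k hk
      rw [hU0 k (by simpa using hk), hV0 k (by simpa using hk), mul_zero]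
    | succ n ih =>
      intro hn k hk
      have ih' := ih (by omega)
      rcases lt_or_eq_of_le hk with h | h
      · exact ih' k (by push_cast at h; omega)
      · subst h
        have e1 := hU (n + 1) (by omega) hn
        have e2 := hVeq (n + 1)
        rw [← e1] at e2
        rw [Finset.sum_range_succ' (fun j => (glCoeff α j : ℂ) * V (((n + 1 : ℕ) : ℤ) - j)),
          Finset.sum_range_succ' (fun j => (glCoeff α j : ℂ) * U (((n + 1 : ℕ) : ℤ) - j))] at e2
        have e3 : ∑ j ∈ Finset.range (n + 1), (glCoeff α (j + 1) : ℂ) *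
              V (((n + 1 : ℕ) : ℤ) - ((j + 1 : ℕ) : ℤ))
            = 2 * Real.pi * ∑ j ∈ Finset.range (n + 1), (glCoeff α (j + 1) : ℂ) *
              U (((n + 1 : ℕ) : ℤ) - ((j + 1 : ℕ) : ℤ)) := by
          rw [Finset.mul_sum]
          refine Finset.sum_congr rfl fun j _ => ?_
          rw [← ih' _ (by push_cast; omega)]
          ring
        rw [e3, ← ih' (((n + 1 : ℕ) : ℤ) - 1) (by push_cast; omega)] at e2
        simp only [Nat.cast_zero, sub_zero, glCoeff, Complex.ofReal_one, one_mul] at e2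
        have hcoef : ((τ ^ (-α) + lam * (1 - α / 2) : ℝ) : ℂ) ≠ 0 := by
          have : 0 < τ ^ (-α) + lam * (1 - α / 2) := by
            have h1 : 0 < 1 - α / 2 := by linarith
            positivity
          exact_mod_cast this.ne'
        refine mul_left_cancel₀ hcoef ?_
        push_cast at e2 ⊢
        linear_combination -e2
  have h1 := hUV n hn n le_rfl
  have h2 := hUV n hn (n - 1) (by omega)
  have h3 := hUV n hn (n - 2) (by omega)
  have e : 2 * Real.pi * ((τ : ℂ)⁻¹ *
      (3 / 2 * U n - 2 * U ((n : ℤ) - 1) + 1 / 2 * U ((n : ℤ) - 2)))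
      = bdf2 τ (invLap σ G) (n * τ) := by
    unfold bdf2
    simp only [Complex.real_smul]
    have k1 : invLap σ G (n * τ) = V n := by simp [hV]
    have k2 : invLap σ G (n * τ - τ) = V ((n : ℤ) - 1) := by
      simp only [hV]; congr 1; push_cast; ring
    have k3 : invLap σ G (n * τ - 2 * τ) = V ((n : ℤ) - 2) := by
      simp only [hV]; congr 1; push_cast; ring
    rw [k1, k2, k3, ← h1, ← h2, ← h3]
    push_cast
    ring
  rw [e, ← invLap_bdf iG]
  unfold invLap
  congr 1 with y
  simp only [hG, hh₁, hh₀, discKernel, schemeKernel]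
  have hτ2 : ((τ ^ (α - 2) : ℝ) : ℂ) = ((τ ^ α : ℝ) : ℂ) * ((τ : ℂ)⁻¹ * (τ : ℂ)⁻¹) := by
    rw [Real.rpow_sub hτ, Real.rpow_two]
    push_cast
    rw [div_eq_mul_inv, sq, mul_inv]
  rw [hτ2]
  ring

/-! ### The error estimate for a family of eigenspaces -/

/-- The kernel of the scheme with step `τ` for the eigenvalue `lam`: the Laplace transform of the
output is the product of this kernel with the transform of the source. -/
noncomputable def stepKernel (α τ lam : ℝ) (s : ℂ) : ℂ :=
  (s ^ 2)⁻¹ * (((τ ^ (α - 2) : ℝ) : ℂ) * discKernel α (lam * τ ^ α) (s * τ))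

/-- The estimates of the discrete kernel that hold, uniformly in `Λ`, on the discs of radius `c‖z‖`
around the points `z` of a fundamental domain of the right half plane. -/
def KernelBound (α κ c M : ℝ) : Prop :=
  ∀ z : ℂ, 0 ≤ z.re → z.re ≤ κ → |z.im| ≤ Real.pi → z ≠ 0 → ∀ w : ℂ, ‖w - z‖ ≤ c * ‖z‖ →
    ∀ Λ : ℝ, 0 ≤ Λ → DifferentiableAt ℂ (discKernel α Λ) w ∧
      ‖discKernel α Λ w‖ ≤ M * ‖w‖ ^ (2 - α) ∧
      ‖1 / (w ^ (α : ℂ) + Λ) - discKernel α Λ w / w ^ 2‖ ≤ M * ‖w‖ ^ (2 - α)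

lemma discKernel_add_two_pi (α Λ : ℝ) (z : ℂ) (k : ℤ) :
    discKernel α Λ (z - k * (2 * Real.pi * Complex.I)) = discKernel α Λ z := by
  have e1 : Complex.exp (-(z - k * (2 * Real.pi * Complex.I))) = Complex.exp (-z) := by
    rw [neg_sub, sub_eq_neg_add, Complex.exp_add, Complex.exp_int_mul_two_pi_mul_I, mul_one]
  have e2 : Complex.exp (-(2 * (z - k * (2 * Real.pi * Complex.I)))) = Complex.exp (-(2 * z)) := by
    rw [show -(2 * (z - k * (2 * Real.pi * Complex.I)))
      = -(2 * z) + ((2 * k : ℤ) : ℂ) * (2 * Real.pi * Complex.I) by push_cast; ring,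
      Complex.exp_add, Complex.exp_int_mul_two_pi_mul_I, mul_one]
  unfold discKernel bdfSymbol avgSymbol glSymbol
  rw [e1, e2]

lemma stepKernel_differentiableAt {α τ lam : ℝ} {w : ℂ} (hw : w ≠ 0)
    (h : DifferentiableAt ℂ (discKernel α (lam * τ ^ α)) (w * τ)) :
    DifferentiableAt ℂ (stepKernel α τ lam) w := by
  unfold stepKernel
  refine ((differentiableAt_id.pow 2).inv (pow_ne_zero _ hw)).mul
    (DifferentiableAt.const_mul ?_ _)
  exact DifferentiableAt.comp w (f := fun s : ℂ => s * τ) h (by fun_prop)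

/-- Consistency of the kernels, near the point `s`. -/
lemma exactKernel_sub_stepKernel_le {α κ c M τ lam : ℝ} (hK : KernelBound α κ c M)
    (hτ : 0 < τ) (hl : 0 ≤ lam) {s : ℂ} (h0 : 0 < s.re) (hκ : s.re * τ ≤ κ)
    (him : |s.im| * τ ≤ Real.pi) {w : ℂ} (hw0 : w ≠ 0)
    (hw : ‖w - s‖ ≤ c * ‖s‖) :
    DifferentiableAt ℂ (stepKernel α τ lam) w ∧
      ‖exactKernel α lam w - stepKernel α τ lam w‖ ≤ M * τ ^ 2 * ‖w‖ ^ (2 - α) := by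
  have hs0 : s ≠ 0 := by rintro rfl; simp at h0
  have hτ' : (τ : ℂ) ≠ 0 := by exact_mod_cast hτ.ne'
  obtain ⟨h1, -, h2⟩ := hK (s * τ) (by rw [Complex.re_mul_ofReal]; positivity)
    (by rwa [Complex.re_mul_ofReal]) (by rwa [Complex.im_mul_ofReal, abs_mul, abs_of_pos hτ])
    (mul_ne_zero hs0 hτ') (w * τ) (by
      rw [← sub_mul, norm_mul, norm_mul, ← mul_assoc]
      gcongr) (lam * τ ^ α) (by positivity)
  refine ⟨stepKernel_differentiableAt hw0 h1, ?_⟩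
  have hcp : (w * τ) ^ (α : ℂ) = w ^ (α : ℂ) * ((τ ^ α : ℝ) : ℂ) := by
    rw [Complex.ofReal_cpow hτ.le, Complex.cpow_def_of_ne_zero (mul_ne_zero hw0 hτ'),
      Complex.cpow_def_of_ne_zero hw0, Complex.cpow_def_of_ne_zero hτ', mul_comm w,
      Complex.log_ofReal_mul hτ hw0, ← Complex.exp_add, Complex.ofReal_log hτ.le]
    ring_nf
  have hτα : (0 : ℝ) < τ ^ α := by positivity
  have hτα' : ((τ ^ α : ℝ) : ℂ) ≠ 0 := by exact_mod_cast hτα.ne'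
  have e : exactKernel α lam w - stepKernel α τ lam w = ((τ ^ α : ℝ) : ℂ) *
      (1 / ((w * τ) ^ (α : ℂ) + (lam * τ ^ α : ℝ)) - discKernel α (lam * τ ^ α) (w * τ)
        / (w * τ) ^ 2) := by
    unfold exactKernel stepKernel
    rw [hcp, Real.rpow_sub hτ, Real.rpow_two]
    push_cast
    rw [← add_mul, mul_sub, one_div, mul_inv]
    field_simp
  rw [e, norm_mul, Complex.norm_real, Real.norm_of_nonneg hτα.le]
  calc τ ^ α * _ ≤ τ ^ α * (M * ‖w * τ‖ ^ (2 - α)) := by gcongr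
    _ = M * τ ^ 2 * ‖w‖ ^ (2 - α) := by
      rw [norm_mul, Complex.norm_real, Real.norm_of_nonneg hτ.le,
        Real.mul_rpow (norm_nonneg _) hτ.le, Real.rpow_sub hτ, Real.rpow_two]
      field_simp

/-- The size of the discrete kernel near the point `s`, in terms of the translate `s'` of `s` by a
period. -/
lemma stepKernel_le {α κ c M τ lam : ℝ} (hK : KernelBound α κ c M)
    (hτ : 0 < τ) (hl : 0 ≤ lam) {s s' : ℂ} {k : ℤ}
    (hs' : s' * τ = s * τ - k * (2 * Real.pi * Complex.I)) (h0 : 0 < s'.re) (hκ : s'.re * τ ≤ κ)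
    (him : |s'.im| * τ ≤ Real.pi) (hM : 0 ≤ M) (hα1 : α < 1) (hc1 : c ≤ 1) {w : ℂ} (hw0 : w ≠ 0)
    (hw : ‖w - s‖ ≤ c * ‖s'‖) :
    DifferentiableAt ℂ (stepKernel α τ lam) w ∧
      ‖stepKernel α τ lam w‖ ≤ M * 2 ^ (2 - α) * ‖s'‖ ^ (2 - α) * ‖w‖ ^ (-2 : ℝ) := by
  have hs0 : s' ≠ 0 := by rintro rfl; simp at h0
  have hτ' : (τ : ℂ) ≠ 0 := by exact_mod_cast hτ.ne'
  have hw' : ‖w * τ - k * (2 * Real.pi * Complex.I) - s' * τ‖ ≤ c * ‖s' * τ‖ := by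
    rw [hs', show w * τ - k * (2 * Real.pi * Complex.I) - (s * τ - k * (2 * Real.pi * Complex.I))
      = (w - s) * τ by ring, ← hs', norm_mul, norm_mul, ← mul_assoc]
    gcongr
  obtain ⟨h1, h2, -⟩ := hK (s' * τ) (by rw [Complex.re_mul_ofReal]; positivity)
    (by rwa [Complex.re_mul_ofReal]) (by rwa [Complex.im_mul_ofReal, abs_mul, abs_of_pos hτ])
    (mul_ne_zero hs0 hτ') _ hw' (lam * τ ^ α) (by positivity)
  have hper : (fun z => discKernel α (lam * τ ^ α) (z - k * (2 * Real.pi * Complex.I)))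
      = discKernel α (lam * τ ^ α) := funext fun z => discKernel_add_two_pi _ _ _ _
  refine ⟨stepKernel_differentiableAt hw0 ?_, ?_⟩
  · rw [← hper]
    exact DifferentiableAt.comp _ (f := fun z : ℂ => z - k * (2 * Real.pi * Complex.I)) h1
      (by fun_prop)
  · rw [discKernel_add_two_pi] at h2
    have h3 : ‖w * τ - k * (2 * Real.pi * Complex.I)‖ ≤ 2 * ‖s'‖ * τ := by
      have := norm_sub_norm_le (w * τ - k * (2 * Real.pi * Complex.I)) (s' * τ)
      rw [norm_mul, Complex.norm_real, Real.norm_of_nonneg hτ.le] at *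
      nlinarith [mul_nonneg (norm_nonneg s') hτ.le]
    unfold stepKernel
    rw [norm_mul, norm_mul, norm_inv, norm_pow, Complex.norm_real,
      Real.norm_of_nonneg (by positivity), Real.rpow_neg (norm_nonneg w), Real.rpow_two]
    calc _ ≤ (‖w‖ ^ 2)⁻¹ * (τ ^ (α - 2) * (M * (2 * ‖s'‖ * τ) ^ (2 - α))) := by
          gcongr
          refine h2.trans ?_
          gcongr
          linarith
      _ = _ := by
        rw [Real.mul_rpow (by positivity) hτ.le, Real.mul_rpow (by positivity) (norm_nonneg _),
          show τ ^ (2 - α) = (τ ^ (α - 2))⁻¹ by rw [← Real.rpow_neg hτ.le, neg_sub]]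
        have : τ ^ (α - 2) ≠ 0 := (Real.rpow_pos_of_pos hτ _).ne'
        field_simp

/-- Discs around points far enough to the right stay in the truncated sector. -/
lemma disc_subset_truncSector {θ ϑ ε c : ℝ} (hϑ0 : 0 ≤ ϑ) (hϑθ : ϑ < θ)
    (hc2 : c ≤ 1 / 2) (hcϑ : 2 * c ≤ -Real.cos ϑ) {s w : ℂ} (hs : 2 * ε ≤ s.re) (hs0 : 0 < s.re)
    (hw : ‖w - s‖ ≤ c * ‖s‖) :
    w ∈ truncSector θ ε ∧ |w.arg| ≤ ϑ ∧ ‖s‖ / 2 ≤ ‖w‖ ∧ ‖w‖ ≤ 2 * ‖s‖ ∧ w ≠ 0 := by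
  have hs0' : s ≠ 0 := by rintro rfl; simp at hs0
  obtain ⟨h1, h2, h3, -, h5⟩ := cone_of_mem_disc hc2 hcϑ hs0.le hs0' hw
  have harg := abs_arg_le_of_cos_mul_norm_le_re hϑ0 h3 (by linarith)
  have := Complex.re_le_norm s
  exact ⟨⟨by linarith, by linarith⟩, harg, h1, h2, h3⟩

lemma norm_sum_mul_le {ι : Type*} [Fintype ι] {a g K : ι → ℂ} {A m : ℝ}
    (hA : ∑ k, ‖a k‖ * ‖g k‖ ≤ A) (hm : 0 ≤ m) (hK : ∀ k, ‖K k‖ ≤ m) :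
    ‖∑ k, a k * (g k * K k)‖ ≤ A * m := by
  refine (norm_sum_le _ _).trans ?_
  calc ∑ k, ‖a k * (g k * K k)‖ ≤ ∑ k, ‖a k‖ * ‖g k‖ * m := Finset.sum_le_sum fun k _ => by
        rw [norm_mul, norm_mul, ← mul_assoc]
        gcongr
        exact hK k
    _ ≤ A * m := by
      rw [← Finset.sum_mul]
      gcongr

/-- A function that is bounded by `g` up to translates of `h`. -/
lemma integral_le_add_tsum_mul {F g h : ℝ → ℝ} {a b : ℤ → ℝ} (hF : Integrable F)
    (hF0 : ∀ y, 0 ≤ F y) (hg : Integrable g) (hg0 : ∀ y, 0 ≤ g y) (hh : Integrable h)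
    (hh0 : ∀ y, 0 ≤ h y) (ha0 : ∀ k, 0 ≤ a k) (ha : Summable a)
    (H : ∀ y, ∃ k, F y ≤ g y + a k * h (y - b k)) :
    ∫ y, F y ≤ (∫ y, g y) + (∑' k, a k) * ∫ y, h y := by
  have h1 : ∀ y, ENNReal.ofReal (F y) ≤ ENNReal.ofReal (g y)
      + ∑' k, ENNReal.ofReal (a k) * ENNReal.ofReal (h (y - b k)) := fun y => by
    obtain ⟨k, hk⟩ := H y
    refine (ENNReal.ofReal_le_ofReal hk).trans ?_
    rw [ENNReal.ofReal_add (hg0 y) (mul_nonneg (ha0 k) (hh0 _)), ENNReal.ofReal_mul (ha0 k)]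
    gcongr
    exact ENNReal.le_tsum (f := fun k => ENNReal.ofReal (a k) * ENNReal.ofReal (h (y - b k))) k
  have hm : ∀ k, AEMeasurable (fun y => ENNReal.ofReal (h (y - b k))) volume := fun k =>
    (hh.comp_sub_right (b k)).aestronglyMeasurable.aemeasurable.ennreal_ofReal
  have h2 : ∫⁻ y, ENNReal.ofReal (F y) ≤ ENNReal.ofReal (∫ y, g y)
      + ENNReal.ofReal (∑' k, a k) * ENNReal.ofReal (∫ y, h y) := by
    refine (lintegral_mono h1).trans ?_
    rw [lintegral_add_left' hg.aestronglyMeasurable.aemeasurable.ennreal_ofReal,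
      lintegral_tsum fun k => (hm k).const_mul _,
      ← ofReal_integral_eq_lintegral_ofReal hg (Eventually.of_forall hg0),
      ENNReal.ofReal_tsum_of_nonneg ha0 ha, ← ENNReal.tsum_mul_right]
    refine add_le_add_right (ENNReal.tsum_le_tsum fun k => le_of_eq ?_) _
    rw [lintegral_const_mul'' _ (hm k), ofReal_integral_eq_lintegral_ofReal hh
      (Eventually.of_forall hh0), lintegral_sub_right_eq_self fun y => ENNReal.ofReal (h y)]
  have h3 : 0 ≤ ∫ y, g y := integral_nonneg hg0
  have h4 : 0 ≤ ∫ y, h y := integral_nonneg hh0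
  have h5 : 0 ≤ ∑' k, a k := tsum_nonneg ha0
  rw [← ofReal_integral_eq_lintegral_ofReal hF (Eventually.of_forall hF0), ← ENNReal.ofReal_mul h5,
    ← ENNReal.ofReal_add h3 (mul_nonneg h5 h4)] at h2
  exact (ENNReal.ofReal_le_ofReal_iff (by positivity)).1 h2

/-- The transforms `fh k` of the components of a source, with weights `a k`, are analytic in the
truncated sector and satisfy the bound on the source there. -/
structure SourceFamily {ι : Type*} [Fintype ι] (θ ε μ B : ℝ) (a : ι → ℂ) (fh : ι → ℂ → ℂ) :
    Prop where
  differentiableOn : ∀ k, DifferentiableOn ℂ (fh k) (truncSector θ ε)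
  bound : ∀ s ∈ truncSector θ ε, ∑ k, ‖a k‖ * ‖fh k s‖ ≤ B * ‖s‖ ^ (-μ - 1)

/-- The weighted sum of the products of the transforms with the kernels `K k`. -/
noncomputable def symbolSum {ι : Type*} [Fintype ι] (a : ι → ℂ) (fh K : ι → ℂ → ℂ) (s : ℂ) : ℂ :=
  ∑ k, a k * (fh k s * K k s)

lemma symbolSum_sub {ι : Type*} [Fintype ι] (a : ι → ℂ) (fh K L : ι → ℂ → ℂ) (s : ℂ) :
    symbolSum a fh (fun k s => K k s - L k s) s = symbolSum a fh K s - symbolSum a fh L s := by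
  unfold symbolSum
  rw [← Finset.sum_sub_distrib]
  exact Finset.sum_congr rfl fun k _ => by ring

section

variable {ι : Type*} [Fintype ι] {α θ ϑ ε μ B κ c M τ : ℝ} {a : ι → ℂ} {fh : ι → ℂ → ℂ}
  {lam : ι → ℝ} {K : ι → ℂ → ℂ} {s : ℂ}

/-- Bounds for the kernels on a disc carry over to the weighted sum. -/
lemma SourceFamily.disc_bound (hS : SourceFamily θ ε μ B a fh) {ρ m q : ℝ}
    (hm : 0 ≤ m) (hs : ∀ w ∈ Metric.closedBall s ρ, w ∈ truncSector θ ε ∧ w ≠ 0)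
    (hK : ∀ k, ∀ w ∈ Metric.closedBall s ρ, DifferentiableAt ℂ (K k) w ∧ ‖K k w‖ ≤ m * ‖w‖ ^ q) :
    DifferentiableOn ℂ (symbolSum a fh K) (Metric.closedBall s ρ) ∧
      ∀ w ∈ Metric.closedBall s ρ, ‖symbolSum a fh K w‖ ≤ B * m * ‖w‖ ^ (-(μ + 1 - q)) := by
  constructor
  · unfold symbolSum
    refine DifferentiableOn.fun_sum fun k _ => DifferentiableOn.const_mul ?_ _
    exact ((hS.differentiableOn k).mono fun w hw => (hs w hw).1).mul
      fun w hw => (hK k w hw).1.differentiableWithinAt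
  · intro w hw
    have hw0 : 0 < ‖w‖ := norm_pos_iff.2 (hs w hw).2
    refine (norm_sum_mul_le (hS.bound w (hs w hw).1) (m := m * ‖w‖ ^ q) (by positivity)
      fun k => (hK k w hw).2).trans (le_of_eq ?_)
    rw [show -(μ + 1 - q) = (-μ - 1) + q by ring, Real.rpow_add hw0]
    ring

/-- The third derivative of the transform of the error, at frequencies that the scheme resolves. -/
lemma norm_iteratedDeriv_error_le (hK : KernelBound α κ c M) (hS : SourceFamily θ ε μ B a fh)
    (hα : 0 < α) (hB : 0 ≤ B) (hM : 0 ≤ M) (hl : ∀ k, 0 ≤ lam k) (hτ : 0 < τ) (hc : 0 < c)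
    (hc2 : c ≤ 1 / 2) (hcϑ : 2 * c ≤ -Real.cos ϑ) (hϑ0 : 0 ≤ ϑ) (hϑθ : ϑ < θ) (hϑπ : ϑ < Real.pi)
    (hαϑ : α * ϑ < Real.pi / 2) (hs : 2 * ε ≤ s.re) (hs0 : 0 < s.re) (hκ : s.re * τ ≤ κ)
    (him : |s.im| * τ ≤ Real.pi) :
    ‖iteratedDeriv 3 (symbolSum a fh fun k s => exactKernel α (lam k) s - stepKernel α τ (lam k) s)
      s‖ ≤ 6 * (B * (M * τ ^ 2) * 2 ^ |μ + α - 1|) / c ^ 3 * ‖s‖ ^ (-(μ + α + 2)) := by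
  have hsne : s ≠ 0 := by rintro rfl; simp at hs0
  have hd := fun w (hw : w ∈ Metric.closedBall s (c * ‖s‖)) =>
    disc_subset_truncSector hϑ0 hϑθ hc2 hcϑ hs hs0 (mem_closedBall_iff_norm.1 hw)
  obtain ⟨h1, h2⟩ := hS.disc_bound (m := M * τ ^ 2) (q := 2 - α) (s := s) (ρ := c * ‖s‖)
    (K := fun k s => exactKernel α (lam k) s - stepKernel α τ (lam k) s) (by positivity)
    (fun w hw => ⟨(hd w hw).1, (hd w hw).2.2.2.2⟩) fun k w hw => by
      obtain ⟨-, harg, -, -, hw0⟩ := hd w hw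
      obtain ⟨e1, e2⟩ := exactKernel_sub_stepKernel_le hK hτ (hl k) hs0 hκ him hw0
        (mem_closedBall_iff_norm.1 hw)
      exact ⟨(exactKernel_bounds hα hϑπ hαϑ hϑ0 (hl k) hw0 harg).2.1.sub e1, e2⟩
  have h3 := norm_iteratedDeriv_le_of_decay hc hc2 hsne h1 (by positivity) h2 3
  rw [show μ + 1 - (2 - α) = μ + α - 1 by ring] at h3
  convert h3 using 3
  · norm_num [Nat.factorial]
  · push_cast; ring

/-- The third derivative of the transform of the exact solution. -/
lemma norm_iteratedDeriv_exact_le (hS : SourceFamily θ ε μ B a fh)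
    (hα : 0 < α) (hB : 0 ≤ B) (hl : ∀ k, 0 ≤ lam k) (hc : 0 < c)
    (hc2 : c ≤ 1 / 2) (hcϑ : 2 * c ≤ -Real.cos ϑ) (hϑ0 : 0 ≤ ϑ) (hϑθ : ϑ < θ) (hϑπ : ϑ < Real.pi)
    (hαϑ : α * ϑ < Real.pi / 2) (hs : 2 * ε ≤ s.re) (hs0 : 0 < s.re) :
    DifferentiableOn ℂ (symbolSum a fh fun k => exactKernel α (lam k))
      (Metric.closedBall s (c * ‖s‖)) ∧
    (∀ w ∈ Metric.closedBall s (c * ‖s‖), ‖symbolSum a fh (fun k => exactKernel α (lam k)) w‖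
      ≤ B * (Real.cos (α * ϑ))⁻¹ * ‖w‖ ^ (-(μ + α + 1))) ∧
    ‖iteratedDeriv 3 (symbolSum a fh fun k => exactKernel α (lam k)) s‖
      ≤ 6 * (B * (Real.cos (α * ϑ))⁻¹ * 2 ^ |μ + α + 1|) / c ^ 3 * ‖s‖ ^ (-(μ + α + 4)) := by
  have hsne : s ≠ 0 := by rintro rfl; simp at hs0
  have hcos : 0 < Real.cos (α * ϑ) := Real.cos_pos_of_mem_Ioo
    ⟨by have := Real.pi_pos; nlinarith [mul_nonneg hα.le hϑ0], hαϑ⟩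
  have hd := fun w (hw : w ∈ Metric.closedBall s (c * ‖s‖)) =>
    disc_subset_truncSector hϑ0 hϑθ hc2 hcϑ hs hs0 (mem_closedBall_iff_norm.1 hw)
  obtain ⟨h1, h2⟩ := hS.disc_bound (m := (Real.cos (α * ϑ))⁻¹) (q := -α) (s := s)
    (ρ := c * ‖s‖) (K := fun k => exactKernel α (lam k)) (by positivity)
    (fun w hw => ⟨(hd w hw).1, (hd w hw).2.2.2.2⟩) fun k w hw => by
      obtain ⟨-, harg, -, -, hw0⟩ := hd w hw
      exact (exactKernel_bounds hα hϑπ hαϑ hϑ0 (hl k) hw0 harg).2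
  rw [show μ + 1 - -α = μ + α + 1 by ring] at h2
  have h3 := norm_iteratedDeriv_le_of_decay hc hc2 hsne h1 (by positivity) h2 3
  refine ⟨h1, h2, ?_⟩
  convert h3 using 3
  · norm_num [Nat.factorial]
  · push_cast; ring

/-- The third derivative of the transform of the output of the scheme, at a frequency `s` whose
translate by `k` periods is `s'`. -/
lemma norm_iteratedDeriv_step_le (hK : KernelBound α κ c M) (hS : SourceFamily θ ε μ B a fh)
    (hα1 : α < 1) (hμ : -1 < μ) (hB : 0 ≤ B) (hM : 0 ≤ M) (hl : ∀ k, 0 ≤ lam k) (hτ : 0 < τ)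
    (hc : 0 < c) (hc2 : c ≤ 1 / 2) (hcϑ : 2 * c ≤ -Real.cos ϑ) (hϑ0 : 0 ≤ ϑ) (hϑθ : ϑ < θ)
    (hs : 2 * ε ≤ s.re) (hs0 : 0 < s.re) {s' : ℂ} {k : ℤ} (hk : k ≠ 0)
    (hs' : s' * τ = s * τ - k * (2 * Real.pi * Complex.I)) (hκ : s'.re * τ ≤ κ)
    (hre : 0 < s'.re) (him : |s'.im| * τ ≤ Real.pi) (hle : ‖s'‖ ≤ ‖s‖) (hks : |(k : ℝ)| ≤ ‖s‖ * τ) :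
    ‖iteratedDeriv 3 (symbolSum a fh fun k => stepKernel α τ (lam k)) s‖
      ≤ 6 * (B * M * 2 ^ (2 - α) * 2 ^ (μ + 3)) / c ^ 3 * τ ^ (μ + 3) * |(k : ℝ)| ^ (-(μ + 3))
        * ‖s'‖ ^ (-(1 + α)) := by
  have hsne : s' ≠ 0 := by rintro rfl; simp at hre
  have hs'p : 0 < ‖s'‖ := norm_pos_iff.2 hsne
  have hkp : 0 < |(k : ℝ)| := by positivity
  have hsub : ∀ w ∈ Metric.closedBall s (c * ‖s'‖), ‖w - s‖ ≤ c * ‖s‖ := fun w hw =>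
    (mem_closedBall_iff_norm.1 hw).trans (by gcongr)
  have hd := fun w (hw : w ∈ Metric.closedBall s (c * ‖s'‖)) =>
    disc_subset_truncSector hϑ0 hϑθ hc2 hcϑ hs hs0 (hsub w hw)
  obtain ⟨h1, h2⟩ := hS.disc_bound (m := M * 2 ^ (2 - α) * ‖s'‖ ^ (2 - α)) (q := -2) (s := s)
    (ρ := c * ‖s'‖) (K := fun k => stepKernel α τ (lam k)) (by positivity)
    (fun w hw => ⟨(hd w hw).1, (hd w hw).2.2.2.2⟩) fun j w hw =>
      stepKernel_le hK hτ (hl j) hs' hre hκ him hM hα1 (by linarith) (hd w hw).2.2.2.2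
        (mem_closedBall_iff_norm.1 hw)
  have h3 : ∀ w ∈ Metric.sphere s (c * ‖s'‖),
      ‖symbolSum a fh (fun k => stepKernel α τ (lam k)) w‖
        ≤ B * (M * 2 ^ (2 - α) * ‖s'‖ ^ (2 - α))
          * (|(k : ℝ)| ^ (-(μ + 3)) * 2 ^ (μ + 3) * τ ^ (μ + 3)) := fun w hw => by
    have hw' := Metric.sphere_subset_closedBall hw
    refine (h2 w hw').trans ?_
    gcongr
    rw [show μ + 1 - -2 = μ + 3 by ring]
    have h4 : |(k : ℝ)| / (2 * τ) ≤ ‖w‖ := by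
      have := (hd w hw').2.2.1
      rw [div_le_iff₀ (by positivity)]
      nlinarith
    refine (Real.rpow_le_rpow_of_nonpos (by positivity) h4 (by linarith)).trans (le_of_eq ?_)
    rw [Real.div_rpow (by positivity) (by positivity), Real.mul_rpow (by positivity) hτ.le,
      Real.rpow_neg zero_le_two, Real.rpow_neg hτ.le, ← mul_inv, div_inv_eq_mul]
    ring
  have h4 := Complex.norm_iteratedDeriv_le_of_forall_mem_sphere_norm_le 3
    (mul_pos hc hs'p) ((h1.mono Metric.closure_ball_subset_closedBall).diffContOnCl) h3
  refine h4.trans (le_of_eq ?_)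
  have h5 : ‖s'‖ ^ (-(1 + α)) = ‖s'‖ ^ (2 - α) / ‖s'‖ ^ 3 := by
    rw [← Real.rpow_natCast, ← Real.rpow_sub hs'p]
    congr 1
    push_cast; ring
  rw [h5, mul_pow]
  norm_num [Nat.factorial]
  field_simp

end

/-- The resolved frequencies contribute the first term, and so does the exact kernel beyond them;
the aliased discrete kernel contributes the second. -/
lemma exists_integral_norm_iteratedDeriv_le {α μ ϑ c M : ℝ} (hα : 0 < α) (hα1 : α < 1)
    (hμ : -1 < μ) (hϑ0 : 0 ≤ ϑ) (hϑπ : ϑ < Real.pi) (hαϑ : α * ϑ < Real.pi / 2) (hc : 0 < c)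
    (hc2 : c ≤ 1 / 2) (hcϑ : 2 * c ≤ -Real.cos ϑ) (hM : 0 ≤ M) :
    ∃ K : ℝ, 0 ≤ K ∧ ∀ (ι : Type) [Fintype ι] (θ ε κ B τ σ : ℝ) (a : ι → ℂ) (fh : ι → ℂ → ℂ)
      (lam : ι → ℝ), KernelBound α κ c M → SourceFamily θ ε μ B a fh → ϑ < θ → 0 ≤ B →
      (∀ k, 0 ≤ lam k) → 0 < τ → 2 * ε ≤ σ → 0 < σ → σ * τ ≤ κ →
      (∀ y, ContDiffAt ℂ 3 (symbolSum a fh fun k => stepKernel α τ (lam k)) (vline σ y)) →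
      Integrable (fun y => iteratedDeriv 3 (symbolSum a fh fun k => exactKernel α (lam k))
        (vline σ y) - iteratedDeriv 3 (symbolSum a fh fun k => stepKernel α τ (lam k))
        (vline σ y)) →
      ∫ y, ‖iteratedDeriv 3 (symbolSum a fh fun k => exactKernel α (lam k)) (vline σ y)
          - iteratedDeriv 3 (symbolSum a fh fun k => stepKernel α τ (lam k)) (vline σ y)‖
        ≤ K * B * (τ ^ 2 * σ ^ (-(μ + α + 1)) + τ ^ (μ + 3) * σ ^ (-α)) := by
  have hpi := Real.pi_pos
  have hcos : 0 < Real.cos (α * ϑ) := Real.cos_pos_of_mem_Ioo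
    ⟨by nlinarith [mul_nonneg hα.le hϑ0], hαϑ⟩
  set N₁ : ℝ := 6 * (M * 2 ^ |μ + α - 1|) / c ^ 3 with hN₁
  set N₂ : ℝ := 6 * ((Real.cos (α * ϑ))⁻¹ * 2 ^ |μ + α + 1|) / c ^ 3 with hN₂
  set N₃ : ℝ := 6 * (M * 2 ^ (2 - α) * 2 ^ (μ + 3)) / c ^ 3 with hN₃
  have hN₁0 : 0 ≤ N₁ := by positivity
  have hN₂0 : 0 ≤ N₂ := by positivity
  have hN₃0 : 0 ≤ N₃ := by positivity
  set Z : ℝ := ∑' k : ℤ, |(k : ℝ)| ^ (-(μ + 3)) with hZ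
  have hZ0 : 0 ≤ Z := tsum_nonneg fun k => by positivity
  have hZs : Summable fun k : ℤ => |(k : ℝ)| ^ (-(μ + 3)) :=
    Real.summable_abs_int_rpow (by linarith)
  have hL1 := lineConst_nonneg (μ + α + 2)
  have hL2 := lineConst_nonneg (1 + α)
  refine ⟨(N₁ + N₂) * lineConst (μ + α + 2) + N₃ * Z * lineConst (1 + α), by positivity, ?_⟩
  intro ι _ θ ε κ B τ σ a fh lam hK hS hϑθ hB hl hτ hε hσ hκ hcd hi
  have hτ' : (τ : ℂ) ≠ 0 := by exact_mod_cast hτ.ne'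
  set Q := symbolSum a fh fun k => exactKernel α (lam k) with hQ
  set Q' := symbolSum a fh fun k => stepKernel α τ (lam k) with hQ'
  have key := integral_le_add_tsum_mul (F := fun y => ‖iteratedDeriv 3 Q (vline σ y)
      - iteratedDeriv 3 Q' (vline σ y)‖)
    (g := fun y => (N₁ + N₂) * B * τ ^ 2 * ‖vline σ y‖ ^ (-(μ + α + 2)))
    (h := fun y => ‖vline σ y‖ ^ (-(1 + α)))
    (a := fun k : ℤ => N₃ * B * τ ^ (μ + 3) * |(k : ℝ)| ^ (-(μ + 3)))
    (b := fun k : ℤ => k * (2 * Real.pi) / τ) hi.norm (fun y => norm_nonneg _)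
    ((integrable_norm_vline_rpow hσ (by linarith)).const_mul _) (fun y => by positivity)
    (integrable_norm_vline_rpow hσ (by linarith)) (fun y => by positivity)
    (fun k => by positivity) (hZs.mul_left _) ?_
  · refine key.trans ?_
    rw [integral_const_mul, integral_norm_vline_rpow hσ, integral_norm_vline_rpow hσ, tsum_mul_left,
      ← hZ, show 1 - (μ + α + 2) = -(μ + α + 1) by ring, show 1 - (1 + α) = -α by ring]
    have e1 : 0 ≤ B * τ ^ 2 * σ ^ (-(μ + α + 1)) * (N₃ * Z * lineConst (1 + α)) := by positivity
    have e2 : 0 ≤ B * τ ^ (μ + 3) * σ ^ (-α) * ((N₁ + N₂) * lineConst (μ + α + 2)) := by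
      positivity
    linarith
  · intro y
    have hs : 2 * ε ≤ (vline σ y).re := by simpa using hε
    have hs0 : 0 < (vline σ y).re := by simpa using hσ
    have hsp := norm_vline_pos hσ y
    rcases le_or_gt (|y| * τ) Real.pi with hy | hy
    · refine ⟨0, ?_⟩
      have h1 := norm_iteratedDeriv_error_le hK hS hα hB hM hl hτ hc hc2 hcϑ hϑ0 hϑθ hϑπ hαϑ hs hs0
        (by simpa using hκ) (by simpa using hy)
      have h2 : symbolSum a fh (fun k s => exactKernel α (lam k) s - stepKernel α τ (lam k) s)
          = fun s => Q s - Q' s := funext fun s => symbolSum_sub a fh _ _ s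
      have h3 : ContDiffAt ℂ 3 Q (vline σ y) :=
        ((norm_iteratedDeriv_exact_le hS hα hB hl hc hc2 hcϑ hϑ0 hϑθ hϑπ hαϑ hs hs0).1.analyticAt
          (Metric.closedBall_mem_nhds _ (mul_pos hc hsp))).contDiffAt
      rw [h2, iteratedDeriv_fun_sub h3 (hcd y)] at h1
      have h4 : 0 ≤ N₂ * B * τ ^ 2 * ‖vline σ y‖ ^ (-(μ + α + 2)) := by positivity
      have h5 : 0 ≤ N₃ * B * τ ^ (μ + 3) * |((0 : ℤ) : ℝ)| ^ (-(μ + 3))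
        * ‖vline σ (y - (0 : ℤ) * (2 * Real.pi) / τ)‖ ^ (-(1 + α)) := by positivity
      refine h1.trans ?_
      have e : 6 * (B * (M * τ ^ 2) * 2 ^ |μ + α - 1|) / c ^ 3 = N₁ * B * τ ^ 2 := by
        rw [hN₁]; ring
      rw [e]
      linarith
    · set k : ℤ := round (y * τ / (2 * Real.pi)) with hk
      refine ⟨k, ?_⟩
      have hr : |y * τ - k * (2 * Real.pi)| ≤ Real.pi := by
        have h1 := abs_sub_round (y * τ / (2 * Real.pi))
        rw [← hk] at h1
        have h2 : y * τ - k * (2 * Real.pi) = (y * τ / (2 * Real.pi) - k) * (2 * Real.pi) := by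
          field_simp
        rw [h2, abs_mul, abs_of_pos (by positivity : 0 < 2 * Real.pi)]
        nlinarith
      have hy' : Real.pi < |y * τ| := by rwa [abs_mul, abs_of_pos hτ]
      have hk0 : k ≠ 0 := by
        intro h0
        rw [h0] at hr
        simp at hr
        simp at hy'
        linarith
      have hk1 : (1 : ℝ) ≤ |(k : ℝ)| := by exact_mod_cast Int.one_le_abs hk0
      have hky : |(k : ℝ)| ≤ |y * τ| := by
        have h1 : |(k : ℝ) * (2 * Real.pi)| ≤ |y * τ| + |y * τ - k * (2 * Real.pi)| := by
          simpa using abs_sub (y * τ) (y * τ - k * (2 * Real.pi))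
        rw [abs_mul, abs_of_pos (by positivity : 0 < 2 * Real.pi)] at h1
        have := Real.pi_gt_three
        nlinarith
      have hyn : |y * τ| ≤ ‖vline σ y‖ * τ := by
        rw [abs_mul, abs_of_pos hτ]
        gcongr
        exact abs_le_norm_vline σ y
      set y' : ℝ := y - k * (2 * Real.pi) / τ with hy'def
      have hy'τ : |y'| * τ ≤ Real.pi := by
        rw [show |y'| * τ = |y' * τ| by rw [abs_mul, abs_of_pos hτ]]
        convert hr using 2
        rw [hy'def]
        field_simp
      have hle : ‖vline σ y'‖ ≤ ‖vline σ y‖ := by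
        rw [Complex.norm_eq_sqrt_sq_add_sq, Complex.norm_eq_sqrt_sq_add_sq]
        simp only [vline_re, vline_im]
        gcongr 2
        have : |y'| ≤ |y| := le_of_mul_le_mul_right (hy'τ.trans hy.le) hτ
        exact sq_le_sq.2 this
      have h1 := norm_iteratedDeriv_step_le (s := vline σ y) (s' := vline σ y') (k := k) hK hS hα1
        hμ hB hM hl hτ hc hc2 hcϑ hϑ0 hϑθ hs hs0 hk0 (by
          rw [hy'def]
          unfold vline
          push_cast
          field_simp
          ring) (by simpa using hκ) (by simpa using hσ) (by simpa using hy'τ) hle (hky.trans hyn)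
      have h2 := (norm_iteratedDeriv_exact_le hS hα hB hl hc hc2 hcϑ hϑ0 hϑθ hϑπ hαϑ hs hs0).2.2
      have h3 : ‖vline σ y‖ ^ (-(μ + α + 4)) ≤ τ ^ 2 * ‖vline σ y‖ ^ (-(μ + α + 2)) := by
        rw [show -(μ + α + 4) = -(μ + α + 2) - (2 : ℕ) by push_cast; ring, Real.rpow_sub hsp,
          Real.rpow_natCast, div_le_iff₀ (by positivity), mul_right_comm, ← mul_pow]
        have h4 : 1 ≤ τ * ‖vline σ y‖ := by linarith [hk1.trans (hky.trans hyn)]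
        have h5 : 1 ≤ (τ * ‖vline σ y‖) ^ 2 := one_le_pow₀ h4
        have h6 : 0 ≤ ‖vline σ y‖ ^ (-(μ + α + 2)) := by positivity
        nlinarith
      refine (norm_sub_le _ _).trans ?_
      refine (add_le_add h2 h1).trans ?_
      have e1 : 6 * (B * (Real.cos (α * ϑ))⁻¹ * 2 ^ |μ + α + 1|) / c ^ 3 = N₂ * B := by
        rw [hN₂]; ring
      have e2 : 6 * (B * M * 2 ^ (2 - α) * 2 ^ (μ + 3)) / c ^ 3 = N₃ * B := by
        rw [hN₃]; ring
      rw [e1, e2]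
      have h7 : N₂ * B * ‖vline σ y‖ ^ (-(μ + α + 4))
          ≤ N₂ * B * (τ ^ 2 * ‖vline σ y‖ ^ (-(μ + α + 2))) := by gcongr
      have h8 : 0 ≤ N₁ * B * τ ^ 2 * ‖vline σ y‖ ^ (-(μ + α + 2)) := by positivity
      linarith

lemma decaysOn_stepKernel {α τ lam ε : ℝ} (hα : 0 < α) (hα1 : α < 1) (hl : 0 < lam) (hτ : 0 < τ)
    (hε : 0 ≤ ε) : DecaysOn ε 2 (stepKernel α τ lam) := by
  have hb := decaysOn_bdfSymbol hτ hε
  have h := (decaysOn_pow_inv hε 2).mul hε ((((hb.mul hε hb).mul hε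
    (decaysOn_schemeKernel (α := α) (Λ := lam * τ ^ α) hα hα1 (by positivity) hτ hε))).const_mul
      ((τ ^ (α - 2) : ℝ) : ℂ))
  norm_num at h
  convert h using 2 with s
  unfold stepKernel discKernel schemeKernel
  rw [Complex.ofReal_mul]
  ring

lemma iteratedDeriv_symbolSum {ι : Type*} [Fintype ι] {a : ι → ℂ} {fh K : ι → ℂ → ℂ} {s : ℂ}
    {n : ℕ} (h : ∀ k, ContDiffAt ℂ n (fun s => fh k s * K k s) s) :
    iteratedDeriv n (symbolSum a fh K) s
      = ∑ k, a k * iteratedDeriv n (fun s => fh k s * K k s) s := by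
  unfold symbolSum
  rw [iteratedDeriv_fun_sum fun k _ => contDiffAt_const.mul (h k)]
  exact Finset.sum_congr rfl fun k _ => iteratedDeriv_const_mul_field _ _

lemma SourceFamily.single {θ ε μ B : ℝ} {g : ℂ → ℂ}
    (hd : DifferentiableOn ℂ g (truncSector θ ε))
    (hb : ∀ s ∈ truncSector θ ε, ‖g s‖ ≤ B * ‖s‖ ^ (-μ - 1)) :
    SourceFamily θ ε μ B (fun _ : Unit => 1) fun _ => g :=
  ⟨fun _ => hd, fun s hs => by simpa using hb s hs⟩

lemma halfPlane_subset_truncSector {θ ε : ℝ} (hε : 0 ≤ ε) (hθ : Real.pi / 2 < θ) :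
    {s : ℂ | ε < s.re} ⊆ truncSector θ ε := fun s hs =>
  ⟨(le_of_lt hs).trans (Complex.re_le_norm s),
    (abs_arg_le_pi_div_two (hε.trans (le_of_lt hs))).trans_lt hθ⟩

set_option maxHeartbeats 1000000 in
/-- The error estimate for a weighted combination of scalar problems with eigenvalues `lam k`. The
constant depends neither on the eigenvalues nor on their number; this is what makes the estimate
independent of the mesh. -/
theorem exists_weighted_error_le {α μ θ ε T : ℝ} (hα : 0 < α) (hα1 : α < 1) (hμ : -1 < μ)
    (hθ : Real.pi / 2 < θ) (hε : 0 < ε) (hT : 0 < T) :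
    ∃ K : ℝ, 0 < K ∧ ∀ (ι : Type) [Fintype ι] (B τ r : ℝ) (N : ℕ) (a : ι → ℂ) (fh : ι → ℂ → ℂ)
      (lam : ι → ℝ) (f u : ι → ℝ → ℂ) (U : ι → ℤ → ℂ), 0 ≤ B → 0 < τ → N * τ = T → 0 < r →
      (∀ k, 0 < lam k) → SourceFamily θ ε μ B a fh →
      (∀ k, ∃ D, 0 ≤ D ∧ ∀ s ∈ truncSector θ ε, ‖fh k s‖ ≤ D * ‖s‖ ^ (-μ - 1)) →
      (∀ k, LapAt r (causal (f k))) →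
      (∀ k, ∀ s : ℂ, r < s.re → fh k s = bilatLap (causal (f k)) s) →
      (∀ k, IntegrableOn (u k) (Ioc 0 T)) → (∀ k, ContinuousOn (u k) (Ioc 0 T)) →
      (∀ k, ∀ t ∈ Ioc 0 T, caputo α (u k) t + lam k * primitive (u k) t = primitive (f k) t) →
      (∀ k, ∀ j ≤ 0, U k j = 0) →
      (∀ k, ∀ n : ℕ, 1 ≤ n → n ≤ N →
        ((τ ^ (-α) : ℝ) : ℂ) * ∑ j ∈ Finset.range (n + 1), (glCoeff α j : ℂ) * U k ((n : ℤ) - j)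
          + lam k * (((1 - α / 2 : ℝ) : ℂ) * U k n + ((α / 2 : ℝ) : ℂ) * U k ((n : ℤ) - 1))
        = ((1 - α / 2 : ℝ) : ℂ) * bdf2 τ (primitive (primitive (f k))) (n * τ)
          + ((α / 2 : ℝ) : ℂ) * bdf2 τ (primitive (primitive (f k))) (((n : ℝ) - 1) * τ)) →
      ∀ n : ℕ, 1 ≤ n → n ≤ N →
        ‖∑ k, a k * (u k (n * τ) - (τ : ℂ)⁻¹ * (3 / 2 * U k n - 2 * U k ((n : ℤ) - 1)
            + 1 / 2 * U k ((n : ℤ) - 2)))‖ ≤ K * B * (n * τ) ^ (α + μ - 2) * τ ^ 2 := by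
  have hpi := Real.pi_pos
  -- an angle for which `s ↦ s ^ α` maps the sector into a smaller one inside the right half plane
  obtain ⟨ϑ, hϑ1, hϑ2⟩ : ∃ ϑ, Real.pi / 2 < ϑ ∧ ϑ < min (min θ Real.pi) (Real.pi / (2 * α)) := by
    refine exists_between (lt_min (lt_min hθ (by linarith)) ?_)
    rw [div_lt_div_iff₀ (by positivity) (by positivity)]
    nlinarith
  have hϑθ : ϑ < θ := hϑ2.trans_le ((min_le_left _ _).trans (min_le_left _ _))
  have hϑπ : ϑ < Real.pi := hϑ2.trans_le ((min_le_left _ _).trans (min_le_right _ _))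
  have hαϑ : α * ϑ < Real.pi / 2 := by
    have h := hϑ2.trans_le (min_le_right _ _)
    rw [lt_div_iff₀ (by positivity)] at h
    linarith
  have hϑ0 : 0 ≤ ϑ := by linarith
  -- The integration runs over `Re s = κ / t`. The choice of `κ` makes `κ / t ≥ 2 * ε` for all
  -- `t ≤ T`, so that discs around `s` avoid `|z| < ε`, while `Re s * t` and `Re s * τ` stay bounded.
  set κ : ℝ := 2 * ε * T + 1 with hκ
  have hκ1 : 1 ≤ κ := by rw [hκ]; nlinarith
  have hκ0 : 0 < κ := by linarith
  obtain ⟨c, M, hc, hc2, hcϑ, hM, hK⟩ := exists_kernel_bounds hα hα1 hκ0 hϑ1 hϑπ hαϑ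
  have hK' : KernelBound α κ c M := hK
  obtain ⟨K, hK0, HK⟩ := exists_integral_norm_iteratedDeriv_le hα hα1 hμ hϑ0 hϑπ hαϑ hc hc2 hcϑ
    hM.le
  refine ⟨Real.exp κ * (K + 1) * 2, by positivity, ?_⟩
  intro ι _ B τ r N a fh lam f u U hB hτ hNτ hr hl hS hfb hf hfh hu huc heq hU0 hU n hn1 hnN
  set t : ℝ := n * τ with ht
  have hn1' : (1 : ℝ) ≤ n := by exact_mod_cast hn1
  have hτt : τ ≤ t := by rw [ht]; nlinarith
  have ht0 : 0 < t := by linarith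
  have htT : t ≤ T := by
    rw [ht, ← hNτ]
    gcongr
  have htI : t ∈ Ioc 0 T := ⟨ht0, htT⟩
  set σ : ℝ := κ / t with hσ
  have hσ0 : 0 < σ := by positivity
  have hσε : 2 * ε < σ := by
    rw [hσ, lt_div_iff₀ ht0, hκ]
    nlinarith
  have hεσ : ε < σ := by linarith
  have hστ : σ * τ ≤ κ := by
    rw [hσ, div_mul_eq_mul_div, div_le_iff₀ ht0]
    gcongr
  have hσt : σ * t = κ := by rw [hσ]; field_simp
  have hdec : ∀ k, DecaysOn ε (μ + 1) (fh k) := fun k => by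
    obtain ⟨D, hD0, hD⟩ := hfb k
    refine ⟨(hS.differentiableOn k).mono (halfPlane_subset_truncSector hε.le hθ), D, hD0,
      fun s hs => ?_⟩
    rw [show -(μ + 1) = -μ - 1 by ring]
    exact hD s (halfPlane_subset_truncSector hε.le hθ hs)
  -- the transforms in one eigenspace
  have hcone : ∀ k, ConeDecay σ c (μ + α + 1) fun s => fh k s * exactKernel α (lam k) s :=
    fun k => by
    obtain ⟨D, hD0, hD⟩ := hfb k
    have h1 := fun y => norm_iteratedDeriv_exact_le (s := vline σ y)
      (lam := fun _ : Unit => lam k) (SourceFamily.single (hS.differentiableOn k) hD) hα hD0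
      (fun _ => (hl k).le) hc hc2 hcϑ hϑ0 hϑθ hϑπ hαϑ (by simpa using hσε.le) (by simpa using hσ0)
    have h2 : (symbolSum (fun _ : Unit => (1 : ℂ)) (fun _ => fh k) fun _ => exactKernel α (lam k))
        = fun s => fh k s * exactKernel α (lam k) s := by
      funext s
      simp [symbolSum]
    have hcos : 0 < Real.cos (α * ϑ) := Real.cos_pos_of_mem_Ioo
      ⟨by nlinarith [mul_nonneg hα.le hϑ0], hαϑ⟩
    rw [h2] at h1
    exact ⟨D * (Real.cos (α * ϑ))⁻¹, by positivity, fun y => ⟨(h1 y).1, (h1 y).2.1⟩⟩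
  have hstep : ∀ k, DecaysOn ε (μ + 1 + 2) fun s => fh k s * stepKernel α τ (lam k) s := fun k =>
    (hdec k).mul hε.le (decaysOn_stepKernel hα hα1 (hl k) hτ hε.le)
  have hstepA : ∀ k y, AnalyticAt ℂ (fun s => fh k s * stepKernel α τ (lam k) s) (vline σ y) :=
    fun k y => (hstep k).differentiableOn.analyticAt
      ((isOpen_halfPlane ε).mem_nhds (by simpa using hεσ))
  have hexA := fun k y => (hcone k).analyticAt hσ0 hc y
  have hstepI : ∀ k j, Integrable fun y =>
      iteratedDeriv j (fun s => fh k s * stepKernel α τ (lam k) s) (vline σ y) := fun k j =>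
    ((hstep k).iteratedDeriv hε.le (show ε < 2 * ε by linarith) j).integrable_line (by linarith)
      hσε (by linarith)
  have hexI := fun k => (hcone k).integrable_iteratedDeriv hσ0 hc hc2 (k := 3)
    (by push_cast; linarith)
  have hex : ∀ k, 2 * Real.pi * ((t : ℂ) ^ 3 * u k t)
      = -invLap σ (iteratedDeriv 3 fun s => fh k s * exactKernel α (lam k) s) t := fun k =>
    exact_eq_invLap hσ0 hc hc2 (by linarith) (hu k) (huc k) (hcone k)
      (fun t ht => primitive_primitive_exact hα hα1 (hl k).le hr hε.le hμ (hu k) (heq k) (hf k)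
        (hfh k) (hdec k) hεσ ht) htI
  have hsch : ∀ k, 2 * Real.pi * ((t : ℂ) ^ 3 * ((τ : ℂ)⁻¹ * (3 / 2 * U k n
      - 2 * U k ((n : ℤ) - 1) + 1 / 2 * U k ((n : ℤ) - 2))))
      = -invLap σ (iteratedDeriv 3 fun s => fh k s * stepKernel α τ (lam k) s) t := fun k => by
    have h1 := scheme_eq_invLap hα hα1 (hl k) hτ hr hε.le hμ (hf k) (hfh k) (hdec k) (hU0 k) (hU k)
      hεσ hnN
    have h2 := cube_mul_invLap (t := t) (hstepA k) fun j _ => hstepI k j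
    rw [← h2]
    change _ = (t : ℂ) ^ 3 * invLap σ (fun s => fh k s * ((s ^ 2)⁻¹ *
      (((τ ^ (α - 2) : ℝ) : ℂ) * discKernel α (lam k * τ ^ α) (s * τ)))) t
    rw [ht, ← h1]
    ring
  set E : ℂ → ℂ := fun s => iteratedDeriv 3 (symbolSum a fh fun k => exactKernel α (lam k)) s
    - iteratedDeriv 3 (symbolSum a fh fun k => stepKernel α τ (lam k)) s with hE
  have hEline : ∀ y, E (vline σ y)
      = ∑ k, a k * (iteratedDeriv 3 (fun s => fh k s * exactKernel α (lam k) s) (vline σ y)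
        - iteratedDeriv 3 (fun s => fh k s * stepKernel α τ (lam k) s) (vline σ y)) := fun y => by
    rw [hE]
    simp only
    rw [iteratedDeriv_symbolSum fun k => (hexA k y).contDiffAt,
      iteratedDeriv_symbolSum fun k => (hstepA k y).contDiffAt, ← Finset.sum_sub_distrib]
    exact Finset.sum_congr rfl fun k _ => (mul_sub _ _ _).symm
  have hEI : Integrable fun y => E (vline σ y) := by
    simp_rw [hEline]
    exact integrable_finsetSum _ fun k _ => ((hexI k).sub (hstepI k 3)).const_mul _
  have hcd : ∀ y, ContDiffAt ℂ 3 (symbolSum a fh fun k => stepKernel α τ (lam k)) (vline σ y) :=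
    fun y => ContDiffAt.sum fun k _ => contDiffAt_const.mul (hstepA k y).contDiffAt
  have hinv : 2 * Real.pi * ((t : ℂ) ^ 3 * ∑ k, a k * (u k t - (τ : ℂ)⁻¹ * (3 / 2 * U k n
      - 2 * U k ((n : ℤ) - 1) + 1 / 2 * U k ((n : ℤ) - 2)))) = -invLap σ E t := by
    have h1 : invLap σ E t = ∑ k, a k *
        (invLap σ (iteratedDeriv 3 fun s => fh k s * exactKernel α (lam k) s) t
          - invLap σ (iteratedDeriv 3 fun s => fh k s * stepKernel α τ (lam k) s) t) := by
      simp_rw [← invLap_sub (hexI _) (hstepI _ 3), ← invLap_const_mul]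
      rw [← invLap_sum _ fun k => ((hexI k).sub (hstepI k 3)).const_mul _]
      unfold invLap
      simp_rw [hEline]
    rw [h1, Finset.mul_sum, Finset.mul_sum, ← Finset.sum_neg_distrib]
    refine Finset.sum_congr rfl fun k _ => ?_
    linear_combination a k * hex k - a k * hsch k
  have hbound := HK ι θ ε κ B τ σ a fh lam hK' hS hϑθ hB (fun k => (hl k).le) hτ hσε.le hσ0 hστ hcd
    hEI
  have hnorm := (norm_invLap_le σ t E).trans (mul_le_mul_of_nonneg_left hbound (Real.exp_nonneg _))
  rw [← norm_neg, ← hinv, norm_mul, norm_mul, norm_mul, norm_pow, Complex.norm_real,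
    Complex.norm_real, Complex.norm_ofNat, Real.norm_of_nonneg hpi.le, Real.norm_of_nonneg ht0.le,
    hσt] at hnorm
  set X := ‖∑ k, a k * (u k t - (τ : ℂ)⁻¹ * (3 / 2 * U k n
      - 2 * U k ((n : ℤ) - 1) + 1 / 2 * U k ((n : ℤ) - 2)))‖ with hX
  have hX0 : 0 ≤ X := norm_nonneg _
  -- the powers of `σ = κ / t` in terms of `t`
  have p1 : ∀ q : ℝ, 0 ≤ q → σ ^ (-q) ≤ t ^ q := fun q hq => by
    rw [hσ, Real.rpow_neg (by positivity), Real.div_rpow hκ0.le ht0.le, inv_div]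
    exact div_le_self (by positivity) (Real.one_le_rpow hκ1 hq)
  have p2 : τ ^ (μ + 3) = τ ^ 2 * τ ^ (μ + 1) := by
    rw [show μ + 3 = (2 : ℕ) + (μ + 1) by push_cast; ring, Real.rpow_add hτ, Real.rpow_natCast]
  have p3 : τ ^ 2 * σ ^ (-(μ + α + 1)) + τ ^ (μ + 3) * σ ^ (-α) ≤ 2 * (τ ^ 2 * t ^ (μ + α + 1)) := by
    have e1 : τ ^ 2 * σ ^ (-(μ + α + 1)) ≤ τ ^ 2 * t ^ (μ + α + 1) := by
      gcongr
      exact p1 _ (by linarith)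
    have e2 : τ ^ (μ + 3) * σ ^ (-α) ≤ τ ^ 2 * t ^ (μ + α + 1) := by
      rw [p2, mul_assoc, show μ + α + 1 = (μ + 1) + α by ring, Real.rpow_add ht0]
      gcongr
      · linarith
      · exact p1 _ hα.le
    linarith
  have p4 : t ^ 3 * t ^ (α + μ - 2) = t ^ (μ + α + 1) := by
    rw [← Real.rpow_natCast, ← Real.rpow_add ht0]
    congr 1; push_cast; ring
  have h3 : t ^ 3 * X ≤ t ^ 3 * (Real.exp κ * (K + 1) * 2 * B * t ^ (α + μ - 2) * τ ^ 2) := by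
    have e1 : t ^ 3 * X ≤ 2 * Real.pi * (t ^ 3 * X) := by
      have h : 0 ≤ t ^ 3 * X := by positivity
      exact le_mul_of_one_le_left h (by have := Real.pi_gt_three; linarith only [this])
    refine e1.trans (hnorm.trans ?_)
    calc _ ≤ Real.exp κ * ((K + 1) * B * (2 * (τ ^ 2 * t ^ (μ + α + 1)))) := by
          gcongr
          exact le_add_of_nonneg_right zero_le_one
      _ = _ := by rw [← p4]; ring
  exact le_of_mul_le_mul_left h3 (by positivity)

/-! ### The finite element space and the energy form -/

/-- The functions that are affine on each simplex of `K` and vanish outside of `K`. -/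
def nodalSpace {d : ℕ} (K : Geometry.SimplicialComplex ℝ (Pt d)) : Submodule ℂ (Pt d → ℂ) where
  carrier := {v | (∀ x, x ∉ K.space → v x = 0) ∧
    ∀ s ∈ K.faces, ∃ L : Pt d →ᵃ[ℝ] ℂ, EqOn v L (convexHull ℝ (s : Set (Pt d)))}
  zero_mem' := ⟨fun _ _ => rfl, fun s _ => ⟨0, fun _ _ => rfl⟩⟩
  add_mem' := by
    rintro v w ⟨hv0, hv⟩ ⟨hw0, hw⟩
    refine ⟨fun x hx => by simp [hv0 x hx, hw0 x hx], fun s hs => ?_⟩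
    obtain ⟨L, hL⟩ := hv s hs
    obtain ⟨M, hM⟩ := hw s hs
    exact ⟨L + M, fun x hx => by simp [hL hx, hM hx]⟩
  smul_mem' := by
    rintro z v ⟨hv0, hv⟩
    refine ⟨fun x hx => by simp [hv0 x hx], fun s hs => ?_⟩
    obtain ⟨L, hL⟩ := hv s hs
    exact ⟨z • L, fun x hx => by simp [hL hx]⟩

/-- A piecewise affine function is determined by its values at the vertices. -/
lemma finiteDimensional_nodalSpace {d : ℕ} {K : Geometry.SimplicialComplex ℝ (Pt d)}
    (hK : K.faces.Finite) : FiniteDimensional ℂ (nodalSpace K) := by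
  set S : Set (Pt d) := ⋃ s ∈ K.faces, (s : Set (Pt d)) with hS
  have hSf : S.Finite := hK.biUnion fun s _ => s.finite_toSet
  have : Fintype S := hSf.fintype
  refine FiniteDimensional.of_injective
    ((LinearMap.funLeft ℂ ℂ (Subtype.val : S → Pt d)).comp (nodalSpace K).subtype) ?_
  rw [← LinearMap.ker_eq_bot, LinearMap.ker_eq_bot']
  rintro ⟨v, hv0, hv⟩ h
  have hnode : ∀ x ∈ S, v x = 0 := fun x hx => congrFun h ⟨x, hx⟩
  refine Subtype.ext (funext fun x => ?_)
  change v x = 0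
  by_cases hx : x ∈ K.space
  · obtain ⟨s, hs, hxs⟩ := Geometry.SimplicialComplex.mem_space_iff.1 hx
    obtain ⟨L, hL⟩ := hv s hs
    have hsub : convexHull ℝ (s : Set (Pt d)) ⊆ L ⁻¹' {0} := by
      refine convexHull_min (fun y hy => ?_) ((convex_singleton 0).affine_preimage L)
      have : v y = L y := hL (subset_convexHull ℝ _ hy)
      rw [mem_preimage, mem_singleton_iff, ← this]
      exact hnode y (mem_biUnion hs hy)
    rw [hL hxs]
    exact hsub hxs
  · exact hv0 x hx

/-- The values of the elements of the finite element space, without their gradients. -/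
noncomputable def valueSpace {d : ℕ} (Ω : Set (Pt d)) (K : Geometry.SimplicialComplex ℝ (Pt d)) :
    Submodule ℂ (L2 Ω) :=
  (feSpace Ω K).map (LinearMap.fst ℂ (L2 Ω) (Fin d → L2 Ω))

lemma finiteDimensional_valueSpace {d : ℕ} (Ω : Set (Pt d))
    {K : Geometry.SimplicialComplex ℝ (Pt d)} (hK : K.faces.Finite) :
    FiniteDimensional ℂ (valueSpace Ω K) := by
  have := finiteDimensional_nodalSpace hK
  let Y : Submodule ℂ (L2 Ω × nodalSpace K) :=
    { carrier := {q | q.1 =ᵐ[volume.restrict Ω] (q.2 : Pt d → ℂ)}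
      zero_mem' := Lp.coeFn_zero ℂ 2 (volume.restrict Ω)
      add_mem' := fun {p q} (hp : p.1 =ᵐ[volume.restrict Ω] (p.2 : Pt d → ℂ))
        (hq : q.1 =ᵐ[volume.restrict Ω] (q.2 : Pt d → ℂ)) =>
        (Lp.coeFn_add p.1 q.1).trans (hp.add hq)
      smul_mem' := fun z p (hp : p.1 =ᵐ[volume.restrict Ω] (p.2 : Pt d → ℂ)) =>
        (Lp.coeFn_smul z p.1).trans (hp.const_smul z) }
  have hY : FiniteDimensional ℂ Y := by
    refine FiniteDimensional.of_injective
      ((LinearMap.snd ℂ (L2 Ω) (nodalSpace K)).comp Y.subtype) ?_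
    rintro ⟨⟨g, v⟩, hg⟩ ⟨⟨g', v'⟩, hg'⟩ h
    have hv : v = v' := h
    subst hv
    have h1 : g =ᵐ[volume.restrict Ω] (v : Pt d → ℂ) := hg
    have h2 : g' =ᵐ[volume.restrict Ω] (v : Pt d → ℂ) := hg'
    exact Subtype.ext (Prod.ext (Lp.ext (h1.trans h2.symm)) rfl)
  have hle : valueSpace Ω K ≤ Y.map (LinearMap.fst ℂ (L2 Ω) (nodalSpace K)) := by
    rintro g ⟨p, ⟨-, v, -, hv, hv0, hvK⟩, rfl⟩
    exact ⟨(p.1, ⟨v, hv0, hvK⟩), hv, rfl⟩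
  exact Submodule.finiteDimensional_of_le hle

/-- Weak gradients are determined by the function: the gradient is closable. -/
lemma H10_snd_eq_zero {d : ℕ} {Ω : Set (Pt d)} (hΩ : IsOpen Ω) {p : FunGrad Ω} (hp : p ∈ H10 Ω)
    (h0 : p.1 = 0) : p.2 = 0 := by
  funext i
  set e : Pt d := EuclideanSpace.single i (1 : ℝ) with he
  have hint : ∀ g : Pt d → ℝ, ContDiff ℝ ∞ g → HasCompactSupport g → tsupport g ⊆ Ω →
      ∫ x in Ω, g x • p.2 i x = 0 := by
    intro g hg hgc hgΩ
    set G : Pt d → ℂ := fun x => (g x : ℂ) with hG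
    have hGd : ContDiff ℝ ∞ G := Complex.ofRealCLM.contDiff.comp hg
    have hGc : HasCompactSupport G := hgc.comp_left (g := fun x : ℝ => (x : ℂ)) Complex.ofReal_zero
    set G' : Pt d → ℂ := fun x => fderiv ℝ G x e with hG'
    have hG'c : Continuous G' := (hGd.continuous_fderiv (by simp)).clm_apply continuous_const
    have hG's : HasCompactSupport G' := hGc.fderiv_apply (𝕜 := ℝ) e
    have mG : MemLp (fun x => starRingEnd ℂ (G x)) 2 (volume.restrict Ω) :=
      ((Complex.continuous_conj.comp hGd.continuous).memLp_of_hasCompactSupport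
        (hGc.comp_left (map_zero _))).restrict Ω
    have mG' : MemLp (fun x => starRingEnd ℂ (G' x)) 2 (volume.restrict Ω) :=
      ((Complex.continuous_conj.comp hG'c).memLp_of_hasCompactSupport
        (hG's.comp_left (map_zero _))).restrict Ω
    -- the functional `q ↦ ∫ q.2 i * g + q.1 * ∂ᵢ g`
    let Φ : FunGrad Ω →L[ℂ] ℂ :=
      (innerSL ℂ mG.toLp).comp ((ContinuousLinearMap.proj i).comp
        (ContinuousLinearMap.snd ℂ (L2 Ω) (Fin d → L2 Ω)))
      + (innerSL ℂ mG'.toLp).comp (ContinuousLinearMap.fst ℂ (L2 Ω) (Fin d → L2 Ω))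
    have inner_eq : ∀ {F : Pt d → ℂ} (mF : MemLp (fun x => starRingEnd ℂ (F x)) 2
        (volume.restrict Ω)) (q : L2 Ω), inner ℂ mF.toLp q = ∫ x in Ω, q x * F x := by
      intro F mF q
      rw [L2.inner_def]
      refine integral_congr_ae ?_
      filter_upwards [mF.coeFn_toLp] with x hx
      rw [hx, RCLike.inner_apply, RingHomCompTriple.comp_apply]
      simp
    have hΦ : H10 Ω ≤ LinearMap.ker (Φ : FunGrad Ω →ₗ[ℂ] ℂ) := by
      refine Submodule.topologicalClosure_minimal _ ?_ (ContinuousLinearMap.isClosed_ker Φ)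
      rw [Submodule.span_le]
      rintro q ⟨φ, hφ, hφc, hφΩ, hq1, hq2⟩
      change inner ℂ mG.toLp (q.2 i) + inner ℂ mG'.toLp q.1 = 0
      rw [inner_eq, inner_eq]
      have e1 : ∫ x in Ω, q.2 i x * G x = ∫ x, fderiv ℝ φ x e * G x := by
        refine Eq.trans ?_ (setIntegral_eq_integral_of_forall_compl_eq_zero (s := Ω) ?_)
        · refine integral_congr_ae ?_
          filter_upwards [hq2 i] with x hx
          rw [hx]
        · intro x hx
          have : x ∉ tsupport G := fun h => hx (hgΩ (tsupport_comp_subset Complex.ofReal_zero g h))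
          rw [image_eq_zero_of_notMem_tsupport this, mul_zero]
      have e2 : ∫ x in Ω, q.1 x * G' x = ∫ x, φ x * G' x := by
        refine Eq.trans ?_ (setIntegral_eq_integral_of_forall_compl_eq_zero (s := Ω) ?_)
        · refine integral_congr_ae ?_
          filter_upwards [hq1] with x hx
          rw [hx]
        · intro x hx
          rw [image_eq_zero_of_notMem_tsupport fun h => hx (hφΩ h), zero_mul]
      have hφ' : Continuous fun x => fderiv ℝ φ x e :=
        (hφ.continuous_fderiv (by simp)).clm_apply continuous_const
      rw [e1, e2, integral_mul_fderiv_eq_neg_fderiv_mul_of_integrable]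
      · simp
      · exact (hφ'.mul hGd.continuous).integrable_of_hasCompactSupport hGc.mul_left
      · exact (hφ.continuous.mul hG'c).integrable_of_hasCompactSupport hφc.mul_right
      · exact (hφ.continuous.mul hGd.continuous).integrable_of_hasCompactSupport hφc.mul_right
      · exact fun x _ => hφ.differentiable (by simp) x
      · exact fun x _ => hGd.differentiable (by simp) x
    have h1 : inner ℂ mG.toLp (p.2 i) + inner ℂ mG'.toLp p.1 = 0 := hΦ hp
    rw [h0, inner_zero_right, add_zero, inner_eq] at h1
    rw [← h1]
    refine integral_congr_ae (Eventually.of_forall fun x => ?_)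
    simp only [hG, Complex.real_smul]
    ring
  have hloc : LocallyIntegrableOn (p.2 i) Ω (volume.restrict Ω) :=
    ((Lp.memLp (p.2 i)).locallyIntegrable (by norm_num)).locallyIntegrableOn Ω
  have h2 := hΩ.ae_eq_zero_of_integral_contDiff_smul_eq_zero hloc hint
  refine (Lp.eq_zero_iff_ae_eq_zero).2 ?_
  filter_upwards [h2, ae_restrict_mem hΩ.measurableSet] with x hx hxΩ using hx hxΩ

lemma integrable_coeff_mul {d : ℕ} {Ω : Set (Pt d)} {k : Pt d → ℝ} {M : ℝ}
    (hk : AEMeasurable k (volume.restrict Ω)) (hM : ∀ᵐ x ∂(volume.restrict Ω), |k x| ≤ M)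
    (v w : L2 Ω) :
    Integrable (fun x => (k x : ℂ) * v x * starRingEnd ℂ (w x)) (volume.restrict Ω) := by
  have h1 := L2.integrable_inner (𝕜 := ℂ) w v
  have h2 := h1.bdd_mul (c := M) (f := fun x => (k x : ℂ))
    (Complex.continuous_ofReal.comp_aestronglyMeasurable hk.aestronglyMeasurable)
    (hM.mono fun x hx => by simpa using hx)
  refine h2.congr (Eventually.of_forall fun x => ?_)
  simp only [RCLike.inner_apply]
  ring

section

variable {d : ℕ} {Ω : Set (Pt d)} {a : Pt d → Matrix (Fin d) (Fin d) ℝ} {b : Pt d → ℝ}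

lemma integrable_energy (hA : IsEllipticPosDef Ω a b) (p q : FunGrad Ω) :
    Integrable (fun x => (∑ i, ∑ j, (a x i j : ℂ) * p.2 j x * starRingEnd ℂ (q.2 i x))
      + (b x : ℂ) * p.1 x * starRingEnd ℂ (q.1 x)) (volume.restrict Ω) := by
  obtain ⟨M, hM⟩ := hA.bounded
  refine Integrable.add ?_ (integrable_coeff_mul hA.aemeasurable_b (hM.mono fun x hx => hx.2) _ _)
  exact integrable_finsetSum _ fun i _ => integrable_finsetSum _ fun j _ =>
    integrable_coeff_mul (hA.aemeasurable_a i j) (hM.mono fun x hx => hx.1 i j) _ _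

lemma energyForm_add_left (hA : IsEllipticPosDef Ω a b) (p p' q : FunGrad Ω) :
    energyForm Ω a b (p + p') q = energyForm Ω a b p q + energyForm Ω a b p' q := by
  unfold energyForm
  rw [← integral_add (integrable_energy hA p q) (integrable_energy hA p' q)]
  refine integral_congr_ae ?_
  have h2 : ∀ᵐ x ∂(volume.restrict Ω), ∀ j, (p.2 j + p'.2 j) x = p.2 j x + p'.2 j x :=
    ae_all_iff.2 fun j => Lp.coeFn_add _ _
  filter_upwards [Lp.coeFn_add p.1 p'.1, h2] with x h1 h2
  simp only [Prod.fst_add, Prod.snd_add, Pi.add_apply] at h1 ⊢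
  simp only [h1, h2, mul_add, add_mul, Finset.sum_add_distrib]
  ring

lemma energyForm_smul_left (z : ℂ) (p q : FunGrad Ω) :
    energyForm Ω a b (z • p) q = z * energyForm Ω a b p q := by
  unfold energyForm
  rw [← integral_const_mul]
  refine integral_congr_ae ?_
  have h2 : ∀ᵐ x ∂(volume.restrict Ω), ∀ j, (z • p.2 j) x = z * p.2 j x :=
    ae_all_iff.2 fun j => Lp.coeFn_smul _ _
  filter_upwards [Lp.coeFn_smul z p.1, h2] with x h1 h2
  simp only [Prod.smul_fst, Prod.smul_snd, Pi.smul_apply, smul_eq_mul] at h1 ⊢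
  simp only [h1, h2, mul_add, Finset.mul_sum]
  congr 1
  · exact Finset.sum_congr rfl fun i _ => Finset.sum_congr rfl fun j _ => by ring
  · ring

lemma energyForm_conj_symm (hA : IsEllipticPosDef Ω a b) (p q : FunGrad Ω) :
    starRingEnd ℂ (energyForm Ω a b p q) = energyForm Ω a b q p := by
  unfold energyForm
  rw [← integral_conj]
  refine integral_congr_ae ?_
  filter_upwards [hA.symmetric] with x hx
  simp only [map_add, map_sum, map_mul, Complex.conj_ofReal, Complex.conj_conj]
  congr 1
  · rw [Finset.sum_comm]
    exact Finset.sum_congr rfl fun i _ => Finset.sum_congr rfl fun j _ => by rw [hx j i]; ring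
  · ring

end

/-- A positive definite Hermitian form on a finite-dimensional space is diagonalized by an
orthonormal basis. -/
lemma exists_orthonormal_eigenbasis {V : Type*} [NormedAddCommGroup V] [InnerProductSpace ℂ V]
    [FiniteDimensional ℂ V] {Q : V → V → ℂ} (hadd : ∀ v v' w, Q (v + v') w = Q v w + Q v' w)
    (hsmul : ∀ (z : ℂ) v w, Q (z • v) w = z * Q v w)
    (hconj : ∀ v w, starRingEnd ℂ (Q v w) = Q w v) (hpos : ∀ v, v ≠ 0 → 0 < (Q v v).re) :
    ∃ (m : ℕ) (e : OrthonormalBasis (Fin m) ℂ V) (lam : Fin m → ℝ),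
      (∀ k, 0 < lam k) ∧ ∀ v k, Q v (e k) = lam k * inner ℂ (e k) v := by
  set B := stdOrthonormalBasis ℂ V with hB
  let S : V →ₗ[ℂ] V :=
    { toFun := fun v => ∑ i, Q v (B i) • B i
      map_add' := fun v w => by simp only [hadd, add_smul, Finset.sum_add_distrib]
      map_smul' := fun z v => by
        simp only [hsmul, mul_smul, RingHom.id_apply, Finset.smul_sum] }
  have hr : ∀ v w w', Q v (w + w') = Q v w + Q v w' := fun v w w' => by
    rw [← hconj, hadd, map_add, hconj, hconj]
  have hrs : ∀ (z : ℂ) v w, Q v (z • w) = starRingEnd ℂ z * Q v w := fun z v w => by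
    rw [← hconj, hsmul, map_mul, hconj]
  let R (v : V) : V →ₗ⋆[ℂ] ℂ :=
    { toFun := Q v, map_add' := hr v, map_smul' := fun z w => hrs z v w }
  have hS : ∀ v w, inner ℂ w (S v) = Q v w := fun v w => by
    have h1 : Q v w = R v (∑ i, inner ℂ (B i) w • B i) := by rw [B.sum_repr' w]; rfl
    rw [h1, map_sum]
    change inner ℂ w (∑ i, Q v (B i) • B i) = _
    rw [inner_sum]
    refine Finset.sum_congr rfl fun i _ => ?_
    rw [inner_smul_right, map_smulₛₗ, inner_conj_symm, smul_eq_mul, mul_comm]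
    rfl
  have hsym : S.IsSymmetric := fun v w => by
    rw [hS, ← inner_conj_symm, hS, hconj]
  refine ⟨Module.finrank ℂ V, hsym.eigenvectorBasis rfl, hsym.eigenvalues rfl, ?_, ?_⟩
  all_goals
    have key : ∀ v k, Q v (hsym.eigenvectorBasis rfl k)
        = hsym.eigenvalues rfl k * inner ℂ (hsym.eigenvectorBasis rfl k) v := fun v k => by
      rw [← hS, ← hsym, hsym.apply_eigenvectorBasis, inner_smul_left, RCLike.conj_ofReal]
      rfl
  · intro k
    have h1 := hpos _ ((hsym.eigenvectorBasis rfl).orthonormal.ne_zero k)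
    rw [key, inner_self_eq_norm_sq_to_K, (hsym.eigenvectorBasis rfl).orthonormal.1 k] at h1
    simpa using h1
  · exact key

/-- The discrete operator `A_h` has an `L²`-orthonormal eigenbasis, with positive eigenvalues. -/
lemma exists_feSpace_eigenbasis {d : ℕ} {Ω : Set (Pt d)} {a : Pt d → Matrix (Fin d) (Fin d) ℝ}
    {b : Pt d → ℝ} {K : Geometry.SimplicialComplex ℝ (Pt d)} (hΩ : IsOpen Ω)
    (hA : IsEllipticPosDef Ω a b) (hK : K.faces.Finite) :
    FiniteDimensional ℂ (feSpace Ω K) ∧ ∃ (m : ℕ) (φ : Fin m → FunGrad Ω) (lam : Fin m → ℝ),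
      (∀ k, φ k ∈ feSpace Ω K) ∧ (∀ k, 0 < lam k) ∧ Orthonormal ℂ (fun k => (φ k).1) ∧
      (∀ p ∈ feSpace Ω K, ∀ k, energyForm Ω a b p (φ k) = lam k * inner ℂ (φ k).1 p.1) ∧
      ∀ p ∈ feSpace Ω K, ∑ k, ‖inner ℂ (φ k).1 p.1‖ ^ 2 = ‖p.1‖ ^ 2 := by
  have hfd := finiteDimensional_valueSpace Ω hK
  have hinj : ∀ p ∈ feSpace Ω K, p.1 = 0 → p = 0 := fun p hp h0 =>
    Prod.ext h0 (H10_snd_eq_zero hΩ hp.1 h0)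
  let F : feSpace Ω K →ₗ[ℂ] valueSpace Ω K :=
    ((LinearMap.fst ℂ (L2 Ω) (Fin d → L2 Ω)).comp (feSpace Ω K).subtype).codRestrict _
      fun p => ⟨p, p.2, rfl⟩
  have hF : Function.Bijective F := by
    constructor
    · refine LinearMap.ker_eq_bot.1 (LinearMap.ker_eq_bot'.2 fun p hp => ?_)
      exact Subtype.ext (hinj p p.2 (congrArg Subtype.val hp))
    · rintro ⟨_, p, hp, rfl⟩
      exact ⟨⟨p, hp⟩, rfl⟩
  let e := LinearEquiv.ofBijective F hF
  have hFe : ∀ v : valueSpace Ω K, ((e.symm v : feSpace Ω K) : FunGrad Ω).1 = v := fun v =>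
    congrArg Subtype.val (e.apply_symm_apply v)
  obtain ⟨m, E, lam, hl, hE⟩ := exists_orthonormal_eigenbasis
    (Q := fun v w : valueSpace Ω K =>
      energyForm Ω a b (e.symm v : FunGrad Ω) (e.symm w : FunGrad Ω))
    (fun v v' w => by
      rw [map_add]
      exact energyForm_add_left hA _ _ _)
    (fun z v w => by
      rw [map_smul]
      exact energyForm_smul_left z _ _)
    (fun v w => energyForm_conj_symm hA _ _)
    (fun v hv => hA.pos_def _ (e.symm v).2.1 (by
      rw [hFe]
      exact fun h => hv (Subtype.ext h)))
  have hfe : ∀ p (hp : p ∈ feSpace Ω K), (e.symm (F ⟨p, hp⟩) : FunGrad Ω) = p := fun p hp =>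
    congrArg Subtype.val (e.symm_apply_apply ⟨p, hp⟩)
  refine ⟨Module.Finite.equiv e.symm, m, fun k => e.symm (E k), lam, fun k => (e.symm (E k)).2, hl,
    ?_, ?_, ?_⟩
  · simp_rw [hFe]
    exact E.orthonormal.comp_linearIsometry (valueSpace Ω K).subtypeₗᵢ
  · intro p hp k
    have h := hE (F ⟨p, hp⟩) k
    simp only [hfe] at h
    rw [h, hFe]
    rfl
  · intro p hp
    simp_rw [hFe]
    exact E.sum_sq_norm_inner_right (F ⟨p, hp⟩)

lemma integrableOn_primitive {H : Type*} [NormedAddCommGroup H] [NormedSpace ℝ H] {T : ℝ}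
    {v : ℝ → H} (hv : IntegrableOn v (Ioc 0 T)) (hT : 0 ≤ T) :
    IntegrableOn (primitive v) (Ioc 0 T) := by
  have h1 : ContinuousOn (fun x => ∫ ξ in (0 : ℝ)..x, v ξ) (Icc 0 T) := by
    rw [← uIcc_of_le hT]
    refine intervalIntegral.continuousOn_primitive_interval ?_
    rw [uIcc_of_le hT]
    exact (integrableOn_Icc_iff_integrableOn_Ioc (by simp)).2 hv
  refine (h1.integrableOn_Icc.mono_set Ioc_subset_Icc_self).congr_fun (fun x hx => ?_)
    measurableSet_Ioc
  simp only [primitive, max_eq_left hx.1.le]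

section

variable {H : Type*} [NormedAddCommGroup H] [NormedSpace ℝ H] [CompleteSpace H]

lemma primitive_comp_clm (ℓ : H →L[ℝ] ℂ) {T t : ℝ} {v : ℝ → H} (hv : IntegrableOn v (Ioc 0 T))
    (hT : 0 ≤ T) (ht : t ≤ T) : primitive (fun x => ℓ (v x)) t = ℓ (primitive v t) := by
  unfold primitive
  refine ContinuousLinearMap.intervalIntegral_comp_comm ℓ ?_
  rw [intervalIntegrable_iff_integrableOn_Ioc_of_le (le_max_right _ _)]
  exact hv.mono_set (Ioc_subset_Ioc_right (max_le ht hT))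

lemma primitive_primitive_comp_clm (ℓ : H →L[ℝ] ℂ) {T t : ℝ} {v : ℝ → H}
    (hv : IntegrableOn v (Ioc 0 T)) (hT : 0 ≤ T) (ht : t ≤ T) :
    primitive (primitive fun x => ℓ (v x)) t = ℓ (primitive (primitive v) t) := by
  rw [← primitive_comp_clm ℓ (integrableOn_primitive hv hT) hT ht]
  exact primitive_congr_of_le (fun x hx => primitive_comp_clm ℓ hv hT hx) ht

lemma bdf2_primitive_comp_clm (ℓ : H →L[ℝ] ℂ) {T t τ : ℝ} {v : ℝ → H}
    (hv : IntegrableOn v (Ioc 0 T)) (hT : 0 ≤ T) (hτ : 0 ≤ τ) (ht : t ≤ T) :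
    bdf2 τ (primitive (primitive fun x => ℓ (v x))) t = ℓ (bdf2 τ (primitive (primitive v)) t) := by
  unfold bdf2
  rw [primitive_primitive_comp_clm ℓ hv hT ht,
    primitive_primitive_comp_clm ℓ hv hT (by linarith : t - τ ≤ T),
    primitive_primitive_comp_clm ℓ hv hT (by linarith : t - 2 * τ ≤ T)]
  simp only [map_add, map_sub, map_smul]

/-- The integrand of the Caputo derivative is integrable: its singularities at `0` and at `t` are
separated. -/
lemma caputo_comp_clm (ℓ : H →L[ℝ] ℂ) {α T t : ℝ} {u : ℝ → H} (hα1 : α < 1)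
    (hu : IntegrableOn u (Ioc 0 T)) (huc : ContinuousOn u (Ioc 0 T)) (ht : t ∈ Ioc 0 T) :
    caputo α (fun x => ℓ (u x)) t = ℓ (caputo α u t) := by
  have ht2 : 0 < t / 2 := half_pos ht.1
  have i1 : IntervalIntegrable (fun ζ => (t - ζ) ^ (-α) • u ζ) volume 0 (t / 2) := by
    refine IntervalIntegrable.continuousOn_smul ?_ ?_
    · rw [intervalIntegrable_iff_integrableOn_Ioc_of_le ht2.le]
      exact hu.mono_set (Ioc_subset_Ioc_right (by linarith [ht.2]))
    · rw [uIcc_of_le ht2.le]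
      refine ContinuousOn.rpow_const (by fun_prop) fun x hx => Or.inl ?_
      have := hx.2
      linarith
  have i2 : IntervalIntegrable (fun ζ => (t - ζ) ^ (-α) • u ζ) volume (t / 2) t := by
    refine IntervalIntegrable.smul_continuousOn ?_ ?_
    · have h := (intervalIntegral.intervalIntegrable_rpow' (a := t / 2) (b := 0)
        (by linarith : -1 < -α)).comp_sub_left t
      rw [sub_zero] at h
      convert h using 1
      ring
    · rw [uIcc_of_le (by linarith)]
      exact huc.mono fun x hx => ⟨ht2.trans_le hx.1, hx.2.trans ht.2⟩
  unfold caputo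
  rw [map_smul, ← ContinuousLinearMap.intervalIntegral_comp_comm ℓ (i1.trans i2)]
  simp only [map_smul]

end

/-- The primitive of a function with values in a finite-dimensional subspace. -/
lemma primitive_mem {E : Type*} [NormedAddCommGroup E] [NormedSpace ℂ E] [NormedSpace ℝ E]
    [CompleteSpace E]
    (X : Submodule ℂ E) [FiniteDimensional ℂ X] {T t : ℝ} {v : ℝ → E}
    (hv : ∀ x ∈ Ioc 0 T, v x ∈ X) (hT : 0 ≤ T) (ht : t ≤ T) : primitive v t ∈ X := by
  classical
  have : CompleteSpace X := FiniteDimensional.complete ℂ X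
  have h1 : primitive v t = ∫ x in Ioc 0 (max t 0),
      X.subtypeₗᵢ (if h : v x ∈ X then ⟨v x, h⟩ else 0) := by
    unfold primitive
    rw [intervalIntegral.integral_of_le (le_max_right _ _)]
    refine setIntegral_congr_fun measurableSet_Ioc fun x hx => ?_
    have : v x ∈ X := hv x ⟨hx.1, hx.2.trans (max_le ht hT)⟩
    simp [this]
  rw [h1, LinearIsometry.integral_comp_comm]
  exact Subtype.mem _

/-! ### The fully discrete error estimate -/

lemma bilatLap_causal (g : ℝ → ℂ) (s : ℂ) :
    bilatLap (causal g) s = ∫ t in Ioi (0 : ℝ), Complex.exp (-(s * t)) * g t := by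
  unfold bilatLap causal
  rw [← integral_indicator measurableSet_Ioi]
  congr 1 with t
  rw [indicator_mul_right]

lemma lapAt_causal {g : ℝ → ℂ} {r : ℝ}
    (h : IntegrableOn (fun t : ℝ => Complex.exp (-((r : ℂ) * t)) * g t) (Ioi 0)) :
    LapAt r (causal g) := by
  refine ⟨fun t ht => causal_of_nonpos ht, ?_⟩
  refine (h.integrable_indicator measurableSet_Ioi).congr (Eventually.of_forall fun t => ?_)
  simp only [causal]
  rw [indicator_mul_right]
  push_cast
  rfl

lemma clm_laplace {H : Type*} [NormedAddCommGroup H] [NormedSpace ℂ H] [CompleteSpace H]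
    (L : H →L[ℂ] ℂ) {f : ℝ → H} {s : ℂ}
    (hf : IntegrableOn (fun t : ℝ => Complex.exp (-(s * t)) • f t) (Ioi 0)) :
    L (laplace f s) = ∫ t in Ioi (0 : ℝ), Complex.exp (-(s * t)) * L (f t) := by
  unfold laplace
  rw [← L.integral_comp_comm hf]
  simp only [map_smul, smul_eq_mul]

/-- The error estimate for the fully discrete scheme. Expanding in the eigenbasis of the discrete
operator and pairing with the error reduces it to a weighted family of scalar problems. -/
theorem exists_norm_error_le {α μ θ ε C T : ℝ} (hα : 0 < α) (hα1 : α < 1) (hμ : -1 < μ)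
    (hθ : Real.pi / 2 < θ) (hε : 0 < ε) (hT : 0 < T) :
    ∃ c : ℝ, 0 < c ∧ ∀ (d : ℕ) (Ω : Set (Pt d)) (a : Pt d → Matrix (Fin d) (Fin d) ℝ)
      (b : Pt d → ℝ) (f : ℝ → L2 Ω), IsOpen Ω → IsEllipticPosDef Ω a b →
      IsSingularSource T θ ε μ C f →
      ∀ (K : Geometry.SimplicialComplex ℝ (Pt d)) (N : ℕ) (u : ℝ → FunGrad Ω)
        (U : ℤ → FunGrad Ω) (w : ℕ → FunGrad Ω), K.faces.Finite → 1 ≤ N →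
        IsSemidiscreteSolution Ω a b K α T 0 f u →
        IsCNIISolution Ω a b K α (T / N) N 0 f U w →
        ∀ n : ℕ, 1 ≤ n → n ≤ N →
          ‖(u (n * (T / N))).1 - (w n).1‖ ≤ c * (n * (T / N)) ^ (α + μ - 2) * (T / N) ^ 2 := by
  obtain ⟨K₀, hK₀, HK⟩ := exists_weighted_error_le hα hα1 hμ hθ hε hT
  refine ⟨K₀ * (|C| + 1), by positivity, ?_⟩
  intro d Ω a b f hΩ hA hf K N u U w hK hN hu hU n hn1 hnN
  obtain ⟨hfi, r₀, fhat, hconv, hlap, hdiff, hbound⟩ := hf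
  obtain ⟨hfd, m, φ, lam, hφ, hl, hon, hE, hpars⟩ := exists_feSpace_eigenbasis hΩ hA hK
  have hN0 : (0 : ℝ) < N := by exact_mod_cast hN
  set τ : ℝ := T / N with hτdef
  have hτ : 0 < τ := by positivity
  have hNτ : N * τ = T := by rw [hτdef]; field_simp
  set t : ℝ := n * τ with ht
  have hn1' : (1 : ℝ) ≤ n := by exact_mod_cast hn1
  have htI : ∀ n : ℕ, 1 ≤ n → n ≤ N → (n : ℝ) * τ ∈ Ioc 0 T := fun n h1 h2 => by
    have h1' : (1 : ℝ) ≤ n := by exact_mod_cast h1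
    refine ⟨by positivity, ?_⟩
    rw [← hNτ]
    gcongr
  -- the coordinates with respect to the eigenbasis
  let ℓ' : Fin m → L2 Ω →L[ℝ] ℂ := fun k => (innerSL ℂ (φ k).1).restrictScalars ℝ
  let ℓ : Fin m → FunGrad Ω →L[ℝ] ℂ := fun k =>
    (ℓ' k).comp (ContinuousLinearMap.fst ℝ (L2 Ω) (Fin d → L2 Ω))
  have hℓ : ∀ k (p : FunGrad Ω), inner ℂ (φ k).1 p.1 = ℓ k p := fun k p => rfl
  have hℓ' : ∀ k (g : L2 Ω), inner ℂ (φ k).1 g = ℓ' k g := fun k g => rfl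
  have hUmem : ∀ j : ℤ, j ≤ N → U j ∈ feSpace Ω K := fun j hj => by
    rcases le_or_gt j 0 with h | h
    · rw [hU.init j h]
      exact Submodule.zero_mem _
    · lift j to ℕ using h.le
      exact hU.mem j (by exact_mod_cast hj)
  have hreal : ∀ (z : ℝ) (p : FunGrad Ω), p ∈ feSpace Ω K → z • p ∈ feSpace Ω K :=
    fun z p hp => Submodule.smul_of_tower_mem _ z hp
  have hwmem : w n ∈ feSpace Ω K := by
    rw [hU.output n hn1 hnN]
    refine hreal _ _ (Submodule.add_mem _ (Submodule.sub_mem _ ?_ ?_) ?_)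
    · exact hreal _ _ (hUmem _ (by exact_mod_cast hnN))
    · exact hreal _ _ (hUmem _ (by omega))
    · exact hreal _ _ (hUmem _ (by omega))
  set p : FunGrad Ω := u t - w n with hp
  have hpmem : p ∈ feSpace Ω K := Submodule.sub_mem _ (hu.mem t (htI n hn1 hnN)) hwmem
  set r : ℝ := max r₀ ε + 1 with hr
  have hrε : ε < r := by
    have := le_max_right r₀ ε
    linarith
  have hrr : r₀ < r := by
    have := le_max_left r₀ ε
    linarith
  have hsec : ∀ s : ℂ, r < s.re → s ∈ truncSector θ ε := fun s hs =>
    halfPlane_subset_truncSector hε.le hθ (hrε.trans hs)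
  have hbound' : ∀ s ∈ truncSector θ ε, ‖fhat s‖ ≤ |C| * ‖s‖ ^ (-μ - 1) := fun s hs =>
    (hbound s hs).trans (by gcongr; exact le_abs_self C)
  have hbessel : ∀ g : L2 Ω, ∑ k, ‖ℓ k p‖ * ‖inner ℂ (φ k).1 g‖ ≤ ‖p.1‖ * ‖g‖ := fun g => by
    refine (Real.sum_mul_le_sqrt_mul_sqrt _ _ _).trans ?_
    have h1 : ∑ k, ‖ℓ k p‖ ^ 2 = ‖p.1‖ ^ 2 := hpars p hpmem
    rw [h1, Real.sqrt_sq (norm_nonneg _)]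
    gcongr
    exact Real.sqrt_le_iff.2 ⟨norm_nonneg _, hon.sum_inner_products_le g⟩
  have hS : SourceFamily θ ε μ (‖p.1‖ * |C|) (fun k => starRingEnd ℂ (ℓ k p))
      fun k s => inner ℂ (φ k).1 (fhat s) := by
    constructor
    · exact fun k => (innerSL ℂ (φ k).1).differentiable.comp_differentiableOn hdiff
    · intro s hs
      simp only [RCLike.norm_conj]
      refine (hbessel (fhat s)).trans ?_
      rw [mul_assoc]
      gcongr
      exact hbound' s hs
  have hlapk : ∀ k (s : ℂ), r₀ < s.re → IntegrableOn (fun t : ℝ =>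
      Complex.exp (-(s * t)) * inner ℂ (φ k).1 (f t)) (Ioi 0) := fun k s hs => by
    have h := (innerSL ℂ (φ k).1).integrable_comp (hconv s hs)
    simpa [IntegrableOn] using h
  have hfin := HK (Fin m) (‖p.1‖ * |C|) τ r N (fun k => starRingEnd ℂ (ℓ k p))
    (fun k s => inner ℂ (φ k).1 (fhat s)) lam (fun k x => ℓ' k (f x)) (fun k x => ℓ k (u x))
    (fun k j => ℓ k (U j)) (by positivity) hτ hNτ (hε.trans hrε) hl hS ?_ ?_ ?_ ?_ ?_ ?_ ?_ ?_
    n hn1 hnN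
  · have e1 : ∑ k, starRingEnd ℂ (ℓ k p) * (ℓ k (u (n * τ)) - (τ : ℂ)⁻¹ * (3 / 2 * ℓ k (U n)
        - 2 * ℓ k (U ((n : ℤ) - 1)) + 1 / 2 * ℓ k (U ((n : ℤ) - 2)))) = ((‖p.1‖ ^ 2 : ℝ) : ℂ) := by
      rw [← hpars p hpmem, Complex.ofReal_sum]
      refine Finset.sum_congr rfl fun k _ => ?_
      have e2 : ℓ k (w n) = (τ : ℂ)⁻¹ * (3 / 2 * ℓ k (U n)
          - 2 * ℓ k (U ((n : ℤ) - 1)) + 1 / 2 * ℓ k (U ((n : ℤ) - 2))) := by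
        rw [hU.output n hn1 hnN]
        simp only [map_smul, map_add, map_sub, Complex.real_smul]
        push_cast
        rfl
      rw [← e2, ← ht, ← map_sub, ← hp, hℓ, mul_comm, Complex.mul_conj, Complex.normSq_eq_norm_sq]
    rw [e1, Complex.norm_real, Real.norm_of_nonneg (by positivity)] at hfin
    change ‖p.1‖ ≤ _
    rcases (norm_nonneg p.1).eq_or_lt with h0 | h0
    · rw [← h0]
      positivity
    · have h2 : ‖p.1‖ * ‖p.1‖ ≤ ‖p.1‖ * (K₀ * |C| * t ^ (α + μ - 2) * τ ^ 2) := by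
        rw [← sq]
        refine hfin.trans (le_of_eq ?_)
        ring
      refine (le_of_mul_le_mul_left h2 h0).trans ?_
      gcongr
      linarith
  · intro k
    refine ⟨‖(φ k).1‖ * |C|, by positivity, fun s hs => ?_⟩
    refine (norm_inner_le_norm _ _).trans ?_
    rw [mul_assoc]
    gcongr
    exact hbound' s hs
  · exact fun k => lapAt_causal (hlapk k r (by simpa using hrr))
  · intro k s hs
    rw [bilatLap_causal, hlap s (hsec s hs) (hrr.trans hs)]
    exact clm_laplace (innerSL ℂ (φ k).1) (hconv s (hrr.trans hs))
  · exact fun k => (ℓ k).integrable_comp hu.integrableOn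
  · exact fun k => (ℓ k).continuous.comp_continuousOn hu.continuousOn
  · intro k x hx
    have h := hu.eq x hx (φ k) (hφ k)
    rw [hE _ (primitive_mem _ hu.mem hT.le hx.2), hℓ, hℓ, smul_zero, add_zero, hℓ'] at h
    rw [caputo_comp_clm (ℓ k) hα1 hu.integrableOn hu.continuousOn hx,
      primitive_comp_clm (ℓ k) hu.integrableOn hT.le hx.2,
      primitive_comp_clm (ℓ' k) hfi hT.le hx.2]
    exact h
  · intro k j hj
    simp only [hU.init j hj, map_zero]
  · intro k j hj1 hjN
    have h := hU.eq j hj1 hjN (φ k) (hφ k)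
    have hmem : (1 - α / 2) • U j + (α / 2) • U ((j : ℤ) - 1) ∈ feSpace Ω K :=
      Submodule.add_mem _ (hreal _ _ (hUmem _ (by exact_mod_cast hjN)))
        (hreal _ _ (hUmem _ (by omega)))
    have hjT := (htI j hj1 hjN).2
    rw [hE _ hmem, hℓ, hℓ, hℓ'] at h
    simp only [schemeData, smul_zero, add_zero, map_add, map_smul, map_sum] at h
    rw [bdf2_primitive_comp_clm (ℓ' k) hfi hT.le hτ.le hjT,
      bdf2_primitive_comp_clm (ℓ' k) hfi hT.le hτ.le (by linarith : ((j : ℝ) - 1) * τ ≤ T)]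
    simpa only [Complex.real_smul] using h

/-! ### Power-type singular sources -/

lemma truncSector_subset_slitPlane {θ ε : ℝ} (hθ : θ < Real.pi) (hε : 0 < ε) :
    truncSector θ ε ⊆ Complex.slitPlane := fun s hs => by
  rw [Complex.mem_slitPlane_iff_arg]
  refine ⟨fun h => ?_, fun h => ?_⟩
  · have := hs.2
    rw [h, abs_of_pos Real.pi_pos] at this
    linarith
  · have := hs.1
    rw [h, norm_zero] at this
    linarith

/-- The Laplace transform of `t ^ μ • g` is `Γ(μ + 1) s ^ (-μ - 1) • g`. -/
theorem isSingularSource_rpow {H : Type*} [NormedAddCommGroup H] [NormedSpace ℂ H]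
    [CompleteSpace H] (g : H) {μ θ ε : ℝ} (T : ℝ) (hμ : -1 < μ) (hθ : θ < Real.pi) (hε : 0 < ε) :
    IsSingularSource T θ ε μ (Real.Gamma (μ + 1) * ‖g‖) fun t : ℝ => t ^ μ • g := by
  have hμ' : 0 < μ + 1 := by linarith
  have hker : ∀ s : ℂ, ∀ t ∈ Ioi (0 : ℝ), Complex.exp (-(s * t)) • t ^ μ • g
      = (Complex.exp (-(s * t)) * powKer (μ + 1) t) • g := fun s t ht => by
    rw [powKer, if_pos (mem_Ioi.1 ht), add_sub_cancel_right, mul_smul, Complex.coe_smul]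
  have hint : ∀ s : ℂ, 0 < s.re →
      Integrable fun t : ℝ => Complex.exp (-(s * t)) * powKer (μ + 1) t := fun s hs =>
    (lapAt_powKer hμ' hs).integrable_exp le_rfl
  refine ⟨?_, 0, fun s => (Real.Gamma (μ + 1) * s ^ (-((μ + 1 : ℝ) : ℂ))) • g, fun s hs => ?_,
    fun s _ hs => ?_, fun s hs => ?_, fun s hs => ?_⟩
  · rcases le_or_gt T 0 with h | h
    · simp [Ioc_eq_empty h.not_gt]
    · refine Integrable.smul_const ?_ g
      rw [← IntegrableOn, ← intervalIntegrable_iff_integrableOn_Ioc_of_le h.le]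
      exact intervalIntegral.intervalIntegrable_rpow' hμ
  · exact (((hint s hs).smul_const g).integrableOn).congr_fun (fun t ht => (hker s t ht).symm)
      measurableSet_Ioi
  · unfold laplace
    beta_reduce
    rw [setIntegral_congr_fun measurableSet_Ioi (hker s), integral_smul_const,
      ← bilatLap_powKer hμ' hs]
    congr 1
    unfold bilatLap
    rw [setIntegral_eq_integral_of_forall_compl_eq_zero]
    intro t ht
    rw [powKer, if_neg (by simpa using ht), mul_zero]
  · have h1 : DifferentiableAt ℂ (fun s : ℂ => s ^ (-((μ + 1 : ℝ) : ℂ))) s :=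
      differentiableAt_id.cpow_const (truncSector_subset_slitPlane hθ hε hs)
    exact ((h1.const_mul _).smul_const g).differentiableWithinAt
  · have hs0 : s ≠ 0 := Complex.slitPlane_ne_zero (truncSector_subset_slitPlane hθ hε hs)
    rw [norm_smul, norm_mul, ← Complex.ofReal_neg, Complex.norm_cpow_real, Complex.norm_real,
      Real.norm_of_nonneg (Real.Gamma_pos_of_pos hμ').le, neg_add']
    exact le_of_eq (by ring)

end SubdiffusionCN

theorem mainTheorem1 :
    (∀ α μ θ ε C T : ℝ, 0 < α → α < 1 → -1 < μ → Real.pi / 2 < θ → θ < Real.pi → 0 < ε → 0 < T →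
      ∃ c : ℝ, 0 < c ∧
        ∀ (d : ℕ) (Ω : Set (SubdiffusionCN.Pt d)) (a : SubdiffusionCN.Pt d → Matrix (Fin d) (Fin d) ℝ)
          (b : SubdiffusionCN.Pt d → ℝ) (f : ℝ → SubdiffusionCN.L2 Ω),
          d = 1 ∨ d = 2 → IsOpen Ω → IsConnected Ω → Bornology.IsBounded Ω →
          SubdiffusionCN.IsEllipticPosDef Ω a b →
          SubdiffusionCN.IsSingularSource T θ ε μ C f →
          ∀ (K : Geometry.SimplicialComplex ℝ (SubdiffusionCN.Pt d)) (N : ℕ)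
            (u : ℝ → SubdiffusionCN.FunGrad Ω)
            (U : ℤ → SubdiffusionCN.FunGrad Ω) (w : ℕ → SubdiffusionCN.FunGrad Ω),
            SubdiffusionCN.IsTriangulation Ω K → 1 ≤ N →
            SubdiffusionCN.IsSemidiscreteSolution Ω a b K α T 0 f u →
            SubdiffusionCN.IsCNIISolution Ω a b K α (T / N) N 0 f U w →
            ∀ n : ℕ, 1 ≤ n → n ≤ N →
              ‖(u (n * (T / N))).1 - (w n).1‖
                ≤ c * (n * (T / N)) ^ (α + μ - 2) * (T / N) ^ 2)
    ∧ (∀ (d : ℕ) (Ω : Set (SubdiffusionCN.Pt d)) (g : SubdiffusionCN.L2 Ω) (μ θ ε T : ℝ),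
        -1 < μ → μ < 0 → Real.pi / 2 < θ → θ < Real.pi → 0 < ε → 0 < T →
        SubdiffusionCN.IsSingularSource T θ ε μ (Real.Gamma (μ + 1) * ‖g‖)
          (fun t : ℝ => t ^ μ • g)) := by
  constructor
  · intro α μ θ ε C T hα hα1 hμ hθ _ hε hT
    obtain ⟨c, hc, H⟩ := SubdiffusionCN.exists_norm_error_le (C := C) hα hα1 hμ hθ hε hT
    exact ⟨c, hc, fun d Ω a b f _ hΩ _ _ hA hf K N u U w hK hN hu hU =>
      H d Ω a b f hΩ hA hf K N u U w hK.finite hN hu hU⟩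
  · intro d Ω g μ θ ε T hμ _ _ hθ hε _
    exact SubdiffusionCN.isSingularSource_rpow g T hμ hθ hε
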